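/- **Theorem (two-level loop equations).** Let $N\ge 2$, $\theta\ge 1$, $a_-<a_+$ real, let $\mathcal M\subset\mathbb C$ be an open set containing $[a_-,a_+]$, and let $V^t,V^b$ be analytic on $\mathcal M$ and real-valued on $[a_-,a_+]$. On $\mathcal G=\{(x,y)\in\mathbb R^{N}\times\mathbb R^{N-1}: a_-<x_1<y_1<x_2<y_2<\cdots<y_{N-1}<x_N<a_+\}$ consider the density $$f(x,y)=\frac1{Z}\prod_{1\le i<j\le N}(x_j-x_i)\prod_{1\le i<j\le N-1}(y_j-y_i)\prod_{i=1}^{N-1}\prod_{j=1}^N|y_i-x_j|^{\theta-1}\prod_{i=1}^{N-1}e^{-N\theta V^b(y_i)}\prod_{i=1}^N e^{-N\theta V^t(x_i)},$$ $f=0$ off $\mathcal G$, where $Z$ is the integral over $\mathcal G$ of the product on the right. Then $f$ is a probability density. Let $(X_1,\dots,X_N,Y_1,\dots,Y_{N-1})$ be a random vector with density $f$, and for $z\in\mathbb C\setminus[a_-,a_+]$ put $G^t(z)=\sum_{i=1}^N\frac1{z-X_i}$, $G^b(z)=\sum_{i=1}^{N-1}\frac1{z-Y_i}$. For finite families of points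 of $\mathbb C\setminus[a_-,a_+]$, not both empty, let $\kappa(u_1,\dots,u_p;w_1,\dots,w_q)$ be the joint cumulant of $G^t(u_1),\dots,G^t(u_p),G^b(w_1),\dots,G^b(w_q)$ (the expectation if $p+q=1$). It is holomorphic in each of its points. Write $p(z)=(z-a_-)(z-a_+)$. A *contour for* a finite set $E\subset\mathbb C$ is a positively oriented closed piecewise $C^1$ curve $\Gamma$ which is contained in $\mathcal M$ together with the region it bounds, encloses $[a_-,a_+]$, and excludes the points of $E$; that is, $\Gamma\subset\mathcal M\setminus([a_-,a_+]\cup E)$ has winding number $1$ about the points of $[a_-,a_+]$ and $0$ about the points of $E$ and of $\mathbb C\setminus\mathcal M$. (i) Rank $(0,0)$. For $v\in\mathbb C\setminus[a_-,a_+]$ and every contour $\Gamma$ for $\{v\}$, $$\begin{aligned}0={}&-\frac{N\theta}{2\pi i}\int_\Gamma\frac{p(z)}{(v-z)\,p(v)}\bigl[\kappa(z;\varnothing)\,\partial_zV^t(z)+\kappa(\varnothing;z)\,\partial_zV^b(z)\bigr]dz-\frac{N^2-(1-\theta)N(N-1)}{p(v)}\\&+\frac{\kappa(v,v;\varnothing)+\kappa(v;\varnothing)^2}2+\frac{\kappa(\varnothing;v,v)+\kappa(\varnothing;v)^2}2-\frac{\partial_v\kappa(\varnothing;v)}2-\frac{\partial_v\kappa(v;\varnothing)}2\\&-(1-\theta)\bigl[\kappa(v;v)+\kappa(v;\varnothing)\kappa(\varnothing;v)\bigr].\end{aligned}$$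 (ii) Rank $(m,n)$. Let $m,n\ge0$, $m+n\ge1$, and let $v,v^1_1,\dots,v^1_m,v^2_1,\dots,v^2_n\in\mathbb C\setminus[a_-,a_+]$ with $v\ne v^1_a$ and $v\neq v^2_b$ for all $a,b$. Write $A=\{1,\dots,m\}$, $B=\{1,\dots,n\}$; in $\kappa(\cdot\,;\cdot)$ a set of indices before the semicolon stands for the corresponding points $v^1_a$ and one after it for the corresponding points $v^2_b$. Then for every contour $\Gamma$ for $\{v,v^1_1,\dots,v^1_m,v^2_1,\dots,v^2_n\}$, $$\begin{aligned}0={}&-\frac{N\theta}{2\pi i}\int_\Gamma\frac{p(z)\bigl[\partial_zV^t(z)\,\kappa(z,A;B)+\partial_zV^b(z)\,\kappa(A;z,B)\bigr]}{(v-z)\,p(v)}dz-\frac{\partial_v\kappa(v,A;B)+\partial_v\kappa(A;v,B)}2\\&+\frac{\kappa(v,v,A;B)+\kappa(A;v,v,B)}2-(1-\theta)\,\kappa(v,A;v,B)\\&+\frac12\sum_{J^t\subset A}\sum_{J^b\subset B}\Bigl[\kappa(v,J^t;J^b)\,\kappa(v,A\setminus J^t;B\setminus J^b)+\kappa(J^t;v,J^b)\,\kappa(A\setminus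 J^t;v,B\setminus J^b)\\&\qquad\qquad-2(1-\theta)\,\kappa(v,J^t;J^b)\,\kappa(A\setminus J^t;v,B\setminus J^b)\Bigr]\\&+\sum_{a=1}^m\partial_{v^1_a}\Bigl[\frac{\kappa(v,A\setminus\{a\};B)}{v-v^1_a}-\frac{p(v^1_a)\,\kappa(A;B)}{(v-v^1_a)\,p(v)}\Bigr]+\sum_{b=1}^n\partial_{v^2_b}\Bigl[\frac{\kappa(A;v,B\setminus\{b\})}{v-v^2_b}-\frac{p(v^2_b)\,\kappa(A;B)}{(v-v^2_b)\,p(v)}\Bigr].\end{aligned}$$ -/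

import Mathlib

open MeasureTheory ProbabilityTheory

noncomputable section

namespace TwoLevel

/-! ### Joint cumulants -/

/-- The joint cumulant of a finite family of complex random variables,
`∑_π (-1)^(|π|-1) (|π|-1)! ∏_{B ∈ π} E[∏_{i ∈ B} ξ i]`, the sum being over all partitions `π` of the
(nonempty) index set. For one variable it is the expectation, for two the covariance
`E[ξ η] - E[ξ] E[η]`. -/
def jointCumulant {Ω : Type*} [MeasurableSpace Ω] (P : Measure Ω) {ι : Type*} [Fintype ι]
    [DecidableEq ι] (ξ : ι → Ω → ℂ) : ℂ :=
  ∑ π : Finpartition (Finset.univ : Finset ι),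
    (-1 : ℂ) ^ (π.parts.card - 1) * ((π.parts.card - 1).factorial : ℂ) *
      ∏ B ∈ π.parts, ∫ ω, ∏ i ∈ B, ξ i ω ∂P

/-! ### The two-level log gas -/

/-- The interlacing configurations `a < x₁ < y₁ < x₂ < y₂ < ⋯ < y_{N-1} < x_N < b`. -/
def interlacingSet (N : ℕ) (a b : ℝ) : Set ((Fin N → ℝ) × (Fin (N - 1) → ℝ)) :=
  {p | (∀ i, a < p.1 i ∧ p.1 i < b) ∧
    ∀ i : Fin (N - 1), p.1 ⟨i, by omega⟩ < p.2 i ∧ p.2 i < p.1 ⟨i + 1, by omega⟩}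

/-- The unnormalized density of the two-level log gas. The potentials are functions on `ℂ` that are
real on the segment `[a, b]`; `.re` only serves to regard their values there as real numbers. -/
def weight (N : ℕ) (θ : ℝ) (Vt Vb : ℂ → ℂ) (p : (Fin N → ℝ) × (Fin (N - 1) → ℝ)) : ℝ :=
  (∏ i, ∏ j ∈ Finset.Ioi i, (p.1 j - p.1 i)) *
    (∏ i, ∏ j ∈ Finset.Ioi i, (p.2 j - p.2 i)) *
    (∏ i, ∏ j, |p.2 i - p.1 j| ^ (θ - 1)) *
    (∏ i, Real.exp (-(N * θ * (Vb (p.2 i)).re))) *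
    ∏ i, Real.exp (-(N * θ * (Vt (p.1 i)).re))

/-- The normalization constant. -/
def partitionFunction (N : ℕ) (θ a b : ℝ) (Vt Vb : ℂ → ℂ) : ℝ :=
  ∫ p in interlacingSet N a b, weight N θ Vt Vb p

open Classical in
/-- The density of the two-level log gas on `ℝ^(2N-1)`. -/
def density (N : ℕ) (θ a b : ℝ) (Vt Vb : ℂ → ℂ) (p : (Fin N → ℝ) × (Fin (N - 1) → ℝ)) : ℝ :=
  if p ∈ interlacingSet N a b then weight N θ Vt Vb p / partitionFunction N θ a b Vt Vb else 0

/-- The law of the two-level log gas. -/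
def law (N : ℕ) (θ a b : ℝ) (Vt Vb : ℂ → ℂ) : Measure ((Fin N → ℝ) × (Fin (N - 1) → ℝ)) :=
  volume.withDensity fun p => ENNReal.ofReal (density N θ a b Vt Vb p)

/-- The segment `[a, b]` as a subset of `ℂ`. -/
def segment (a b : ℝ) : Set ℂ := (fun x : ℝ => (x : ℂ)) '' Set.Icc a b

/-! ### Contours -/

/-- `γ` restricted to `[0, 1]` is piecewise continuously differentiable. -/
def IsPiecewiseC1 (γ : ℝ → ℂ) : Prop :=
  ∃ (k : ℕ) (t : ℕ → ℝ), t 0 = 0 ∧ t k = 1 ∧ (∀ i < k, t i < t (i + 1)) ∧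
    ∀ i < k, ContDiffOn ℝ 1 γ (Set.Icc (t i) (t (i + 1)))

/-- The contour integral `∫_γ F(z) dz` along `γ : [0, 1] → ℂ`. -/
def contourIntegral (γ : ℝ → ℂ) (F : ℂ → ℂ) : ℂ :=
  ∫ s in (0 : ℝ)..1, F (γ s) * deriv γ s

/-- The winding number of `γ` about `w`. -/
def windingNumber (γ : ℝ → ℂ) (w : ℂ) : ℂ :=
  (2 * Real.pi * Complex.I)⁻¹ * contourIntegral γ fun z => (z - w)⁻¹

/-- `γ` is a positively oriented closed contour which encloses the set `K`, is contained, together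
with the region that it bounds, in `M`, and excludes the points of `E` (neither on the contour nor
inside it). The points inside are those about which the winding number is not zero. -/
structure IsContour (γ : ℝ → ℂ) (M K E : Set ℂ) : Prop where
  piecewiseC1 : IsPiecewiseC1 γ
  closed : γ 0 = γ 1
  mem : ∀ s ∈ Set.Icc (0 : ℝ) 1, γ s ∈ M
  notMem_enclosed : ∀ s ∈ Set.Icc (0 : ℝ) 1, γ s ∉ K
  notMem_excluded : ∀ s ∈ Set.Icc (0 : ℝ) 1, γ s ∉ E
  encloses : ∀ w ∈ K, windingNumber γ w = 1
  excludes : ∀ w ∈ E, windingNumber γ w = 0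
  interior_subset : ∀ w ∉ M, windingNumber γ w = 0

/-! ### Stieltjes transforms, their cumulants, and the loop equations -/

/-- The Stieltjes transform `∑ i, 1 / (z - X i)` of the counting measure of the points `X i`. -/
def stieltjes {Ω : Type*} {k : ℕ} (X : Ω → Fin k → ℝ) (z : ℂ) (ω : Ω) : ℂ :=
  ∑ i, 1 / (z - (X ω i : ℂ))

variable {Ω : Type*} [MeasurableSpace Ω] {N : ℕ}

/-- `κ(u; w)`, the joint cumulant of the variables `G^t(u i)` and `G^b(w j)`. -/
def kappa (P : Measure Ω) (X : Ω → Fin N → ℝ) (Y : Ω → Fin (N - 1) → ℝ)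
    {ι ι' : Type} [Fintype ι] [DecidableEq ι] [Fintype ι'] [DecidableEq ι']
    (u : ι → ℂ) (w : ι' → ℂ) : ℂ :=
  jointCumulant P (Sum.elim (fun i => stieltjes X (u i)) (fun j => stieltjes Y (w j)))

/-- The family of points `u` with one further point `v`. -/
def adjoin {ι : Type} (v : ℂ) (u : ι → ℂ) : Option ι → ℂ := fun o => o.elim v u

/-- The subfamily of `u` with indices in `J`. -/
def sub {ι : Type} (u : ι → ℂ) (J : Finset ι) : J → ℂ := fun i => u i

/-- The right-hand side of the loop equation of rank `(0, 0)`. -/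
def rankZeroExpr (P : Measure Ω) (X : Ω → Fin N → ℝ) (Y : Ω → Fin (N - 1) → ℝ) (θ a b : ℝ)
    (Vt Vb : ℂ → ℂ) (γ : ℝ → ℂ) (v : ℂ) : ℂ :=
  - (N * θ / (2 * Real.pi * Complex.I) * contourIntegral γ fun z =>
      (z - a) * (z - b) / ((v - z) * (v - a) * (v - b)) *
        (kappa P X Y ![z] ![] * deriv Vt z + kappa P X Y ![] ![z] * deriv Vb z))
  - ((N : ℂ) ^ 2 - (1 - θ) * N * (N - 1)) / ((v - a) * (v - b))
  + (kappa P X Y ![v, v] ![] + kappa P X Y ![v] ![] ^ 2) / 2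
  + (kappa P X Y ![] ![v, v] + kappa P X Y ![] ![v] ^ 2) / 2
  - deriv (fun z => kappa P X Y ![] ![z]) v / 2
  - deriv (fun z => kappa P X Y ![z] ![]) v / 2
  - (1 - θ) * (kappa P X Y ![v] ![v] + kappa P X Y ![v] ![] * kappa P X Y ![] ![v])

/-- The right-hand side of the loop equation of rank `(m, n)`. -/
def rankExpr (P : Measure Ω) (X : Ω → Fin N → ℝ) (Y : Ω → Fin (N - 1) → ℝ) (θ a b : ℝ)
    (Vt Vb : ℂ → ℂ) (γ : ℝ → ℂ) (v : ℂ) {m n : ℕ} (v₁ : Fin m → ℂ) (v₂ : Fin n → ℂ) : ℂ :=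
  - (N * θ / (2 * Real.pi * Complex.I) * contourIntegral γ fun z =>
      (z - a) * (z - b) *
        (deriv Vt z * kappa P X Y (adjoin z v₁) v₂ + deriv Vb z * kappa P X Y v₁ (adjoin z v₂)) /
          ((v - z) * (v - a) * (v - b)))
  - (deriv (fun z => kappa P X Y (adjoin z v₁) v₂) v +
      deriv (fun z => kappa P X Y v₁ (adjoin z v₂)) v) / 2
  + (kappa P X Y (adjoin v (adjoin v v₁)) v₂ + kappa P X Y v₁ (adjoin v (adjoin v v₂))) / 2
  - (1 - θ) * kappa P X Y (adjoin v v₁) (adjoin v v₂)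
  + 1 / 2 * ∑ Jt : Finset (Fin m), ∑ Jb : Finset (Fin n),
      (kappa P X Y (adjoin v (sub v₁ Jt)) (sub v₂ Jb) *
          kappa P X Y (adjoin v (sub v₁ Jtᶜ)) (sub v₂ Jbᶜ)
        + kappa P X Y (sub v₁ Jt) (adjoin v (sub v₂ Jb)) *
          kappa P X Y (sub v₁ Jtᶜ) (adjoin v (sub v₂ Jbᶜ))
        - 2 * (1 - θ) * (kappa P X Y (adjoin v (sub v₁ Jt)) (sub v₂ Jb) *
          kappa P X Y (sub v₁ Jtᶜ) (adjoin v (sub v₂ Jbᶜ))))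
  + ∑ i : Fin m, deriv (fun w =>
      kappa P X Y (adjoin v (sub v₁ {i}ᶜ)) v₂ / (v - w)
        - (w - a) * (w - b) * kappa P X Y (Function.update v₁ i w) v₂ /
          ((v - w) * (v - a) * (v - b))) (v₁ i)
  + ∑ j : Fin n, deriv (fun w =>
      kappa P X Y v₁ (adjoin v (sub v₂ {j}ᶜ)) / (v - w)
        - (w - a) * (w - b) * kappa P X Y v₁ (Function.update v₂ j w) /
          ((v - w) * (v - a) * (v - b))) (v₂ j)

end TwoLevel

end

/-! The loop equations are Ward identities. Put `p(z) = (z - a)(z - b)` and `h(x) = p(x) / (v - x)`,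
and move every point of both levels by `x ↦ x + t h(x)`, where `h` is replaced in turn by its real
and its imaginary part. The end points are fixed and, for small `t`, the order of the points is
kept, so the interlacing domain is mapped onto itself and the integral of weight times `F` can be
rewritten by this change of variables. Differentiation at `t = 0` gives `E[Λ F + δF] = 0`, where `δ`
is the derivative along `h` and `Λ` is the logarithmic derivative of the weight, Jacobian included
(`ward_real`, `ward_loopField`). As `θ ≥ 1`, the weight is continuous up to the boundary, and
compactness supplies every domination.

The divided differences of `h` are `p(v) / ((v - x)(v - y)) - 1`. Hence the pair interactions and
the Jacobian add up to expressions quadratic in the Stieltjes transforms at `v`, and the summands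
`-1` to the constant `-(N² - (1 - θ)N(N - 1))` (`loopLog_eq`). The rest of `Λ` is `-Nθ` times the
sum of `h V'` over both levels. A contour that winds once about the segment and not about `v` turns
`h(x) V'(x)` into the integral of `p(z) V'(z) / ((v - z)(z - x))`, whose expectation involves `G(z)`
(`contourIntegral_expectation`). The contour is known only through its winding numbers, so Cauchy's
formula is needed in its homology form, which is proved by Dixon's argument (`dixon`,
`contourIntegral_cauchy`).

For the higher ranks `F` is the element `Q T` (`cumulantDual`) for which `E[η Q T]` is the joint
cumulant of `η` and the `ξ i`, `i ∈ T`. With variables `s i` of square zero, `Q T` is the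
coefficient of `∏ s i` in `exp(∑ s i ξ i) / E[exp(∑ s i ξ i)]`; subset convolution is the product of
such series. Three facts are used. `E[Q T] = 0` if `T` is not empty, so the constant disappears.
`E[ξ a ξ b Q T]` is a cumulant plus a sum of products of two cumulants over the splittings of `T`
(`map_mul_mul_cumulantDual`). Finally `δ(Q T) = ∑ δ(ξ i) Q (T \ {i})` (`derivation_cumulantDual`);
here `δG(w) = ∑ h(x) / (w - x)²`, whose partial fractions are exactly the `w`-derivatives in the
equation (`deriv_variation`). -/

open MeasureTheory ProbabilityTheory

noncomputable section

namespace TwoLevel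

/-! ### Cumulants of a set function -/

section SetCumulant

variable {ι : Type*} [DecidableEq ι]

/-- The cumulants associated with a set function `m` of moments. -/
def setCumulant (m : Finset ι → ℂ) (T : Finset ι) : ℂ :=
  ∑ π : Finpartition T,
    (-1 : ℂ) ^ (π.parts.card - 1) * ((π.parts.card - 1).factorial : ℂ) * ∏ B ∈ π.parts, m B

/-- The partitions of `T`, as sets of blocks. -/
def partitions (T : Finset ι) : Finset (Finset (Finset ι)) :=
  Finset.univ.image (Finpartition.parts (a := T))

theorem mem_partitions {T : Finset ι} {p : Finset (Finset ι)} :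
    p ∈ partitions T ↔ ∅ ∉ p ∧ (p : Set (Finset ι)).PairwiseDisjoint id ∧ p.sup id = T := by
  constructor
  · intro h
    obtain ⟨π, -, rfl⟩ := Finset.mem_image.1 h
    exact ⟨π.bot_notMem, π.disjoint, π.sup_parts⟩
  · rintro ⟨h₁, h₂, h₃⟩
    exact Finset.mem_image.2
      ⟨⟨p, Finset.supIndep_iff_pairwiseDisjoint.2 h₂, h₃, h₁⟩, Finset.mem_univ _, rfl⟩

theorem setCumulant_eq_sum_partitions (m : Finset ι → ℂ) (T : Finset ι) :
    setCumulant m T = ∑ p ∈ partitions T,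
      (-1 : ℂ) ^ (p.card - 1) * ((p.card - 1).factorial : ℂ) * ∏ B ∈ p, m B := by
  rw [partitions, Finset.sum_image]
  · rfl
  · intro π _ π' _ h
    exact Finpartition.ext h

theorem mem_sup_id {p : Finset (Finset ι)} {x : ι} : x ∈ p.sup id ↔ ∃ B ∈ p, x ∈ B := by
  simp [Finset.mem_sup]

theorem subset_of_mem_partitions {T : Finset ι} {p : Finset (Finset ι)} (hp : p ∈ partitions T)
    {B : Finset ι} (hB : B ∈ p) : B ⊆ T := by
  intro x hx
  rw [← (mem_partitions.1 hp).2.2, mem_sup_id]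
  exact ⟨B, hB, hx⟩

theorem card_filter_notMem_partition {T : Finset ι} {p : Finset (Finset ι)}
    (hp : p ∈ partitions T) {a : ι} (ha : a ∈ T) :
    (p.filter (a ∉ ·)).card = p.card - 1 := by
  obtain ⟨-, h₂, h₃⟩ := mem_partitions.1 hp
  obtain ⟨B, hB, haB⟩ := mem_sup_id.1 (h₃ ▸ ha)
  have : p.filter (a ∉ ·) = p.erase B := by
    ext C
    simp only [Finset.mem_filter, Finset.mem_erase]
    constructor
    · rintro ⟨hC, haC⟩
      exact ⟨fun h => haC (h ▸ haB), hC⟩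
    · rintro ⟨hne, hC⟩
      exact ⟨hC, fun haC => Finset.disjoint_left.1 (h₂ hC hB hne) haC haB⟩
  rw [this, Finset.card_erase_of_mem hB]

/-- This map and the one of `erase_mem_partitions` are mutually inverse. They identify a partition
of `a ∪ U`, `U` a proper subset of `S`, with a partition of `a ∪ S` having a marked block `S \ U`
that does not contain `a`. -/
theorem insert_sdiff_mem_partitions {a : ι} {S U : Finset ι} (haS : a ∉ S) (hU : U ⊂ S)
    {p : Finset (Finset ι)} (hp : p ∈ partitions (insert a U)) :
    insert (S \ U) p ∈ partitions (insert a S) ∧ S \ U ∉ p := by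
  obtain ⟨h₁, h₂, h₃⟩ := mem_partitions.1 hp
  have hne : (S \ U).Nonempty := Finset.sdiff_nonempty.2 hU.2
  have hdisj : ∀ C ∈ p, Disjoint (S \ U) C := by
    intro C hC
    refine Finset.disjoint_left.2 fun x hx hxC => ?_
    have := subset_of_mem_partitions hp hC hxC
    simp only [Finset.mem_sdiff, Finset.mem_insert] at hx this
    rcases this with rfl | h
    · exact haS hx.1
    · exact hx.2 h
  have hnot : S \ U ∉ p := fun h => by
    obtain ⟨x, hx⟩ := hne
    exact Finset.disjoint_left.1 (hdisj _ h) hx hx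
  refine ⟨mem_partitions.2 ⟨?_, ?_, ?_⟩, hnot⟩
  · rw [Finset.mem_insert, not_or]
    exact ⟨hne.ne_empty.symm, h₁⟩
  · rw [Finset.coe_insert, Set.pairwiseDisjoint_insert]
    exact ⟨h₂, fun C hC _ => hdisj C hC⟩
  · rw [Finset.sup_insert, h₃]
    ext x
    have := @hU.1 x
    simp only [id, Finset.sup_eq_union, Finset.mem_union, Finset.mem_sdiff, Finset.mem_insert]
    tauto

theorem erase_mem_partitions {a : ι} {S : Finset ι} {p : Finset (Finset ι)} (haS : a ∉ S)
    (hp : p ∈ partitions (insert a S)) {B : Finset ι} (hB : B ∈ p) (haB : a ∉ B) :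
    B ⊆ S ∧ B.Nonempty ∧ p.erase B ∈ partitions (insert a (S \ B)) := by
  obtain ⟨h₁, h₂, h₃⟩ := mem_partitions.1 hp
  have hBS : B ⊆ S := (Finset.subset_insert_iff_of_notMem haB).1 (subset_of_mem_partitions hp hB)
  refine ⟨hBS, Finset.nonempty_iff_ne_empty.2 fun h => h₁ (h ▸ hB), mem_partitions.2 ⟨?_, ?_, ?_⟩⟩
  · exact fun h => h₁ (Finset.mem_of_mem_erase h)
  · exact h₂.subset (by simp)
  · ext x
    have hx : (∃ C ∈ p, x ∈ C) ↔ x ∈ insert a S := by rw [← mem_sup_id, h₃]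
    simp only [mem_sup_id, Finset.mem_erase, Finset.mem_insert, Finset.mem_sdiff] at hx ⊢
    constructor
    · rintro ⟨C, ⟨hne, hC⟩, hxC⟩
      have hxB : x ∉ B := fun h => Finset.disjoint_left.1 (h₂ hC hB hne) hxC h
      have := hx.1 ⟨C, hC, hxC⟩
      tauto
    · intro h
      have hxB : x ∉ B := by
        rcases h with rfl | h
        · exact haB
        · exact h.2
      obtain ⟨C, hC, hxC⟩ := hx.2 (by tauto)
      exact ⟨C, ⟨fun h => hxB (h ▸ hxC), hC⟩, hxC⟩

theorem signed_factorial_cancel (r : ℕ) (hr : 2 ≤ r) :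
    (-1 : ℂ) ^ (r - 1) * ((r - 1).factorial : ℂ)
      + ((r - 1 : ℕ) : ℂ) * ((-1 : ℂ) ^ (r - 1 - 1) * ((r - 1 - 1).factorial : ℂ)) = 0 := by
  obtain ⟨k, rfl⟩ := Nat.exists_eq_add_of_le hr
  have h₁ : 2 + k - 1 = k + 1 := by omega
  rw [h₁, Nat.add_sub_cancel, Nat.factorial_succ, pow_succ]
  push_cast
  ring

/-- The recursion between moments and cumulants. -/
theorem moment_eq_sum_setCumulant (m : Finset ι → ℂ) (hm : m ∅ = 1) {a : ι} {S : Finset ι}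
    (haS : a ∉ S) :
    m (insert a S) = ∑ U ∈ S.powerset, setCumulant m (insert a U) * m (S \ U) := by
  -- The terms with `U ≠ S` run over the partitions of `a ∪ S` with a marked block avoiding `a`; the
  -- coefficient is that of the partition without the marked block, which has one block fewer.
  have hmarked : ∑ U ∈ S.ssubsets, setCumulant m (insert a U) * m (S \ U)
      = ∑ p ∈ partitions (insert a S), ∑ B ∈ p.filter (a ∉ ·),
        (-1 : ℂ) ^ (p.card - 1 - 1) * ((p.card - 1 - 1).factorial : ℂ) * ∏ C ∈ p, m C := by
    simp_rw [setCumulant_eq_sum_partitions, Finset.sum_mul]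
    rw [Finset.sum_sigma', Finset.sum_sigma']
    refine Finset.sum_bij' (fun x _ => ⟨insert (S \ x.1) x.2, S \ x.1⟩)
      (fun y _ => ⟨S \ y.2, y.1.erase y.2⟩) ?_ ?_ ?_ ?_ ?_
    · rintro ⟨U, p⟩ h
      simp only [Finset.mem_sigma, Finset.mem_ssubsets, Finset.mem_filter] at h ⊢
      exact ⟨(insert_sdiff_mem_partitions haS h.1 h.2).1, Finset.mem_insert_self _ _,
        fun h => haS (Finset.mem_sdiff.1 h).1⟩
    · rintro ⟨p, B⟩ h
      simp only [Finset.mem_sigma, Finset.mem_ssubsets, Finset.mem_filter] at h ⊢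
      obtain ⟨h₁, h₂, h₃⟩ := erase_mem_partitions haS h.1 h.2.1 h.2.2
      exact ⟨Finset.sdiff_ssubset h₁ h₂, h₃⟩
    · rintro ⟨U, p⟩ h
      simp only [Finset.mem_sigma, Finset.mem_ssubsets] at h
      simp [Finset.erase_insert (insert_sdiff_mem_partitions haS h.1 h.2).2,
        Finset.inter_eq_right.2 h.1.1]
    · rintro ⟨p, B⟩ h
      simp only [Finset.mem_sigma, Finset.mem_filter] at h
      obtain ⟨h₁, -, -⟩ := erase_mem_partitions haS h.1 h.2.1 h.2.2
      simp [Finset.inter_eq_right.2 h₁, Finset.insert_erase h.2.1]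
    · rintro ⟨U, p⟩ h
      simp only [Finset.mem_sigma, Finset.mem_ssubsets] at h
      have hnot := (insert_sdiff_mem_partitions haS h.1 h.2).2
      simp only [Finset.prod_insert hnot, Finset.card_insert_of_notMem hnot, Nat.add_sub_cancel]
      ring
  -- The term `U = S` is the sum over unmarked partitions. A partition with `r ≥ 2` blocks has `r -
  -- 1` blocks avoiding `a`, so its two contributions cancel by `signed_factorial_cancel`; only the
  -- partition with a single block survives.
  rw [← Finset.insert_erase (Finset.mem_powerset_self S), Finset.sum_insert (by simp),
    ← Finset.ssubsets, hmarked, Finset.sdiff_self, hm, mul_one,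
    setCumulant_eq_sum_partitions, ← Finset.sum_add_distrib]
  have hsing : ({insert a S} : Finset (Finset ι)) ∈ partitions (insert a S) :=
    mem_partitions.2 ⟨by simp [(Finset.insert_nonempty a S).ne_empty.symm], by simp, by simp⟩
  rw [Finset.sum_eq_single_of_mem _ hsing]
  · simp
  · intro p hp hne
    rw [Finset.sum_const, nsmul_eq_mul,
      card_filter_notMem_partition hp (Finset.mem_insert_self a S), ← mul_assoc, ← add_mul,
      signed_factorial_cancel, zero_mul]
    by_contra! h
    have hcard : p.card = 1 := by
      have : p.card ≠ 0 := fun h0 => by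
        have := (mem_partitions.1 hp).2.2
        rw [Finset.card_eq_zero.1 h0] at this
        exact (Finset.insert_nonempty a S).ne_empty (by simpa using this.symm)
      omega
    obtain ⟨B, rfl⟩ := Finset.card_eq_one.1 hcard
    have := (mem_partitions.1 hp).2.2
    simp only [Finset.sup_singleton, id] at this
    exact hne (by rw [this])

/-! ### Subset convolution -/

/-- The subset convolution of two set functions. -/
def conv {R : Type*} [CommRing R] (f g : Finset ι → R) (T : Finset ι) : R :=
  ∑ U ∈ T.powerset, f U * g (T \ U)

section conv

variable {R : Type*} [CommRing R]

theorem conv_comm (f g : Finset ι → R) : conv f g = conv g f := by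
  ext T
  refine Finset.sum_bij' (fun U _ => T \ U) (fun U _ => T \ U) ?_ ?_ ?_ ?_ ?_
  · intro U _; simp
  · intro U _; simp
  · intro U hU; simpa using Finset.mem_powerset.1 hU
  · intro U hU; simpa using Finset.mem_powerset.1 hU
  · intro U hU
    rw [Finset.sdiff_sdiff_eq_self (Finset.mem_powerset.1 hU), mul_comm]

/-- Both sides sum over the ordered splittings of `T` into three disjoint parts. -/
theorem conv_assoc (f g h : Finset ι → R) : conv (conv f g) h = conv f (conv g h) := by
  ext T
  simp only [conv, Finset.sum_mul, Finset.mul_sum]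
  rw [Finset.sum_sigma', Finset.sum_sigma']
  refine Finset.sum_bij' (fun x _ => ⟨x.2, x.1 \ x.2⟩) (fun y _ => ⟨y.1 ∪ y.2, y.1⟩) ?_ ?_ ?_ ?_ ?_
  · rintro ⟨U, V⟩ h
    simp only [Finset.mem_sigma, Finset.mem_powerset] at h ⊢
    exact ⟨h.2.trans h.1, Finset.sdiff_subset_sdiff h.1 le_rfl⟩
  · rintro ⟨U, V⟩ h
    simp only [Finset.mem_sigma, Finset.mem_powerset] at h ⊢
    exact ⟨Finset.union_subset h.1 (h.2.trans Finset.sdiff_subset), Finset.subset_union_left⟩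
  · rintro ⟨U, V⟩ h
    simp only [Finset.mem_sigma, Finset.mem_powerset] at h
    simp [Finset.union_eq_right.2 h.2]
  · rintro ⟨U, V⟩ h
    simp only [Finset.mem_sigma, Finset.mem_powerset] at h
    have : Disjoint V U := Finset.disjoint_of_subset_left h.2 Finset.sdiff_disjoint
    simp [Finset.union_sdiff_left, this.sdiff_eq_left]
  · rintro ⟨U, V⟩ h
    simp only [Finset.mem_sigma, Finset.mem_powerset] at h
    have : (T \ V) \ (U \ V) = T \ U := by
      ext x
      have := @h.2 x
      simp only [Finset.mem_sdiff]
      tauto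
    simp only [this, mul_assoc]

/-- The unit for subset convolution. -/
def convOne (T : Finset ι) : R := if T = ∅ then 1 else 0

theorem conv_one (f : Finset ι → R) : conv f convOne = f := by
  ext T
  rw [conv, Finset.sum_eq_single_of_mem T (Finset.mem_powerset_self T)]
  · simp [convOne]
  · intro U hU hne
    have : T \ U ≠ ∅ := fun h =>
      hne ((Finset.mem_powerset.1 hU).antisymm (Finset.sdiff_eq_empty_iff_subset.1 h))
    simp [convOne, this]

/-- The inverse of `f` for subset convolution, if `f ∅ = 1`. -/
def convInv (f : Finset ι → R) (T : Finset ι) : R :=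
  if T = ∅ then 1 else -∑ U : {U // U ∈ T.ssubsets}, f (T \ U) * convInv f U
termination_by T.card
decreasing_by exact Finset.card_lt_card (Finset.mem_ssubsets.1 U.2)

theorem conv_convInv (f : Finset ι → R) (hf : f ∅ = 1) : conv f (convInv f) = convOne := by
  rw [conv_comm]
  ext T
  rw [conv, ← Finset.insert_erase (Finset.mem_powerset_self T), Finset.sum_insert (by simp),
    ← Finset.ssubsets, Finset.sdiff_self, hf, mul_one]
  by_cases h : T = ∅
  · subst h
    rw [convInv, convOne]
    simp [Finset.ssubsets]
  · rw [convInv, convOne, if_neg h, if_neg h, Finset.sum_coe_sort T.ssubsets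
      (fun U => f (T \ U) * convInv f U), neg_add_eq_zero]
    exact Finset.sum_congr rfl fun U _ => mul_comm _ _

theorem eq_conv_convInv_of_conv_eq {f g k : Finset ι → R} (hf : f ∅ = 1) (h : conv k f = g) :
    k = conv g (convInv f) := by
  rw [← h, conv_assoc, conv_convInv f hf, conv_one]

end conv

end SetCumulant

/-! ### The dual elements of joint cumulants. -/

section Dual

variable {ι : Type*} [DecidableEq ι] {A : Type*} [CommRing A]

/-- Division at `T` only involves subsets of `T`. This locality matters because the moment recursion
holds only for sets that avoid the distinguished index. -/
theorem apply_eq_conv_convInv_of_conv_eq {f g k : Finset ι → A} (hf : f ∅ = 1) {T : Finset ι}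
    (h : ∀ S ⊆ T, conv k f S = g S) : k T = conv g (convInv f) T := by
  rw [eq_conv_convInv_of_conv_eq hf (rfl : conv k f = conv k f)]
  exact Finset.sum_congr rfl fun U hU => by rw [h U (Finset.mem_powerset.1 hU)]

theorem conv_congr {f f' g g' : Finset ι → A} {T : Finset ι} (hf : ∀ S ⊆ T, f S = f' S)
    (hg : ∀ S ⊆ T, g S = g' S) : conv f g T = conv f' g' T :=
  Finset.sum_congr rfl fun U hU => by
    rw [hf U (Finset.mem_powerset.1 hU), hg _ Finset.sdiff_subset]

theorem convInv_congr {f f' : Finset ι → A} {T : Finset ι} (hf : f ∅ = 1)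
    (h : ∀ S ⊆ T, f S = f' S) : convInv f T = convInv f' T := by
  rw [apply_eq_conv_convInv_of_conv_eq (k := convInv f) (f := f') (g := convOne)
    ((h ∅ (Finset.empty_subset T)).symm.trans hf), conv_comm, conv_one]
  intro S hS
  rw [← conv_convInv f hf, conv_comm f]
  exact conv_congr (fun _ _ => rfl) fun V hV => (h V (hV.trans hS)).symm

theorem conv_map {ι' : Type*} [DecidableEq ι'] (e : ι' ↪ ι) (f g : Finset ι → A) (T : Finset ι') :
    conv f g (T.map e) = conv (fun S => f (S.map e)) (fun S => g (S.map e)) T := by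
  have : (T.map e).powerset = T.powerset.map (Finset.mapEmbedding e).toEmbedding := by
    ext U
    simp only [Finset.mem_powerset, Finset.mem_map, Finset.subset_map_iff]
    constructor
    · rintro ⟨V, hV, rfl⟩
      exact ⟨V, hV, rfl⟩
    · rintro ⟨V, hV, rfl⟩
      exact ⟨V, hV, rfl⟩
  rw [conv, this, Finset.sum_map]
  refine Finset.sum_congr rfl fun U _ => ?_
  have : T.map e \ U.map e = (T \ U).map e := by
    ext x
    simp only [Finset.mem_sdiff, Finset.mem_map]
    constructor
    · rintro ⟨⟨y, hy, rfl⟩, h⟩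
      exact ⟨y, ⟨hy, fun hU => h ⟨y, hU, rfl⟩⟩, rfl⟩
    · rintro ⟨y, ⟨hy, hU⟩, rfl⟩
      exact ⟨⟨y, hy, rfl⟩, fun ⟨z, hz, h⟩ => hU (e.injective h ▸ hz)⟩
  simp [Finset.mapEmbedding_apply, this]

theorem convInv_map {ι' : Type*} [DecidableEq ι'] (e : ι' ↪ ι) (f : Finset ι → A) (hf : f ∅ = 1)
    (T : Finset ι') : convInv f (T.map e) = convInv (fun S => f (S.map e)) T := by
  have h : conv (fun S => convInv f (S.map e)) (fun S => f (S.map e)) = convOne := by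
    ext S
    rw [← conv_map, conv_comm, conv_convInv f hf, convOne, convOne]
    simp
  have := congrFun (eq_conv_convInv_of_conv_eq (by simpa using hf) h) T
  rwa [conv_comm, conv_one] at this

/-- `f ↦ (S ↦ f (insert b S))` is the partial derivative in the variable of `b`, a derivation for
subset convolution on sets avoiding `b`. The formula is `(1/f)' = -f'/f²`, obtained by
differentiating `f * f⁻¹ = 1`. -/
theorem convInv_insert {f : Finset ι → A} (hf : f ∅ = 1) {b : ι} {T : Finset ι} (hb : b ∉ T) :
    convInv f (insert b T)
      = -conv (conv (fun S => f (insert b S)) (convInv f)) (convInv f) T := by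
  have key := apply_eq_conv_convInv_of_conv_eq (k := fun S => convInv f (insert b S)) (f := f)
    (g := fun S => -conv (fun S => f (insert b S)) (convInv f) S) hf (T := T) ?_
  · rw [key, conv, conv]
    simp
  · intro S hS
    have hbS : b ∉ S := fun h => hb (hS h)
    have h0 : conv f (convInv f) (insert b S) = 0 := by
      rw [conv_convInv f hf, convOne, if_neg (Finset.insert_nonempty b S).ne_empty]
    rw [conv, Finset.sum_powerset_insert hbS] at h0
    rw [conv_comm, eq_neg_iff_add_eq_zero, ← h0]
    congr 1
    · refine Finset.sum_congr rfl fun U hU => ?_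
      rw [Finset.insert_sdiff_of_notMem _ fun h => hbS (Finset.mem_powerset.1 hU h)]
    · refine Finset.sum_congr rfl fun U hU => ?_
      rw [Finset.insert_sdiff_insert, Finset.sdiff_insert_of_notMem hbS]

variable {R : Type*} [CommRing R] [Algebra ℂ R] (E : R →ₗ[ℂ] ℂ) (ξ : ι → R)

/-- The mixed moments of a family `ξ`. -/
def moment (T : Finset ι) : ℂ := E (∏ i ∈ T, ξ i)

/-- The element against which a variable `η` has to be integrated to obtain the joint cumulant of
`η` and of the variables `ξ i`, `i ∈ T`. -/
def cumulantDual (T : Finset ι) : R :=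
  conv (fun U => ∏ i ∈ U, ξ i) (fun U => algebraMap ℂ R (convInv (moment E ξ) U)) T

variable {E} (hE : E 1 = 1)

omit [DecidableEq ι] in
include hE in
theorem moment_empty : moment E ξ ∅ = 1 := by simp [moment, hE]

theorem map_mul_cumulantDual (η : R) (T : Finset ι) :
    E (η * cumulantDual E ξ T)
      = conv (fun U => E (η * ∏ i ∈ U, ξ i)) (convInv (moment E ξ)) T := by
  rw [cumulantDual, conv, conv, Finset.mul_sum, map_sum]
  refine Finset.sum_congr rfl fun U _ => ?_
  rw [← mul_assoc, mul_comm, ← Algebra.smul_def, map_smul, smul_eq_mul, mul_comm]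

-- The moment recursion says that, as functions of `S`, the moments of `ξ a` with `ξ i`, `i ∈ S`,
-- are the convolution of the cumulants containing `a` with the plain moments; dividing by the
-- latter gives the pairing with the dual.
include hE in
theorem setCumulant_moment_insert {a : ι} {T : Finset ι} (ha : a ∉ T) :
    setCumulant (moment E ξ) (insert a T) = E (ξ a * cumulantDual E ξ T) := by
  rw [map_mul_cumulantDual]
  refine apply_eq_conv_convInv_of_conv_eq (k := fun S => setCumulant (moment E ξ) (insert a S))
    (moment_empty ξ hE) fun S hS => ?_
  have haS : a ∉ S := fun h => ha (hS h)
  rw [← Finset.prod_insert haS]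
  exact (moment_eq_sum_setCumulant _ (moment_empty ξ hE) haS).symm

include hE in
theorem map_cumulantDual (T : Finset ι) : E (cumulantDual E ξ T) = if T = ∅ then 1 else 0 := by
  rw [← one_mul (cumulantDual E ξ T), map_mul_cumulantDual]
  simp only [one_mul]
  exact congrFun (conv_convInv (moment E ξ) (moment_empty ξ hE)) T

theorem cumulantDual_empty : cumulantDual E ξ ∅ = 1 := by
  simp [cumulantDual, conv, convInv]

-- The derivative of `exp(∑ s i ξ i) / M` in the variable of `b` is `ξ b` times the quotient minus
-- the quotient times `M'/M`, and the coefficients of `M'/M` are the cumulants `E (ξ b *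
-- cumulantDual E ξ U)`.
include hE in
theorem cumulantDual_insert {b : ι} {T : Finset ι} (hb : b ∉ T) :
    cumulantDual E ξ (insert b T) = ξ b * cumulantDual E ξ T
      - ∑ U ∈ T.powerset, E (ξ b * cumulantDual E ξ U) • cumulantDual E ξ (T \ U) := by
  rw [cumulantDual, conv, Finset.sum_powerset_insert hb, sub_eq_add_neg, add_comm]
  congr 1
  · rw [cumulantDual, conv, Finset.mul_sum]
    refine Finset.sum_congr rfl fun U hU => ?_
    rw [Finset.prod_insert fun h => hb (Finset.mem_powerset.1 hU h), mul_assoc,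
      Finset.insert_sdiff_insert, Finset.sdiff_insert_of_notMem hb]
  -- Here `b` lies in the argument of the inverse moments, to which `convInv_insert` applies.
  · have h1 : ∀ U ∈ T.powerset, (∏ i ∈ U, ξ i) *
        algebraMap ℂ R (convInv (moment E ξ) (insert b T \ U))
        = -((∏ i ∈ U, ξ i) * conv (fun S => algebraMap ℂ R (E (ξ b * cumulantDual E ξ S)))
          (fun S => algebraMap ℂ R (convInv (moment E ξ) S)) (T \ U)) := by
      intro U hU
      have hbU : b ∉ T \ U := fun h => hb (Finset.mem_sdiff.1 h).1
      rw [Finset.insert_sdiff_of_notMem _ fun h => hb (Finset.mem_powerset.1 hU h),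
        convInv_insert (moment_empty ξ hE) hbU, map_neg, mul_neg]
      congr 2
      rw [conv, map_sum, conv]
      refine Finset.sum_congr rfl fun V hV => ?_
      rw [map_mul, map_mul_cumulantDual]
      congr 2
      refine conv_congr (fun W hW => ?_) fun _ _ => rfl
      rw [moment, Finset.prod_insert fun h => hbU (Finset.mem_powerset.1 hV (hW h))]
    rw [Finset.sum_congr rfl h1, Finset.sum_neg_distrib]
    congr 1
    have h2 := congrFun (conv_assoc (fun S => algebraMap ℂ R (E (ξ b * cumulantDual E ξ S)))
      (fun U => ∏ i ∈ U, ξ i) (fun S => algebraMap ℂ R (convInv (moment E ξ) S))) T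
    rw [conv_comm (fun S => algebraMap ℂ R (E (ξ b * cumulantDual E ξ S))), conv_assoc] at h2
    refine h2.trans (Finset.sum_congr rfl fun U _ => ?_)
    rw [Algebra.smul_def]
    rfl

-- Multiplying the expression of `cumulantDual_insert` by `ξ a` and taking expectations leaves the
-- cumulant of `a`, `b`, `T` on one side and the splittings of `T` on the other. This is the source
-- of the quadratic sums in the loop equations.
include hE in
theorem map_mul_mul_cumulantDual {a b : ι} {T : Finset ι} (ha : a ∉ insert b T) (hb : b ∉ T) :
    E (ξ a * ξ b * cumulantDual E ξ T) = setCumulant (moment E ξ) (insert a (insert b T))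
      + ∑ U ∈ T.powerset, E (ξ a * cumulantDual E ξ U) * E (ξ b * cumulantDual E ξ (T \ U)) := by
  rw [setCumulant_moment_insert ξ hE ha, cumulantDual_insert ξ hE hb, mul_sub, map_sub,
    Finset.mul_sum, map_sum, mul_assoc]
  have := congrFun (conv_comm (fun U => E (ξ a * cumulantDual E ξ U))
    (fun U => E (ξ b * cumulantDual E ξ U))) T
  rw [conv, conv] at this
  rw [this, eq_comm, sub_add_eq_add_sub, sub_eq_iff_eq_add]
  congr 1
  refine Finset.sum_congr rfl fun U _ => ?_
  rw [mul_smul_comm, map_smul, smul_eq_mul]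

include hE in
theorem cumulantDual_congr {ζ : ι → R} {T : Finset ι} (h : ∀ i ∈ T, ζ i = ξ i) :
    cumulantDual E ζ T = cumulantDual E ξ T := by
  have hprod : ∀ S ⊆ T, ∏ i ∈ S, ζ i = ∏ i ∈ S, ξ i := fun S hS =>
    Finset.prod_congr rfl fun i hi => h i (hS hi)
  refine conv_congr hprod fun S hS => ?_
  rw [convInv_congr (moment_empty ζ hE)]
  intro V hV
  rw [moment, moment, hprod V (hV.trans hS)]

include hE in
theorem cumulantDual_map {ι' : Type*} [DecidableEq ι'] (e : ι' ↪ ι) (T : Finset ι') :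
    cumulantDual E ξ (T.map e) = cumulantDual E (ξ ∘ e) T := by
  have hmom : (fun S : Finset ι' => moment E ξ (S.map e)) = moment E (ξ ∘ e) := by
    ext S
    simp [moment]
  rw [cumulantDual, conv_map, cumulantDual]
  refine conv_congr (fun S _ => by simp) fun S _ => ?_
  rw [convInv_map e _ (moment_empty ξ hE), hmom]

/-- A joint cumulant as the expectation of one of the variables times the dual of the others. -/
theorem setCumulant_univ_eq {ι₁ ι' : Type*} [DecidableEq ι₁] [Fintype ι₁] [DecidableEq ι']
    [Fintype ι'] (hE : E 1 = 1) (ζ : ι' → R) (e : Option ι₁ ≃ ι') (g : ι₁ ↪ ι)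
    (h : ∀ i, ζ (e (some i)) = ξ (g i)) :
    setCumulant (moment E ζ) Finset.univ
      = E (ζ (e none) * cumulantDual E ξ (Finset.univ.map g)) := by
  have hf : (Finset.univ : Finset ι')
      = insert (e none) (Finset.univ.map (Function.Embedding.some.trans e.toEmbedding)) := by
    ext x
    obtain ⟨y, rfl⟩ := e.surjective x
    cases y <;> simp
  rw [hf, setCumulant_moment_insert ζ hE (by simp), cumulantDual_map ζ hE, cumulantDual_map ξ hE]
  rw [cumulantDual_congr (ξ ∘ g) hE (ζ := ζ ∘ Function.Embedding.some.trans e.toEmbedding)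
    fun i _ => h i]

/-- The second order analogue of `setCumulant_univ_eq`. -/
theorem map_mul_mul_cumulantDual_univ {ι' : Type*} [Fintype ι] [DecidableEq ι'] [Fintype ι']
    (hE : E 1 = 1) (ζ : ι' → R) (e : Option (Option ι) ≃ ι') (h : ∀ i, ζ (e (some (some i))) = ξ i) :
    E (ζ (e none) * ζ (e (some none)) * cumulantDual E ξ Finset.univ)
      = setCumulant (moment E ζ) Finset.univ
        + ∑ U : Finset ι, E (ζ (e none) * cumulantDual E ξ U)
          * E (ζ (e (some none)) * cumulantDual E ξ Uᶜ) := by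
  set f : ι ↪ ι' :=
    (Function.Embedding.some.trans Function.Embedding.some).trans e.toEmbedding with hfdef
  have hf : (Finset.univ : Finset ι')
      = insert (e none) (insert (e (some none)) (Finset.univ.map f)) := by
    ext x
    obtain ⟨y, rfl⟩ := e.surjective x
    rcases y with _ | _ | y <;> simp [hfdef]
  have hQ : ∀ U : Finset ι, cumulantDual E ξ U = cumulantDual E ζ (U.map f) := fun U => by
    rw [cumulantDual_map ζ hE]
    exact cumulantDual_congr _ hE fun i _ => (h i).symm
  rw [hQ Finset.univ, map_mul_mul_cumulantDual ζ hE (by simp [hfdef]) (by simp [hfdef]), ← hf]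
  congr 1
  have := conv_map f (fun U => E (ζ (e none) * cumulantDual E ζ U))
    (fun U => E (ζ (e (some none)) * cumulantDual E ζ U)) Finset.univ
  rw [conv, conv, Finset.powerset_univ] at this
  rw [this]
  refine Finset.sum_congr rfl fun U _ => ?_
  rw [hQ U, hQ Uᶜ, Finset.compl_eq_univ_sdiff]

/-- Derivations act on the dual elements as on products. -/
theorem derivation_cumulantDual (ev : R →ₐ[ℂ] ℂ) (δ : R →ₗ[ℂ] ℂ)
    (hδ : ∀ r s, δ (r * s) = ev r * δ s + ev s * δ r) (T : Finset ι) :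
    δ (cumulantDual E ξ T) = ∑ i ∈ T, δ (ξ i) * ev (cumulantDual E ξ (T.erase i)) := by
  have hone : δ 1 = 0 := by
    have := hδ 1 1
    simp only [mul_one, map_one, one_mul] at this
    exact left_eq_add.1 this
  have hprod : ∀ U : Finset ι, δ (∏ i ∈ U, ξ i) = ∑ i ∈ U, δ (ξ i) * ev (∏ j ∈ U.erase i, ξ j) := by
    intro U
    induction U using Finset.induction_on with
    | empty => simp [hone]
    | insert a U ha ih =>
      rw [Finset.prod_insert ha, hδ, ih, Finset.sum_insert ha, Finset.erase_insert ha, add_comm,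
        mul_comm (ev _), Finset.mul_sum]
      congr 1
      refine Finset.sum_congr rfl fun i hi => ?_
      have hne : a ≠ i := fun h => ha (h ▸ hi)
      rw [Finset.erase_insert_of_ne hne, Finset.prod_insert (by simp [ha]), map_mul]
      ring
  have hterm : ∀ (c : ℂ) (r : R), δ (r * algebraMap ℂ R c) = δ r * c := by
    intro c r
    rw [mul_comm, ← Algebra.smul_def, map_smul, smul_eq_mul, mul_comm]
  -- The moments are constants, so only the products are differentiated. Marking `i ∈ U` and
  -- removing it from both `U` and `T` does not change `T \ U`, hence not the moment factor either.
  rw [cumulantDual, conv, map_sum]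
  simp only [hterm, hprod, Finset.sum_mul, cumulantDual, conv, map_sum, Finset.mul_sum]
  rw [Finset.sum_sigma', Finset.sum_sigma']
  refine Finset.sum_bij' (fun x _ => ⟨x.2, x.1.erase x.2⟩) (fun y _ => ⟨insert y.1 y.2, y.1⟩)
    ?_ ?_ ?_ ?_ ?_
  · rintro ⟨U, i⟩ h
    simp only [Finset.mem_sigma, Finset.mem_powerset] at h ⊢
    exact ⟨h.1 h.2, Finset.erase_subset_erase _ h.1⟩
  · rintro ⟨i, U⟩ h
    simp only [Finset.mem_sigma, Finset.mem_powerset] at h ⊢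
    exact ⟨Finset.insert_subset h.1 (h.2.trans (Finset.erase_subset _ _)),
      Finset.mem_insert_self _ _⟩
  · rintro ⟨U, i⟩ h
    simp only [Finset.mem_sigma] at h
    simp [Finset.insert_erase h.2]
  · rintro ⟨i, U⟩ h
    simp only [Finset.mem_sigma, Finset.mem_powerset] at h
    have : i ∉ U := fun hi => by simpa using h.2 hi
    simp [Finset.erase_insert this]
  · rintro ⟨U, i⟩ h
    simp only [Finset.mem_sigma, Finset.mem_powerset] at h
    have : T.erase i \ U.erase i = T \ U := by
      ext x
      simp only [Finset.mem_sdiff, Finset.mem_erase]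
      by_cases hx : x = i
      · subst hx
        simp [h.2]
      · simp [hx]
    simp only [this, map_mul, AlgHom.commutes, Algebra.algebraMap_self_apply]
    ring

end Dual

/-! ### Contour integrals and Cauchy's formula in homology form. -/

section Contour

open Set Metric Filter Topology

/-! ### Holomorphic parameter integrals -/

/-- No bound on the derivative has to be assumed: Cauchy's estimate on circles of radius `r / 4`
yields one from the bound on `F`, and the derivative is measurable as a limit of difference
quotients. -/
theorem hasDerivAt_integral_of_holomorphic {α : Type*} [MeasurableSpace α] {μ : Measure α}
    {F : ℂ → α → ℂ} {B : α → ℝ} {z₀ : ℂ} {r : ℝ} (hr : 0 < r)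
    (hmeas : ∀ z ∈ ball z₀ r, AEStronglyMeasurable (F z) μ)
    (hdiff : ∀ᵐ x ∂μ, DifferentiableOn ℂ (fun z => F z x) (ball z₀ r))
    (hbound : ∀ᵐ x ∂μ, ∀ z ∈ ball z₀ r, ‖F z x‖ ≤ B x) (hB : Integrable B μ) :
    HasDerivAt (fun z => ∫ x, F z x ∂μ) (∫ x, deriv (fun z => F z x) z₀ ∂μ) z₀ := by
  have hz₀ : z₀ ∈ ball z₀ r := mem_ball_self hr
  have hderiv : ∀ᵐ x ∂μ, ∀ z ∈ ball z₀ (r / 2),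
      HasDerivAt (fun z => F z x) (deriv (fun z => F z x) z) z := by
    filter_upwards [hdiff] with x hx z hz
    exact (hx.differentiableAt
      (isOpen_ball.mem_nhds (ball_subset_ball (by linarith) hz))).hasDerivAt
  have hderiv_meas : AEStronglyMeasurable (fun x => deriv (fun z => F z x) z₀) μ := by
    have hseq : Tendsto (fun n : ℕ => z₀ + (r / 2 / (n + 1) : ℝ)) atTop (𝓝[≠] z₀) := by
      refine tendsto_nhdsWithin_iff.2 ⟨?_, Eventually.of_forall fun n => ?_⟩
      · have : Tendsto (fun n : ℕ => ((r / 2 / ((n : ℝ) + 1) : ℝ) : ℂ)) atTop (𝓝 ((0 : ℝ) : ℂ)) := by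
          refine (Complex.continuous_ofReal.tendsto 0).comp ?_
          have := tendsto_one_div_add_atTop_nhds_zero_nat (𝕜 := ℝ)
          simpa [div_eq_mul_inv] using this.const_mul (r / 2)
        simpa using this.const_add z₀
      · have : 0 < r / 2 / ((n : ℝ) + 1) := by positivity
        simp only [mem_compl_iff, mem_singleton_iff, add_eq_left]
        exact_mod_cast this.ne'
    refine aestronglyMeasurable_of_tendsto_ae (u := atTop)
      (f := fun (n : ℕ) x => slope (fun z => F z x) z₀ (z₀ + (r / 2 / (n + 1) : ℝ)))
      (fun n => ?_) ?_
    · have hmem : z₀ + (r / 2 / (n + 1) : ℝ) ∈ ball z₀ r := by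
        rw [mem_ball, dist_self_add_left, Complex.norm_real, Real.norm_eq_abs, abs_of_pos (by positivity)]
        have : r / 2 / ((n : ℝ) + 1) ≤ r / 2 := div_le_self (by positivity) (by simp)
        linarith
      simp only [slope, vsub_eq_sub, smul_eq_mul]
      exact ((hmeas _ hmem).sub (hmeas _ hz₀)).const_mul _
    · filter_upwards [hderiv] with x hx
      exact (hasDerivAt_iff_tendsto_slope.1 (hx z₀ (mem_ball_self (by positivity)))).comp hseq
  refine (hasDerivAt_integral_of_dominated_loc_of_deriv_le (s := ball z₀ (r / 2))
    (bound := fun x => B x / (r / 4)) (F' := fun z x => deriv (fun z => F z x) z)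
    (ball_mem_nhds _ (by positivity)) ?_ ?_ hderiv_meas ?_ (hB.div_const _) hderiv).2
  · filter_upwards [ball_mem_nhds z₀ hr] with z hz using hmeas z hz
  · exact hB.mono' (hmeas _ hz₀) (hbound.mono fun x hx => hx _ hz₀)
  · filter_upwards [hdiff, hbound] with x hx hb z hz
    have hsub : closedBall z (r / 4) ⊆ ball z₀ r := fun w hw => by
      rw [mem_ball] at hz ⊢
      rw [mem_closedBall] at hw
      linarith [dist_triangle w z z₀]
    refine Complex.norm_deriv_le_of_forall_mem_sphere_norm_le (by positivity) ?_
      fun w hw => hb w (hsub (sphere_subset_closedBall hw))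
    refine (hx.mono ?_).diffContOnCl
    exact (closure_ball_subset_closedBall).trans hsub

/-! ### Piecewise continuously differentiable curves -/

variable {γ : ℝ → ℂ}

/-- On each closed piece the one-sided derivative is continuous, hence bounded, and it is the true
derivative in the interior. Only the break points are lost; they form a null set and are allowed as
exceptions in the fundamental theorem of calculus. -/
theorem IsPiecewiseC1.exists_bound (hγ : IsPiecewiseC1 γ) :
    ContinuousOn γ (Icc 0 1) ∧ ∃ s : Set ℝ, s.Finite ∧ ∃ C : ℝ, ∀ x ∈ Icc (0 : ℝ) 1 \ s,
      DifferentiableAt ℝ γ x ∧ ‖deriv γ x‖ ≤ C := by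
  obtain ⟨k, t, h0, h1, hlt, hC⟩ := hγ
  have key : ∀ j ≤ k, 0 ≤ t j ∧ ContinuousOn γ (Icc 0 (t j)) ∧ ∃ s : Set ℝ, s.Finite ∧ ∃ C : ℝ,
      ∀ x ∈ Icc 0 (t j) \ s, DifferentiableAt ℝ γ x ∧ ‖deriv γ x‖ ≤ C := by
    intro j
    induction j with
    | zero =>
      intro _
      rw [h0]
      refine ⟨le_rfl, by simp, {0}, finite_singleton 0, 0, fun x hx => ?_⟩
      simp at hx
    | succ j ih =>
      intro hj
      obtain ⟨hpos, hcont, s, hs, C, hsC⟩ := ih (by omega)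
      have hj' := hlt j (by omega)
      have hCj := hC j (by omega)
      have hunion : Icc 0 (t (j + 1)) = Icc 0 (t j) ∪ Icc (t j) (t (j + 1)) :=
        (Icc_union_Icc_eq_Icc hpos hj'.le).symm
      refine ⟨hpos.trans hj'.le, ?_, s ∪ {t j, t (j + 1)}, hs.union (by simp), ?_⟩
      · rw [hunion]
        exact hcont.union_of_isClosed hCj.continuousOn isClosed_Icc isClosed_Icc
      · obtain ⟨C', hC'⟩ := isCompact_Icc.exists_bound_of_continuousOn
          (hCj.continuousOn_derivWithin (uniqueDiffOn_Icc hj') le_rfl)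
        refine ⟨max C C', fun x hx => ?_⟩
        simp only [Set.mem_sdiff, mem_union, mem_insert_iff, mem_singleton_iff, not_or] at hx
        obtain ⟨hx, hxs, hx1, hx2⟩ := hx
        rw [hunion] at hx
        rcases hx with hx | hx
        · obtain ⟨h₁, h₂⟩ := hsC x ⟨hx, hxs⟩
          exact ⟨h₁, h₂.trans (le_max_left _ _)⟩
        · have hnhds : Icc (t j) (t (j + 1)) ∈ 𝓝 x :=
            Icc_mem_nhds (lt_of_le_of_ne hx.1 (Ne.symm hx1)) (lt_of_le_of_ne hx.2 hx2)
          refine ⟨((hCj.differentiableOn one_ne_zero) x hx).differentiableAt hnhds, ?_⟩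
          rw [← derivWithin_of_mem_nhds hnhds]
          exact (hC' x hx).trans (le_max_right _ _)
  have := key k le_rfl
  rw [h1] at this
  exact this.2

theorem IsPiecewiseC1.continuousOn (hγ : IsPiecewiseC1 γ) : ContinuousOn γ (Icc 0 1) :=
  hγ.exists_bound.1

theorem IsPiecewiseC1.intervalIntegrable_deriv (hγ : IsPiecewiseC1 γ) :
    IntervalIntegrable (deriv γ) volume 0 1 := by
  obtain ⟨-, s, hs, C, hC⟩ := hγ.exists_bound
  rw [intervalIntegrable_iff_integrableOn_Icc_of_le zero_le_one]
  refine IntegrableOn.of_bound (by simp) (measurable_deriv γ).aestronglyMeasurable C ?_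
  have : ∀ᵐ x, x ∉ s := (measure_eq_zero_iff_ae_notMem.1 (hs.measure_zero _))
  rw [ae_restrict_iff' measurableSet_Icc]
  filter_upwards [this] with x hx hx'
  exact (hC x ⟨hx', hx⟩).2

/-- The image of a curve. -/
abbrev trace (γ : ℝ → ℂ) : Set ℂ := γ '' Icc 0 1

theorem IsPiecewiseC1.isCompact_trace (hγ : IsPiecewiseC1 γ) : IsCompact (trace γ) :=
  isCompact_Icc.image_of_continuousOn hγ.continuousOn

theorem IsPiecewiseC1.intervalIntegrable (hγ : IsPiecewiseC1 γ) {f : ℂ → ℂ}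
    (hf : ContinuousOn f (trace γ)) :
    IntervalIntegrable (fun s => f (γ s) * deriv γ s) volume 0 1 := by
  refine hγ.intervalIntegrable_deriv.continuousOn_mul ?_
  rw [uIcc_of_le zero_le_one]
  exact hf.comp hγ.continuousOn (mapsTo_image _ _)

theorem contourIntegral_eq_zero_of_hasDerivAt (hγ : IsPiecewiseC1 γ) (hcl : γ 0 = γ 1)
    {F f : ℂ → ℂ} (hF : ∀ z ∈ trace γ, HasDerivAt F (f z) z) (hf : ContinuousOn f (trace γ)) :
    contourIntegral γ f = 0 := by
  obtain ⟨hcont, s, hs, C, hC⟩ := hγ.exists_bound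
  have := integral_eq_of_hasDerivAt_off_countable_of_le (F ∘ γ)
    (fun s => f (γ s) * deriv γ s) zero_le_one hs.countable
    (ContinuousOn.comp (t := trace γ) (fun z hz => (hF z hz).continuousAt.continuousWithinAt) hcont
      (mapsTo_image _ _)) (fun x hx => ?_) (hγ.intervalIntegrable hf)
  · rw [contourIntegral, this, Function.comp, Function.comp, hcl, sub_self]
  · have hx' : x ∈ Icc (0 : ℝ) 1 := Ioo_subset_Icc_self hx.1
    have := (hF _ (mem_image_of_mem γ hx')).scomp x (hC x ⟨hx', hx.2⟩).1.hasDerivAt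
    simpa [mul_comm] using this

theorem contourIntegral_sub (hγ : IsPiecewiseC1 γ) {f g : ℂ → ℂ} (hf : ContinuousOn f (trace γ))
    (hg : ContinuousOn g (trace γ)) :
    contourIntegral γ (fun z => f z - g z) = contourIntegral γ f - contourIntegral γ g := by
  simp only [contourIntegral, sub_mul]
  exact intervalIntegral.integral_sub (hγ.intervalIntegrable hf) (hγ.intervalIntegrable hg)

theorem contourIntegral_const_mul (c : ℂ) (f : ℂ → ℂ) :
    contourIntegral γ (fun z => c * f z) = c * contourIntegral γ f := by
  simp only [contourIntegral, mul_assoc]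
  exact intervalIntegral.integral_const_mul _ _

theorem contourIntegral_congr {f g : ℂ → ℂ} (h : ∀ z ∈ trace γ, f z = g z) :
    contourIntegral γ f = contourIntegral γ g := by
  refine intervalIntegral.integral_congr fun s hs => ?_
  rw [uIcc_of_le zero_le_one] at hs
  simp only [h _ (mem_image_of_mem γ hs)]

/-- A contour integral depending holomorphically on a parameter. -/
theorem hasDerivAt_contourIntegral (hγ : IsPiecewiseC1 γ) {F : ℂ → ℂ → ℂ} {w₀ : ℂ} {r : ℝ}
    (hr : 0 < r) (hcont : ∀ w ∈ ball w₀ r, ContinuousOn (fun z => F w z) (trace γ))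
    (hdiff : ∀ z ∈ trace γ, DifferentiableOn ℂ (fun w => F w z) (ball w₀ r)) {C : ℝ}
    (hbound : ∀ w ∈ ball w₀ r, ∀ z ∈ trace γ, ‖F w z‖ ≤ C) :
    HasDerivAt (fun w => contourIntegral γ (F w))
      (contourIntegral γ fun z => deriv (fun w => F w z) w₀) w₀ := by
  have hint := hγ.intervalIntegrable_deriv
  simp only [contourIntegral, intervalIntegral.integral_of_le zero_le_one]
  have hmem : ∀ᵐ s ∂(volume.restrict (Ioc (0 : ℝ) 1)), γ s ∈ trace γ :=
    (ae_restrict_mem measurableSet_Ioc).mono fun s hs =>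
      mem_image_of_mem γ (Ioc_subset_Icc_self hs)
  have := hasDerivAt_integral_of_holomorphic (μ := volume.restrict (Ioc (0 : ℝ) 1))
    (F := fun w s => F w (γ s) * deriv γ s) (B := fun s => C * ‖deriv γ s‖) (z₀ := w₀) hr ?_ ?_ ?_ ?_
  · convert this using 1
    refine integral_congr_ae (hmem.mono fun s hs => ?_)
    have hd := (hdiff _ hs).differentiableAt (ball_mem_nhds _ hr)
    exact (hd.hasDerivAt.mul_const _).deriv.symm
  · intro w hw
    exact ((intervalIntegrable_iff_integrableOn_Ioc_of_le zero_le_one).1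
      (hγ.intervalIntegrable (hcont w hw))).1
  · filter_upwards [hmem] with s hs
    exact (hdiff _ hs).mul_const _
  · filter_upwards [hmem] with s hs w hw
    rw [norm_mul]
    exact mul_le_mul_of_nonneg_right (hbound w hw _ hs) (norm_nonneg _)
  · exact ((intervalIntegrable_iff_integrableOn_Ioc_of_le zero_le_one).1 hint).norm.const_mul C

/-! ### Cauchy integrals and winding numbers -/

theorem exists_ball_dist_trace (hγ : IsPiecewiseC1 γ) {w : ℂ} (hw : w ∉ trace γ) :
    ∃ r > 0, ∀ w' ∈ ball w r, ∀ z ∈ trace γ, r ≤ ‖z - w'‖ := by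
  have hopen : IsOpen (trace γ)ᶜ := hγ.isCompact_trace.isClosed.isOpen_compl
  obtain ⟨r, hr, hsub⟩ := Metric.isOpen_iff.1 hopen w hw
  refine ⟨r / 2, by positivity, fun w' hw' z hz => ?_⟩
  by_contra! h
  refine hsub ?_ hz
  rw [mem_ball] at hw' ⊢
  rw [← dist_eq_norm] at h
  linarith [dist_triangle z w' w]

theorem hasDerivAt_cauchyIntegral (hγ : IsPiecewiseC1 γ) {g : ℂ → ℂ}
    (hg : ContinuousOn g (trace γ)) {w : ℂ} (hw : w ∉ trace γ) :
    HasDerivAt (fun w => contourIntegral γ fun z => g z * (z - w)⁻¹)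
      (contourIntegral γ fun z => g z * ((z - w) ^ 2)⁻¹) w := by
  obtain ⟨r, hr, hdist⟩ := exists_ball_dist_trace hγ hw
  obtain ⟨C, hC⟩ := hγ.isCompact_trace.exists_bound_of_continuousOn hg
  have hne : ∀ w' ∈ ball w r, ∀ z ∈ trace γ, z - w' ≠ 0 := fun w' hw' z hz h => by
    have := hdist w' hw' z hz
    rw [h, norm_zero] at this
    linarith
  have hd : ∀ z ∈ trace γ, ∀ w' ∈ ball w r,
      HasDerivAt (fun w => g z * (z - w)⁻¹) (g z * ((z - w') ^ 2)⁻¹) w' := by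
    intro z hz w' hw'
    have h := (((hasDerivAt_id w').const_sub z).inv (hne w' hw' z hz)).const_mul (g z)
    simpa using h
  have := hasDerivAt_contourIntegral hγ (F := fun w z => g z * (z - w)⁻¹) (w₀ := w) (C := C * r⁻¹)
    hr ?_ ?_ ?_
  · convert this using 1
    exact contourIntegral_congr fun z hz => ((hd z hz w (mem_ball_self hr)).deriv).symm
  · exact fun w' hw' => hg.mul ((continuousOn_id.sub continuousOn_const).inv₀ (hne w' hw'))
  · exact fun z hz w' hw' => (hd z hz w' hw').differentiableAt.differentiableWithinAt
  · intro w' hw' z hz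
    rw [norm_mul, norm_inv]
    have h1 := hC z hz
    have h2 := hdist w' hw' z hz
    have h3 : 0 ≤ C := (norm_nonneg _).trans h1
    gcongr

theorem windingNumber_eq_zero_iff {w : ℂ} :
    windingNumber γ w = 0 ↔ (contourIntegral γ fun z => (z - w)⁻¹) = 0 := by
  simp [windingNumber, Real.pi_ne_zero]

/-- The derivative in `w` is the integral of `(z - w)⁻²`, which vanishes because `-(z - w)⁻¹` is a
primitive on the curve. Local constancy thus follows without knowing that winding numbers are
integers. -/
theorem eventually_contourIntegral_inv_eq (hγ : IsPiecewiseC1 γ) (hcl : γ 0 = γ 1) {w : ℂ}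
    (hw : w ∉ trace γ) :
    ∀ᶠ w' in 𝓝 w, (contourIntegral γ fun z => (z - w')⁻¹) = contourIntegral γ fun z => (z - w)⁻¹ := by
  obtain ⟨r, hr, hdist⟩ := exists_ball_dist_trace hγ hw
  have hne : ∀ w' ∈ ball w r, ∀ z ∈ trace γ, z - w' ≠ 0 := fun w' hw' z hz h => by
    have := hdist w' hw' z hz
    rw [h, norm_zero] at this
    linarith
  have hd : ∀ w' ∈ ball w r, HasDerivAt (fun w => contourIntegral γ fun z => (z - w)⁻¹) 0 w' := by
    intro w' hw'
    have h1 := hasDerivAt_cauchyIntegral hγ (g := fun _ => 1) continuousOn_const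
      (w := w') fun h => hne w' hw' w' h (sub_self _)
    simp only [one_mul] at h1
    convert h1 using 1
    refine (contourIntegral_eq_zero_of_hasDerivAt hγ hcl (F := fun z => -(z - w')⁻¹)
      (fun z hz => ?_) ?_).symm
    · have h : HasDerivAt (fun z => -(z - w')⁻¹) (-(-1 / (z - w') ^ 2)) z :=
        (((hasDerivAt_id z).sub_const w').inv (hne w' hw' z hz)).neg
      simpa [neg_div] using h
    · exact ((continuousOn_id.sub continuousOn_const).pow 2).inv₀
        fun z hz => pow_ne_zero 2 (hne w' hw' z hz)
  filter_upwards [ball_mem_nhds w hr] with w' hw'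
  exact (convex_ball w r).is_const_of_fderivWithin_eq_zero (𝕜 := ℂ)
    (fun x hx => (hd x hx).differentiableAt.differentiableWithinAt)
    (fun x hx => by
      rw [fderivWithin_of_isOpen isOpen_ball hx]
      ext
      simp [(hd x hx).deriv]) hw' (mem_ball_self hr)

/-- For such `w`, `1 - z / w` stays in the disc of radius `1` about `1`, where the principal
logarithm is holomorphic and gives a primitive. -/
theorem contourIntegral_inv_eq_zero_of_norm_lt (hγ : IsPiecewiseC1 γ) (hcl : γ 0 = γ 1) {w : ℂ}
    (hw : ∀ z ∈ trace γ, ‖z‖ < ‖w‖) : (contourIntegral γ fun z => (z - w)⁻¹) = 0 := by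
  have hne : ∀ z ∈ trace γ, z - w ≠ 0 := fun z hz h => (hw z hz).ne (by rw [sub_eq_zero.1 h])
  refine contourIntegral_eq_zero_of_hasDerivAt hγ hcl (F := fun z => Complex.log (1 - z / w))
    (fun z hz => ?_) ((continuousOn_id.sub continuousOn_const).inv₀ hne)
  have hw0 : w ≠ 0 := fun h => by
    have := hw z hz
    rw [h, norm_zero] at this
    exact absurd this (not_lt.2 (norm_nonneg z))
  have hslit : 1 - z / w ∈ Complex.slitPlane := by
    refine Complex.mem_slitPlane_of_norm_lt_one (z := -(z / w)) ?_ |> fun h => by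
      simpa [sub_eq_add_neg] using h
    rw [norm_neg, norm_div, div_lt_one (norm_pos_iff.2 hw0)]
    exact hw z hz
  have : HasDerivAt (fun z => Complex.log (1 - z / w)) (-(1 / w) / (1 - z / w)) z :=
    (((hasDerivAt_id z).div_const w).const_sub 1).clog hslit
  convert this using 1
  have h1 := hne z hz
  have h2 : w - z ≠ 0 := fun h => h1 (by rw [← neg_sub, h, neg_zero])
  have h3 : (1 - z / w) ≠ 0 := Complex.slitPlane_ne_zero hslit
  field_simp
  ring

/-! ### The homology version of Cauchy's formula -/

theorem dslope_comm {f : ℂ → ℂ} (z w : ℂ) : dslope f z w = dslope f w z := by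
  rcases eq_or_ne z w with rfl | h
  · rfl
  · rw [dslope_of_ne _ h, dslope_of_ne _ h.symm, slope_comm]

/-- Joint continuity is clear off the diagonal. On it, a holomorphic function is strictly
differentiable, which controls slopes between two distinct nearby points, and the derivative is
continuous, which controls nearby points of the diagonal. -/
theorem continuousAt_dslope_uncurry {M : Set ℂ} (hM : IsOpen M) {f : ℂ → ℂ}
    (hf : DifferentiableOn ℂ f M) {z w : ℂ} (hz : z ∈ M) (hw : w ∈ M) :
    ContinuousAt (fun q : ℂ × ℂ => dslope f q.1 q.2) (z, w) := by
  rcases ne_or_eq z w with h | rfl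
  · have hne : ∀ᶠ q : ℂ × ℂ in 𝓝 (z, w), q.2 ≠ q.1 :=
      (isOpen_ne_fun continuous_snd continuous_fst).mem_nhds h.symm
    have hz' : ContinuousAt f z := (hf.differentiableAt (hM.mem_nhds hz)).continuousAt
    have hw' : ContinuousAt f w := (hf.differentiableAt (hM.mem_nhds hw)).continuousAt
    have : ContinuousAt (fun q : ℂ × ℂ => (q.2 - q.1)⁻¹ * (f q.2 - f q.1)) (z, w) := by
      refine ContinuousAt.mul (ContinuousAt.inv₀ (by fun_prop) (sub_ne_zero.2 h.symm)) ?_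
      exact (ContinuousAt.comp (f := Prod.snd) hw' continuousAt_snd).sub
        (ContinuousAt.comp (f := Prod.fst) hz' continuousAt_fst)
    refine this.congr (hne.mono fun q hq => ?_)
    simp only [dslope_of_ne _ hq, slope, vsub_eq_sub, smul_eq_mul]
  · have hs : HasStrictDerivAt f (deriv f z) z :=
      (hf.analyticAt (hM.mem_nhds hz)).hasStrictDerivAt
    have hderiv : ContinuousAt (deriv f) z :=
      ((hf.deriv hM).differentiableAt (hM.mem_nhds hz)).continuousAt
    rw [ContinuousAt, dslope_same, Metric.tendsto_nhds]
    intro ε hε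
    have h1 := hs.isLittleO.def (half_pos hε)
    have h2 : ∀ᶠ q : ℂ × ℂ in 𝓝 (z, z), dist (deriv f q.1) (deriv f z) < ε :=
      (hderiv.tendsto.comp (continuous_fst.tendsto (z, z))).eventually (ball_mem_nhds _ hε)
    filter_upwards [h1, h2] with q hq1 hq2
    rcases eq_or_ne q.2 q.1 with h | h
    · rw [h, dslope_same]
      exact hq2
    · rw [dslope_of_ne _ h, slope_comm, slope, vsub_eq_sub, smul_eq_mul, dist_eq_norm]
      have hne : q.1 - q.2 ≠ 0 := sub_ne_zero.2 h.symm
      have : (q.1 - q.2)⁻¹ * (f q.1 - f q.2) - deriv f z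
          = (q.1 - q.2)⁻¹ * (f q.1 - f q.2 - (q.1 - q.2) • deriv f z) := by
        rw [smul_eq_mul]
        field_simp
      rw [this, norm_mul, norm_inv, inv_mul_lt_iff₀ (norm_pos_iff.2 hne)]
      have := norm_pos_iff.2 hne
      simp only [ContinuousLinearMap.toSpanSingleton_apply, smul_eq_mul] at hq1 ⊢
      nlinarith

variable {M : Set ℂ} {g : ℂ → ℂ}

theorem contourIntegral_dslope_eq (hγ : IsPiecewiseC1 γ) (hg : ContinuousOn g (trace γ)) {w : ℂ}
    (hw : w ∉ trace γ) :
    (contourIntegral γ fun z => dslope g z w)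
      = (contourIntegral γ fun z => g z * (z - w)⁻¹)
        - g w * contourIntegral γ fun z => (z - w)⁻¹ := by
  have hne : ∀ z ∈ trace γ, z - w ≠ 0 := fun z hz h => hw (sub_eq_zero.1 h ▸ hz)
  have hinv : ContinuousOn (fun z => (z - w)⁻¹) (trace γ) :=
    (continuousOn_id.sub continuousOn_const).inv₀ hne
  rw [← contourIntegral_const_mul, ← contourIntegral_sub hγ (f := fun z => g z * (z - w)⁻¹)
    (g := fun z => g w * (z - w)⁻¹) (hg.mul hinv) (continuousOn_const.mul hinv)]
  refine contourIntegral_congr fun z hz => ?_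
  rw [dslope_comm, dslope_of_ne _ (sub_ne_zero.1 (hne z hz)), slope, vsub_eq_sub, smul_eq_mul]
  ring

theorem differentiableAt_contourIntegral_dslope (hγ : IsPiecewiseC1 γ) (hM : IsOpen M)
    (hγM : trace γ ⊆ M) (hg : DifferentiableOn ℂ g M) {w : ℂ} (hw : w ∈ M) :
    DifferentiableAt ℂ (fun w => contourIntegral γ fun z => dslope g z w) w := by
  obtain ⟨r, hr, hsub⟩ := Metric.nhds_basis_closedBall.mem_iff.1 (hM.mem_nhds hw)
  have hcont : ContinuousOn (fun q : ℂ × ℂ => dslope g q.1 q.2) (trace γ ×ˢ closedBall w r) :=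
    fun q hq => (continuousAt_dslope_uncurry hM hg (hγM hq.1) (hsub hq.2)).continuousWithinAt
  obtain ⟨C, hC⟩ := (hγ.isCompact_trace.prod (isCompact_closedBall w r)).exists_bound_of_continuousOn
    hcont
  refine (hasDerivAt_contourIntegral hγ (F := fun w z => dslope g z w) (C := C) hr ?_ ?_
    ?_).differentiableAt
  · intro w' hw'
    exact hcont.comp (f := fun z => (z, w')) (by fun_prop)
      fun z hz => ⟨hz, ball_subset_closedBall hw'⟩
  · intro z hz
    exact ((Complex.differentiableOn_dslope (hM.mem_nhds (hγM hz))).2 hg).mono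
      (ball_subset_closedBall.trans hsub)
  · exact fun w' hw' z hz => hC (z, w') ⟨hz, ball_subset_closedBall hw'⟩

/-- The function of Dixon's proof vanishes identically. -/
theorem dixon (hγ : IsPiecewiseC1 γ) (hcl : γ 0 = γ 1) (hM : IsOpen M)
    (hγM : trace γ ⊆ M) (hint : ∀ w ∉ M, windingNumber γ w = 0) (hg : DifferentiableOn ℂ g M) :
    (∀ w ∈ M, (contourIntegral γ fun z => dslope g z w) = 0) ∧
      ∀ w ∉ M, (contourIntegral γ fun z => g z * (z - w)⁻¹) = 0 := by
  classical
  have hgc : ContinuousOn g (trace γ) := hg.continuousOn.mono hγM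
  set D : ℂ → ℂ := fun w => if w ∈ M then contourIntegral γ fun z => dslope g z w
    else contourIntegral γ fun z => g z * (z - w)⁻¹ with hD
  -- The two formulas for `D` differ by `g w` times the integral of `(z - w)⁻¹`. They agree where
  -- the latter vanishes, in particular near every point outside `M`, so they glue to an entire
  -- function.
  have hDeq : ∀ w ∉ trace γ, (contourIntegral γ fun z => (z - w)⁻¹) = 0 →
      D w = contourIntegral γ fun z => g z * (z - w)⁻¹ := by
    intro w hw h
    by_cases hwM : w ∈ M
    · rw [hD]
      simp only [hwM, if_true]
      rw [contourIntegral_dslope_eq hγ hgc hw, h, mul_zero, sub_zero]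
    · simp [hD, hwM]
  have hdiff : Differentiable ℂ D := by
    intro w
    by_cases hwM : w ∈ M
    · refine (differentiableAt_contourIntegral_dslope hγ hM hγM hg hwM).congr_of_eventuallyEq ?_
      filter_upwards [hM.mem_nhds hwM] with w' hw'
      simp [hD, hw']
    · have hw : w ∉ trace γ := fun h => hwM (hγM h)
      have h0 := windingNumber_eq_zero_iff.1 (hint w hwM)
      refine (hasDerivAt_cauchyIntegral hγ hgc hw).differentiableAt.congr_of_eventuallyEq ?_
      filter_upwards [eventually_contourIntegral_inv_eq hγ hcl hw,
        hγ.isCompact_trace.isClosed.isOpen_compl.mem_nhds hw] with w' h1 h2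
      exact hDeq w' h2 (h1.trans h0)
  -- Far from the curve `D` is a Cauchy integral, bounded by a constant times the inverse of the
  -- distance from `w` to the disc of radius `R` containing the curve. Liouville's theorem then
  -- gives `D = 0`.
  have hlim : Tendsto D (cocompact ℂ) (𝓝 0) := by
    obtain ⟨R, hR⟩ := hγ.isCompact_trace.isBounded.exists_norm_le
    obtain ⟨C, hC⟩ := hγ.isCompact_trace.exists_bound_of_continuousOn hgc
    set L := ∫ s in (0 : ℝ)..1, ‖deriv γ s‖ with hL
    have hbig : ∀ᶠ w in cocompact ℂ, R < ‖w‖ :=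
      (tendsto_norm_cocompact_atTop (E := ℂ)).eventually_gt_atTop R
    have hbd : Tendsto (fun w : ℂ => C * L * (‖w‖ - R)⁻¹) (cocompact ℂ) (𝓝 0) := by
      have h1 : Tendsto (fun w : ℂ => ‖w‖ - R) (cocompact ℂ) atTop :=
        tendsto_atTop_add_const_right _ (-R) (tendsto_norm_cocompact_atTop (E := ℂ))
      simpa using h1.inv_tendsto_atTop.const_mul (C * L)
    refine squeeze_zero_norm' ?_ hbd
    filter_upwards [hbig] with w hw
    have hlt : ∀ z ∈ trace γ, ‖z‖ < ‖w‖ := fun z hz => (hR z hz).trans_lt hw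
    have hw' : w ∉ trace γ := fun h => (hlt w h).ne rfl
    rw [hDeq w hw' (contourIntegral_inv_eq_zero_of_norm_lt hγ hcl hlt), contourIntegral]
    calc ‖∫ s in (0 : ℝ)..1, g (γ s) * (γ s - w)⁻¹ * deriv γ s‖
        ≤ ∫ s in (0 : ℝ)..1, C * (‖w‖ - R)⁻¹ * ‖deriv γ s‖ := by
          refine intervalIntegral.norm_integral_le_of_norm_le zero_le_one
            (Eventually.of_forall fun s hs => ?_) (hγ.intervalIntegrable_deriv.norm.const_mul _)
          have hmem : γ s ∈ trace γ := mem_image_of_mem γ (Ioc_subset_Icc_self hs)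
          rw [norm_mul, norm_mul, norm_inv]
          have h1 := hC _ hmem
          have h2 : ‖w‖ - R ≤ ‖γ s - w‖ := by
            have := norm_sub_norm_le w (γ s)
            rw [norm_sub_rev] at this
            linarith [hR _ hmem]
          have h3 : 0 < ‖w‖ - R := sub_pos.2 hw
          have h4 : 0 ≤ C := (norm_nonneg _).trans h1
          gcongr
      _ = C * L * (‖w‖ - R)⁻¹ := by
          rw [intervalIntegral.integral_const_mul]
          ring
  have hzero : ∀ w, D w = 0 := fun w => hdiff.apply_eq_of_tendsto_cocompact w hlim
  refine ⟨fun w hw => ?_, fun w hw => ?_⟩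
  · simpa [hD, hw] using hzero w
  · simpa [hD, hw] using hzero w

/-- Cauchy's integral formula for a cycle that is homologous to zero in `M`. -/
theorem contourIntegral_cauchy (hγ : IsPiecewiseC1 γ) (hcl : γ 0 = γ 1) (hM : IsOpen M)
    (hγM : trace γ ⊆ M) (hint : ∀ w ∉ M, windingNumber γ w = 0) (hg : DifferentiableOn ℂ g M)
    {w : ℂ} (hw : w ∉ trace γ) :
    (contourIntegral γ fun z => g z * (z - w)⁻¹)
      = g w * (2 * Real.pi * Complex.I * windingNumber γ w) := by
  have h2 : (2 * Real.pi * Complex.I : ℂ) ≠ 0 := by simp [Real.pi_ne_zero]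
  obtain ⟨h₁, h₂⟩ := dixon hγ hcl hM hγM hint hg
  by_cases hwM : w ∈ M
  · have := h₁ w hwM
    rw [contourIntegral_dslope_eq hγ (hg.continuousOn.mono hγM) hw, sub_eq_zero] at this
    rw [this, windingNumber, mul_inv_cancel_left₀ h2]
  · rw [h₂ w hwM, hint w hwM, mul_zero, mul_zero]

end Contour

/-! ### The law of the gas: positivity, normalization, integrability. -/

section Gibbs

open Set

variable {N : ℕ} {θ a b : ℝ} {Vt Vb : ℂ → ℂ}

/-- The configurations all of whose points are in `[a, b]`. -/
def cube (N : ℕ) (a b : ℝ) : Set ((Fin N → ℝ) × (Fin (N - 1) → ℝ)) :=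
  (univ.pi fun _ => Icc a b) ×ˢ (univ.pi fun _ => Icc a b)

theorem isCompact_cube : IsCompact (cube N a b) :=
  (isCompact_univ_pi fun _ => isCompact_Icc).prod (isCompact_univ_pi fun _ => isCompact_Icc)

theorem mem_cube {p : (Fin N → ℝ) × (Fin (N - 1) → ℝ)} :
    p ∈ cube N a b ↔ (∀ i, p.1 i ∈ Icc a b) ∧ ∀ j, p.2 j ∈ Icc a b := by
  simp only [cube, mem_prod, mem_univ_pi]

theorem mem_Ioo_of_mem_interlacingSet {p : (Fin N → ℝ) × (Fin (N - 1) → ℝ)}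
    (hp : p ∈ interlacingSet N a b) :
    (∀ i, p.1 i ∈ Ioo a b) ∧ ∀ j, p.2 j ∈ Ioo a b :=
  ⟨hp.1, fun j => ⟨(hp.1 _).1.trans (hp.2 j).1, (hp.2 j).2.trans (hp.1 _).2⟩⟩

theorem interlacingSet_subset_cube : interlacingSet N a b ⊆ cube N a b := fun _ hp =>
  mem_cube.2 ⟨fun i => Ioo_subset_Icc_self ((mem_Ioo_of_mem_interlacingSet hp).1 i),
    fun j => Ioo_subset_Icc_self ((mem_Ioo_of_mem_interlacingSet hp).2 j)⟩

theorem isOpen_interlacingSet : IsOpen (interlacingSet N a b) := by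
  simp only [interlacingSet, ofPred_and, ofPred_forall]
  refine IsOpen.inter (isOpen_iInter_of_finite fun i => ?_) (isOpen_iInter_of_finite fun i => ?_)
  · exact (isOpen_lt (by fun_prop) (by fun_prop)).inter (isOpen_lt (by fun_prop) (by fun_prop))
  · exact (isOpen_lt (by fun_prop) (by fun_prop)).inter (isOpen_lt (by fun_prop) (by fun_prop))

theorem interlacingSet_nonempty (hab : a < b) : (interlacingSet N a b).Nonempty := by
  -- `2 * N` equally spaced interior points, taken alternately for the upper and the lower level.
  set g : ℕ → ℝ := fun k => a + (b - a) * (k / (2 * N + 1)) with hg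
  have hpos : (0 : ℝ) < 2 * N + 1 := by positivity
  have hmono : StrictMono g := by
    intro k l hkl
    have : (k : ℝ) < l := by exact_mod_cast hkl
    have hba : 0 < b - a := sub_pos.2 hab
    simp only [hg]
    gcongr
  have h0 : g 0 = a := by simp [hg]
  have h1 : g (2 * N + 1) = b := by
    simp only [hg]
    push_cast
    field_simp
    ring
  refine ⟨(fun i => g (2 * i + 1), fun j => g (2 * j + 2)), fun i => ?_, fun j => ?_⟩
  · exact ⟨h0 ▸ hmono (by omega), h1 ▸ hmono (by omega)⟩
  · exact ⟨hmono (by simp), hmono (by simp; omega)⟩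

theorem fst_lt_of_mem_interlacingSet {p : (Fin N → ℝ) × (Fin (N - 1) → ℝ)}
    (hp : p ∈ interlacingSet N a b) {i j : Fin N} (hij : i < j) : p.1 i < p.1 j := by
  have key : ∀ (d i : ℕ) (h : i + d + 1 < N), p.1 ⟨i, by omega⟩ < p.1 ⟨i + d + 1, h⟩ := by
    intro d
    induction d with
    | zero =>
      intro i h
      exact (hp.2 ⟨i, by omega⟩).1.trans (hp.2 ⟨i, by omega⟩).2
    | succ d ih =>
      intro i h
      refine (ih i (by omega)).trans ?_
      exact (hp.2 ⟨i + d + 1, by omega⟩).1.trans (hp.2 ⟨i + d + 1, by omega⟩).2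
  obtain ⟨d, hd⟩ := Nat.exists_eq_add_of_lt (Fin.lt_def.1 hij)
  have := key d i (by omega)
  convert this using 2
  exact Fin.ext hd

theorem fst_le_of_mem_interlacingSet {p : (Fin N → ℝ) × (Fin (N - 1) → ℝ)}
    (hp : p ∈ interlacingSet N a b) {i j : Fin N} (hij : i ≤ j) : p.1 i ≤ p.1 j := by
  rcases hij.eq_or_lt with rfl | h
  · exact le_rfl
  · exact (fst_lt_of_mem_interlacingSet hp h).le

theorem snd_lt_of_mem_interlacingSet {p : (Fin N → ℝ) × (Fin (N - 1) → ℝ)}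
    (hp : p ∈ interlacingSet N a b) {i j : Fin (N - 1)} (hij : i < j) : p.2 i < p.2 j :=
  (hp.2 i).2.trans_le ((fst_le_of_mem_interlacingSet hp
    (Fin.le_def.2 (by simpa using Fin.lt_def.1 hij))).trans (hp.2 j).1.le)

theorem snd_ne_fst_of_mem_interlacingSet {p : (Fin N → ℝ) × (Fin (N - 1) → ℝ)}
    (hp : p ∈ interlacingSet N a b) (i : Fin (N - 1)) (j : Fin N) : p.2 i ≠ p.1 j := by
  rcases le_or_gt (j : ℕ) i with h | h
  · exact ((fst_le_of_mem_interlacingSet hp (i := j) (j := ⟨i, by omega⟩) h).trans_lt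
      (hp.2 i).1).ne'
  · exact ((hp.2 i).2.trans_le (fst_le_of_mem_interlacingSet hp (i := ⟨i + 1, by omega⟩) (j := j)
      (Fin.le_def.2 (by simpa using h)))).ne

theorem weight_pos {p : (Fin N → ℝ) × (Fin (N - 1) → ℝ)} (hp : p ∈ interlacingSet N a b) :
    0 < weight N θ Vt Vb p := by
  have h1 : 0 < ∏ i, ∏ j ∈ Finset.Ioi i, (p.1 j - p.1 i) :=
    Finset.prod_pos fun i _ => Finset.prod_pos fun j hj =>
      sub_pos.2 (fst_lt_of_mem_interlacingSet hp (Finset.mem_Ioi.1 hj))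
  have h2 : 0 < ∏ i, ∏ j ∈ Finset.Ioi i, (p.2 j - p.2 i) :=
    Finset.prod_pos fun i _ => Finset.prod_pos fun j hj =>
      sub_pos.2 (snd_lt_of_mem_interlacingSet hp (Finset.mem_Ioi.1 hj))
  have h3 : 0 < ∏ i, ∏ j, |p.2 i - p.1 j| ^ (θ - 1) :=
    Finset.prod_pos fun i _ => Finset.prod_pos fun j _ =>
      Real.rpow_pos_of_pos (abs_pos.2 (sub_ne_zero.2 (snd_ne_fst_of_mem_interlacingSet hp i j))) _
  unfold weight
  positivity

/-- The exponent `θ - 1` is nonnegative, so the interaction between the levels has no singularity at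
collisions. The weight is therefore bounded on the compact cube, and integrability questions reduce
to continuity there. -/
theorem continuousOn_weight (hθ : 1 ≤ θ) (hVt : ∀ x ∈ Icc a b, ContinuousAt Vt (x : ℂ))
    (hVb : ∀ x ∈ Icc a b, ContinuousAt Vb (x : ℂ)) :
    ContinuousOn (weight N θ Vt Vb) (cube N a b) := by
  intro p hp
  refine ContinuousAt.continuousWithinAt ?_
  have hpot : ∀ {V : ℂ → ℂ} {f : (Fin N → ℝ) × (Fin (N - 1) → ℝ) → ℝ}, Continuous f →
      ContinuousAt V (f p : ℂ) →
      ContinuousAt (fun q => Real.exp (-(N * θ * (V (f q)).re))) p := by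
    intro V f hf hV
    have h1 : ContinuousAt (fun q => V (f q)) p :=
      ContinuousAt.comp (g := V) (f := fun q => (f q : ℂ)) hV (by fun_prop)
    have h2 := Complex.continuous_re.continuousAt.comp h1
    exact Real.continuous_exp.continuousAt.comp (h2.const_mul (N * θ : ℝ)).neg
  refine ((((ContinuousAt.mul ?_ ?_).mul ?_).mul ?_).mul ?_)
  · fun_prop
  · fun_prop
  · refine Continuous.continuousAt (continuous_finsetProd _ fun i _ =>
      continuous_finsetProd _ fun j _ => ?_)
    exact Continuous.rpow_const (by fun_prop) fun _ => Or.inr (by linarith)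
  · exact tendsto_finsetProd _ fun i _ => hpot (by fun_prop) (hVb _ ((mem_cube.1 hp).2 i))
  · exact tendsto_finsetProd _ fun i _ => hpot (by fun_prop) (hVt _ ((mem_cube.1 hp).1 i))

theorem integrableOn_of_continuousOn_cube {E : Type*} [NormedAddCommGroup E]
    {F : (Fin N → ℝ) × (Fin (N - 1) → ℝ) → E} (hF : ContinuousOn F (cube N a b)) :
    IntegrableOn F (interlacingSet N a b) :=
  (hF.integrableOn_compact isCompact_cube).mono_set interlacingSet_subset_cube

section law

variable (hab : a < b) (hθ : 1 ≤ θ) (hVt : ∀ x ∈ Icc a b, ContinuousAt Vt (x : ℂ))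
  (hVb : ∀ x ∈ Icc a b, ContinuousAt Vb (x : ℂ))

include hab hθ hVt hVb

theorem partitionFunction_pos : 0 < partitionFunction N θ a b Vt Vb := by
  rw [partitionFunction, setIntegral_pos_iff_support_of_nonneg_ae]
  · refine lt_of_lt_of_le (isOpen_interlacingSet.measure_pos volume (interlacingSet_nonempty hab))
      (measure_mono fun p hp => ⟨(weight_pos hp).ne', hp⟩)
  · exact (ae_restrict_mem isOpen_interlacingSet.measurableSet).mono fun p hp => (weight_pos hp).le
  · exact integrableOn_of_continuousOn_cube (continuousOn_weight hθ hVt hVb)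

omit hab hθ hVt hVb in
theorem law_eq : law N θ a b Vt Vb = (volume.restrict (interlacingSet N a b)).withDensity
    fun p => ENNReal.ofReal (weight N θ Vt Vb p / partitionFunction N θ a b Vt Vb) := by
  rw [law, ← withDensity_indicator isOpen_interlacingSet.measurableSet]
  congr 1
  ext p
  by_cases hp : p ∈ interlacingSet N a b <;> simp [density, hp]

theorem isProbabilityMeasure_law : IsProbabilityMeasure (law N θ a b Vt Vb) := by
  have hZ := partitionFunction_pos (N := N) hab hθ hVt hVb
  constructor
  rw [law_eq, withDensity_apply _ MeasurableSet.univ, Measure.restrict_univ,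
    ← ofReal_integral_eq_lintegral_ofReal]
  · rw [integral_div, ← partitionFunction, div_self hZ.ne', ENNReal.ofReal_one]
  · exact (integrableOn_of_continuousOn_cube (continuousOn_weight hθ hVt hVb)).div_const _
  · exact (ae_restrict_mem isOpen_interlacingSet.measurableSet).mono fun p hp =>
      div_nonneg (weight_pos hp).le hZ.le

theorem integral_law {E : Type*} [NormedAddCommGroup E] [NormedSpace ℝ E]
    (F : (Fin N → ℝ) × (Fin (N - 1) → ℝ) → E) :
    ∫ p, F p ∂(law N θ a b Vt Vb) = (partitionFunction N θ a b Vt Vb)⁻¹ •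
      ∫ p in interlacingSet N a b, weight N θ Vt Vb p • F p := by
  have hZ := partitionFunction_pos (N := N) hab hθ hVt hVb
  have hw := (integrableOn_of_continuousOn_cube (continuousOn_weight (N := N) hθ hVt hVb)).aemeasurable
  rw [law_eq, integral_withDensity_eq_integral_toReal_smul₀ (hw.div_const _).ennreal_ofReal
    (Filter.Eventually.of_forall fun _ => ENNReal.ofReal_lt_top), ← integral_smul]
  refine setIntegral_congr_fun isOpen_interlacingSet.measurableSet fun p hp => ?_
  rw [ENNReal.toReal_ofReal (div_nonneg (weight_pos hp).le hZ.le), smul_smul, div_eq_inv_mul]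

omit hab hθ hVt hVb in
theorem ae_law_mem : ∀ᵐ p ∂(law N θ a b Vt Vb), p ∈ interlacingSet N a b := by
  rw [law_eq]
  exact (withDensity_absolutelyContinuous _ _).ae_le
    (ae_restrict_mem isOpen_interlacingSet.measurableSet)

omit hab hθ hVt hVb in
theorem aestronglyMeasurable_law {E : Type*} [NormedAddCommGroup E]
    {F : (Fin N → ℝ) × (Fin (N - 1) → ℝ) → E} (hF : ContinuousOn F (cube N a b)) :
    AEStronglyMeasurable F (law N θ a b Vt Vb) := by
  rw [law_eq]
  exact (integrableOn_of_continuousOn_cube hF).1.mono_ac (withDensity_absolutelyContinuous _ _)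

theorem integrable_law {E : Type*} [NormedAddCommGroup E]
    {F : (Fin N → ℝ) × (Fin (N - 1) → ℝ) → E} (hF : ContinuousOn F (cube N a b)) :
    Integrable F (law N θ a b Vt Vb) := by
  have := isProbabilityMeasure_law (N := N) hab hθ hVt hVb
  obtain ⟨C, hC⟩ := isCompact_cube.exists_bound_of_continuousOn hF
  exact Integrable.of_bound (aestronglyMeasurable_law hF) C
    (ae_law_mem.mono fun p hp => hC p (interlacingSet_subset_cube hp))

end law

end Gibbs

/-! ### The Ward identity of a real vector field. -/

section Ward

open Set Filter Topology

variable {N : ℕ} {θ a b : ℝ} {Vt Vb : ℂ → ℂ}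

/-- At `t = 0` every factor is `1`, so the derivative of a product is the sum of the derivatives;
logarithms of possibly vanishing factors of the weight are never taken. -/
theorem hasDerivAt_prod_of_eq_one {κ : Type*} [Fintype κ] {f : κ → ℝ → ℝ} {f' : κ → ℝ}
    (h1 : ∀ i, f i 0 = 1) (hd : ∀ i, HasDerivAt (f i) (f' i) 0) :
    HasDerivAt (fun t => ∏ i, f i t) (∑ i, f' i) 0 := by
  classical
  have := HasDerivAt.fun_finsetProd (u := Finset.univ) fun i _ => hd i
  simpa [h1] using this

theorem hasDerivAt_finset_prod_of_eq_one {κ : Type*} {s : Finset κ} {f : κ → ℝ → ℝ} {f' : κ → ℝ}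
    (h1 : ∀ i, f i 0 = 1) (hd : ∀ i, HasDerivAt (f i) (f' i) 0) :
    HasDerivAt (fun t => ∏ i ∈ s, f i t) (∑ i ∈ s, f' i) 0 := by
  classical
  have := HasDerivAt.fun_finsetProd (u := s) fun i _ => hd i
  simpa [h1] using this

/-- A vector field on `[a, b]` vanishing at the end points, with its divided differences. -/
structure IsField (a b : ℝ) (h : ℝ → ℝ) (D : ℝ → ℝ → ℝ) : Prop where
  left : h a = 0
  right : h b = 0
  sub_eq : ∀ x ∈ Icc a b, ∀ y ∈ Icc a b, h x - h y = D x y * (x - y)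
  contDiffAt_div : ∀ x ∈ Icc a b, ∀ y ∈ Icc a b,
    ContDiffAt ℝ 1 (fun q : ℝ × ℝ => D q.1 q.2) (x, y)
  hasDerivAt : ∀ x ∈ Icc a b, HasDerivAt h (D x x) x
  contDiffAt : ∀ x ∈ Icc a b, ContDiffAt ℝ 1 h x

variable {h : ℝ → ℝ} {D : ℝ → ℝ → ℝ}

/-- The deformation `x ↦ x + t h(x)` of all the points of a configuration. -/
def deform (h : ℝ → ℝ) (t : ℝ) (p : (Fin N → ℝ) × (Fin (N - 1) → ℝ)) :
    (Fin N → ℝ) × (Fin (N - 1) → ℝ) :=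
  (fun i => p.1 i + t * h (p.1 i), fun j => p.2 j + t * h (p.2 j))

/-- The logarithmic derivative of the weight along the deformation. -/
def deformLog (N : ℕ) (θ : ℝ) (Vt Vb : ℂ → ℂ) (h : ℝ → ℝ) (D : ℝ → ℝ → ℝ)
    (p : (Fin N → ℝ) × (Fin (N - 1) → ℝ)) : ℝ :=
  (∑ i, ∑ j ∈ Finset.Ioi i, D (p.1 j) (p.1 i)) + (∑ i, ∑ j ∈ Finset.Ioi i, D (p.2 j) (p.2 i))
    + (∑ i, ∑ j, (θ - 1) * D (p.2 i) (p.1 j))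
    + (∑ i, -(N * θ * ((deriv Vb (p.2 i)).re * h (p.2 i))))
    + (∑ i, -(N * θ * ((deriv Vt (p.1 i)).re * h (p.1 i))))
    + (∑ i, D (p.1 i) (p.1 i)) + ∑ i, D (p.2 i) (p.2 i)

/-- The factor by which the deformation changes the weight, Jacobian included. -/
def deformFactor (N : ℕ) (θ : ℝ) (Vt Vb : ℂ → ℂ) (h : ℝ → ℝ) (D : ℝ → ℝ → ℝ) (t : ℝ)
    (p : (Fin N → ℝ) × (Fin (N - 1) → ℝ)) : ℝ :=
  (∏ i, ∏ j ∈ Finset.Ioi i, (1 + t * D (p.1 j) (p.1 i)))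
    * (∏ i, ∏ j ∈ Finset.Ioi i, (1 + t * D (p.2 j) (p.2 i)))
    * (∏ i, ∏ j, (1 + t * D (p.2 i) (p.1 j)) ^ (θ - 1))
    * (∏ i, Real.exp (-(N * θ * ((Vb (p.2 i + t * h (p.2 i) : ℝ)).re - (Vb (p.2 i)).re))))
    * (∏ i, Real.exp (-(N * θ * ((Vt (p.1 i + t * h (p.1 i) : ℝ)).re - (Vt (p.1 i)).re))))
    * (∏ i, (1 + t * D (p.1 i) (p.1 i))) * ∏ i, (1 + t * D (p.2 i) (p.2 i))

theorem hasDerivAt_re_comp {V : ℂ → ℂ} {x : ℝ} (hV : DifferentiableAt ℂ V x) (c : ℝ) :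
    HasDerivAt (fun t : ℝ => (V (x + t * c : ℝ)).re) ((deriv V x).re * c) 0 := by
  have h1 : HasDerivAt V (deriv V x) ((x + 0 * c : ℝ) : ℂ) := by simpa using hV.hasDerivAt
  have h2 : HasDerivAt (fun t : ℝ => x + t * c) c 0 := by
    simpa using ((hasDerivAt_id (0 : ℝ)).mul_const c).const_add x
  exact (h1.real_of_complex (z := x + 0 * c)).comp (0 : ℝ) h2

theorem hasDerivAt_deformFactor {p : (Fin N → ℝ) × (Fin (N - 1) → ℝ)}
    (hVt : ∀ i, DifferentiableAt ℂ Vt (p.1 i)) (hVb : ∀ i, DifferentiableAt ℂ Vb (p.2 i)) :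
    HasDerivAt (fun t => deformFactor N θ Vt Vb h D t p) (deformLog N θ Vt Vb h D p) 0 := by
  have hlin : ∀ c : ℝ, HasDerivAt (fun t : ℝ => 1 + t * c) c 0 := fun c => by
    simpa using ((hasDerivAt_id (0 : ℝ)).mul_const c).const_add 1
  have hrpow : ∀ c : ℝ, HasDerivAt (fun t : ℝ => (1 + t * c) ^ (θ - 1)) ((θ - 1) * c) 0 := by
    intro c
    have := (hlin c).rpow_const (p := θ - 1) (Or.inl (by simp))
    simpa [mul_comm] using this
  have hexp : ∀ (V : ℂ → ℂ) (x : ℝ), DifferentiableAt ℂ V x →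
      HasDerivAt (fun t : ℝ => Real.exp (-(N * θ * ((V (x + t * h x : ℝ)).re - (V x).re))))
        (-(N * θ * ((deriv V x).re * h x))) 0 := by
    intro V x hV
    have := (((hasDerivAt_re_comp hV (h x)).sub_const (V x).re).const_mul (N * θ : ℝ)).neg.exp
    simpa using this
  have e1 := hasDerivAt_prod_of_eq_one (fun i => by simp)
    fun i : Fin N => hasDerivAt_finset_prod_of_eq_one (s := Finset.Ioi i) (by simp)
      fun j => hlin (D (p.1 j) (p.1 i))
  have e2 := hasDerivAt_prod_of_eq_one (fun i => by simp)
    fun i : Fin (N - 1) => hasDerivAt_finset_prod_of_eq_one (s := Finset.Ioi i) (by simp)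
      fun j => hlin (D (p.2 j) (p.2 i))
  have e3 := hasDerivAt_prod_of_eq_one (fun i => by simp)
    fun i : Fin (N - 1) => hasDerivAt_prod_of_eq_one (by simp)
      fun j : Fin N => hrpow (D (p.2 i) (p.1 j))
  have e4 := hasDerivAt_prod_of_eq_one (fun i => by simp) fun i => hexp Vb (p.2 i) (hVb i)
  have e5 := hasDerivAt_prod_of_eq_one (fun i => by simp) fun i => hexp Vt (p.1 i) (hVt i)
  have e6 := hasDerivAt_prod_of_eq_one (fun i => by simp) fun i => hlin (D (p.1 i) (p.1 i))
  have e7 := hasDerivAt_prod_of_eq_one (fun i => by simp) fun i => hlin (D (p.2 i) (p.2 i))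
  have := (((((e1.mul e2).mul e3).mul e4).mul e5).mul e6).mul e7
  refine HasDerivAt.congr_deriv (f := fun t => deformFactor N θ Vt Vb h D t p) this ?_
  simp [deformLog]

theorem contDiffAt_deform (hh : ∀ x ∈ Icc a b, ContDiffAt ℝ 1 h x) {t : ℝ}
    {p : (Fin N → ℝ) × (Fin (N - 1) → ℝ)} (hp : p ∈ cube N a b) :
    ContDiffAt ℝ 1 (fun q : ℝ × ((Fin N → ℝ) × (Fin (N - 1) → ℝ)) => deform h q.1 q.2) (t, p) := by
  have key : ∀ {f : ℝ × ((Fin N → ℝ) × (Fin (N - 1) → ℝ)) → ℝ}, ContDiff ℝ 1 f →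
      f (t, p) ∈ Icc a b → ContDiffAt ℝ 1 (fun q => f q + q.1 * h (f q)) (t, p) := by
    intro f hf hfp
    have h1 : ContDiffAt ℝ 1 (fun q => h (f q)) (t, p) :=
      ContDiffAt.comp (t, p) (hh _ hfp) hf.contDiffAt
    exact hf.contDiffAt.add (contDiffAt_fst.mul h1)
  refine ContDiffAt.prodMk (contDiffAt_pi.2 fun i => ?_) (contDiffAt_pi.2 fun i => ?_)
  · exact key (by fun_prop) ((mem_cube.1 hp).1 i)
  · exact key (by fun_prop) ((mem_cube.1 hp).2 i)

theorem contDiffAt_deformFactor (hF : IsField a b h D) (hVt : ∀ x ∈ Icc a b, AnalyticAt ℂ Vt (x : ℂ))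
    (hVb : ∀ x ∈ Icc a b, AnalyticAt ℂ Vb (x : ℂ))
    {p : (Fin N → ℝ) × (Fin (N - 1) → ℝ)} (hp : p ∈ cube N a b) :
    ContDiffAt ℝ 1 (fun q : ℝ × ((Fin N → ℝ) × (Fin (N - 1) → ℝ)) =>
      deformFactor N θ Vt Vb h D q.1 q.2) (0, p) := by
  have hlin : ∀ {f g : ℝ × ((Fin N → ℝ) × (Fin (N - 1) → ℝ)) → ℝ}, ContDiff ℝ 1 f →
      ContDiff ℝ 1 g → f (0, p) ∈ Icc a b → g (0, p) ∈ Icc a b →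
      ContDiffAt ℝ 1 (fun q => 1 + q.1 * D (f q) (g q)) (0, p) := by
    intro f g hf hg hfp hgp
    have h1 : ContDiffAt ℝ 1 (fun q => D (f q) (g q)) (0, p) :=
      ContDiffAt.comp (g := fun q : ℝ × ℝ => D q.1 q.2) (f := fun q => (f q, g q)) (0, p)
        (hF.contDiffAt_div _ hfp _ hgp) (hf.prodMk hg).contDiffAt
    exact contDiffAt_const.add (contDiffAt_fst.mul h1)
  have hre : ∀ {V : ℂ → ℂ} {f : ℝ × ((Fin N → ℝ) × (Fin (N - 1) → ℝ)) → ℝ} ,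
      ContDiffAt ℝ 1 f (0, p) → AnalyticAt ℂ V (f (0, p)) →
      ContDiffAt ℝ 1 (fun q => (V (f q)).re) (0, p) := by
    intro V f hf hV
    have h1 : ContDiffAt ℝ 1 (fun q => (f q : ℂ)) (0, p) :=
      Complex.ofRealCLM.contDiff.contDiffAt.comp (0, p) hf
    have h2 : ContDiffAt ℝ 1 (fun q => V (f q)) (0, p) :=
      ContDiffAt.comp (g := V) (0, p) (hV.contDiffAt.restrict_scalars ℝ) h1
    exact Complex.reCLM.contDiff.contDiffAt.comp (0, p) h2
  have hexp : ∀ {V : ℂ → ℂ} {f : ℝ × ((Fin N → ℝ) × (Fin (N - 1) → ℝ)) → ℝ},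
      ContDiff ℝ 1 f → f (0, p) ∈ Icc a b → (∀ x ∈ Icc a b, AnalyticAt ℂ V (x : ℂ)) →
      ContDiffAt ℝ 1 (fun q => Real.exp (-(N * θ * ((V (f q + q.1 * h (f q) : ℝ)).re
        - (V (f q)).re)))) (0, p) := by
    intro V f hf hfp hV
    have h1 : ContDiffAt ℝ 1 (fun q => f q + q.1 * h (f q)) (0, p) :=
      hf.contDiffAt.add (contDiffAt_fst.mul
        (ContDiffAt.comp (0, p) (hF.contDiffAt _ hfp) hf.contDiffAt))
    have h2 := hre (V := V) h1 (by simpa using hV _ hfp)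
    exact (contDiffAt_const.mul (h2.sub (hre hf.contDiffAt (hV _ hfp)))).neg.exp
  obtain ⟨hp1, hp2⟩ := mem_cube.1 hp
  refine ContDiffAt.mul (ContDiffAt.mul (ContDiffAt.mul (ContDiffAt.mul (ContDiffAt.mul
    (ContDiffAt.mul ?_ ?_) ?_) ?_) ?_) ?_) ?_
  · exact contDiffAt_prod fun i _ => contDiffAt_prod fun j _ =>
      hlin (by fun_prop) (by fun_prop) (hp1 j) (hp1 i)
  · exact contDiffAt_prod fun i _ => contDiffAt_prod fun j _ =>
      hlin (by fun_prop) (by fun_prop) (hp2 j) (hp2 i)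
  · exact contDiffAt_prod fun i _ => contDiffAt_prod fun j _ =>
      (hlin (by fun_prop) (by fun_prop) (hp2 i) (hp1 j)).rpow_const_of_ne (by simp)
  · exact contDiffAt_prod fun i _ => hexp (by fun_prop) (hp2 i) hVb
  · exact contDiffAt_prod fun i _ => hexp (by fun_prop) (hp1 i) hVt
  · exact contDiffAt_prod fun i _ => hlin (by fun_prop) (by fun_prop) (hp1 i) (hp1 i)
  · exact contDiffAt_prod fun i _ => hlin (by fun_prop) (by fun_prop) (hp2 i) (hp2 i)

theorem IsField.add_mul_sub (hF : IsField a b h D) (t : ℝ) {x y : ℝ} (hx : x ∈ Icc a b)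
    (hy : y ∈ Icc a b) : (x + t * h x) - (y + t * h y) = (x - y) * (1 + t * D x y) := by
  linear_combination t * hF.sub_eq x hx y hy

/-- Each difference of two points is multiplied by `1 + t D`, so the weight changes by an explicit
factor. Stated as a product, this needs no division by the weight and remains meaningful where
points collide. -/
theorem weight_deform (hF : IsField a b h D) {t : ℝ}
    (ht : ∀ x ∈ Icc a b, ∀ y ∈ Icc a b, 0 < 1 + t * D x y)
    {p : (Fin N → ℝ) × (Fin (N - 1) → ℝ)} (hp : p ∈ cube N a b) :
    ((∏ i, (1 + t * D (p.1 i) (p.1 i))) * ∏ i, (1 + t * D (p.2 i) (p.2 i))) *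
      weight N θ Vt Vb (deform h t p) = weight N θ Vt Vb p * deformFactor N θ Vt Vb h D t p := by
  obtain ⟨hp1, hp2⟩ := mem_cube.1 hp
  have e3 : ∀ i j, |(deform h t p).2 i - (deform h t p).1 j| ^ (θ - 1)
      = |p.2 i - p.1 j| ^ (θ - 1) * (1 + t * D (p.2 i) (p.1 j)) ^ (θ - 1) := by
    intro i j
    have hpos := ht _ (hp2 i) _ (hp1 j)
    rw [deform, hF.add_mul_sub t (hp2 i) (hp1 j), abs_mul, abs_of_pos hpos,
      Real.mul_rpow (abs_nonneg _) hpos.le]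
  have hexp : ∀ (V : ℂ → ℂ) (x y : ℝ), Real.exp (-(N * θ * (V x).re))
      = Real.exp (-(N * θ * (V y).re)) * Real.exp (-(N * θ * ((V x).re - (V y).re))) := by
    intro V x y
    rw [← Real.exp_add]
    ring_nf
  have e4 : ∀ i, Real.exp (-(N * θ * (Vb ((deform h t p).2 i)).re))
      = Real.exp (-(N * θ * (Vb (p.2 i)).re)) *
        Real.exp (-(N * θ * ((Vb (p.2 i + t * h (p.2 i) : ℝ)).re - (Vb (p.2 i)).re))) :=
    fun i => hexp Vb _ _
  have e5 : ∀ i, Real.exp (-(N * θ * (Vt ((deform h t p).1 i)).re))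
      = Real.exp (-(N * θ * (Vt (p.1 i)).re)) *
        Real.exp (-(N * θ * ((Vt (p.1 i + t * h (p.1 i) : ℝ)).re - (Vt (p.1 i)).re))) :=
    fun i => hexp Vt _ _
  have e1 : ∀ i j, (deform h t p).1 j - (deform h t p).1 i
      = (p.1 j - p.1 i) * (1 + t * D (p.1 j) (p.1 i)) :=
    fun i j => hF.add_mul_sub t (hp1 j) (hp1 i)
  have e2 : ∀ i j, (deform h t p).2 j - (deform h t p).2 i
      = (p.2 j - p.2 i) * (1 + t * D (p.2 j) (p.2 i)) :=
    fun i j => hF.add_mul_sub t (hp2 j) (hp2 i)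
  simp only [weight, deformFactor, e1, e2, e3, e4, e5, Finset.prod_mul_distrib]
  ring

/-- The map `x ↦ x + t h(x)` is continuous and strictly increasing on `[a, b]` with fixed end
points. It preserves and reflects the interlacing inequalities, and it is onto by the intermediate
value theorem. -/
theorem image_deform (hab : a < b) (hF : IsField a b h D) {t : ℝ}
    (ht : ∀ x ∈ Icc a b, ∀ y ∈ Icc a b, 0 < 1 + t * D x y) :
    deform h t '' interlacingSet N a b = interlacingSet N a b := by
  have hmono : StrictMonoOn (fun x => x + t * h x) (Icc a b) := by
    intro x hx y hy hxy
    have := mul_pos (sub_pos.2 hxy) (ht y hy x hx)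
    rw [← hF.add_mul_sub t hy hx] at this
    exact sub_pos.1 this
  have hcont : ContinuousOn (fun x => x + t * h x) (Icc a b) := fun x hx =>
    (continuousAt_id.add (continuousAt_const.mul
      (hF.hasDerivAt x hx).continuousAt)).continuousWithinAt
  have ha : a + t * h a = a := by rw [hF.left, mul_zero, add_zero]
  have hb : b + t * h b = b := by rw [hF.right, mul_zero, add_zero]
  have hamem : a ∈ Icc a b := left_mem_Icc.2 hab.le
  have hbmem : b ∈ Icc a b := right_mem_Icc.2 hab.le
  have key : ∀ {p : (Fin N → ℝ) × (Fin (N - 1) → ℝ)}, p ∈ cube N a b →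
      (deform h t p ∈ interlacingSet N a b ↔ p ∈ interlacingSet N a b) := by
    intro p hp
    obtain ⟨hp1, hp2⟩ := mem_cube.1 hp
    simp only [interlacingSet, Set.mem_ofPred_eq, deform]
    refine and_congr (forall_congr' fun i => and_congr ?_ ?_)
      (forall_congr' fun i => and_congr ?_ ?_)
    · have := hmono.lt_iff_lt hamem (hp1 i)
      simpa only [ha] using this
    · have := hmono.lt_iff_lt (hp1 i) hbmem
      simpa only [hb] using this
    · exact hmono.lt_iff_lt (hp1 _) (hp2 i)
    · exact hmono.lt_iff_lt (hp2 i) (hp1 _)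
  ext q
  constructor
  · rintro ⟨p, hp, rfl⟩
    exact (key (interlacingSet_subset_cube hp)).2 hp
  · intro hq
    obtain ⟨hq1, hq2⟩ := mem_cube.1 (interlacingSet_subset_cube hq)
    have hsurj : ∀ y ∈ Icc a b, ∃ x ∈ Icc a b, x + t * h x = y := by
      intro y hy
      have := intermediate_value_Icc hab.le hcont
      simp only [ha, hb] at this
      exact this hy
    choose x hx hxq using fun i => hsurj _ (hq1 i)
    choose y hy hyq using fun i => hsurj _ (hq2 i)
    have heq : deform h t (x, y) = q := Prod.ext (funext hxq) (funext hyq)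
    exact ⟨(x, y), (key (mem_cube.2 ⟨hx, hy⟩)).1 (heq ▸ hq), heq⟩

theorem injOn_deform (hF : IsField a b h D) {t : ℝ}
    (ht : ∀ x ∈ Icc a b, ∀ y ∈ Icc a b, 0 < 1 + t * D x y) :
    InjOn (deform h t) (cube N a b) := by
  have hinj : ∀ x ∈ Icc a b, ∀ y ∈ Icc a b, x + t * h x = y + t * h y → x = y := by
    intro x hx y hy hxy
    have := hF.add_mul_sub t hx hy
    rw [hxy, sub_self, eq_comm, mul_eq_zero] at this
    exact sub_eq_zero.1 (this.resolve_right (ht x hx y hy).ne')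
  intro p hp q hq hpq
  rw [mem_cube] at hp hq
  refine Prod.ext (funext fun i => ?_) (funext fun i => ?_)
  · exact hinj _ (hp.1 i) _ (hq.1 i) (congrFun (congrArg Prod.fst hpq) i)
  · exact hinj _ (hp.2 i) _ (hq.2 i) (congrFun (congrArg Prod.snd hpq) i)

/-- The integral of `F` against the weight, after the deformation. -/
theorem integral_deform (hab : a < b) (hF : IsField a b h D) {t : ℝ}
    (ht : ∀ x ∈ Icc a b, ∀ y ∈ Icc a b, 0 < 1 + t * D x y)
    (F : (Fin N → ℝ) × (Fin (N - 1) → ℝ) → ℂ) :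
    ∫ p in interlacingSet N a b, weight N θ Vt Vb p • F p
      = ∫ p in interlacingSet N a b,
        weight N θ Vt Vb p • (deformFactor N θ Vt Vb h D t p • F (deform h t p)) := by
  have hsing : ∀ x ∈ Icc a b, HasFDerivAt (fun x => x + t * h x)
      (ContinuousLinearMap.toSpanSingleton ℝ (1 + t * D x x)) x := by
    intro x hx
    have := (hasDerivAt_id x).add ((hF.hasDerivAt x hx).const_mul t)
    exact this.hasFDerivAt
  set f' : (Fin N → ℝ) × (Fin (N - 1) → ℝ) →
      ((Fin N → ℝ) × (Fin (N - 1) → ℝ) →L[ℝ] (Fin N → ℝ) × (Fin (N - 1) → ℝ)) := fun p =>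
    (ContinuousLinearMap.pi fun i =>
      (ContinuousLinearMap.toSpanSingleton ℝ (1 + t * D (p.1 i) (p.1 i))).comp
        (ContinuousLinearMap.proj i)).prodMap
    (ContinuousLinearMap.pi fun i =>
      (ContinuousLinearMap.toSpanSingleton ℝ (1 + t * D (p.2 i) (p.2 i))).comp
        (ContinuousLinearMap.proj i)) with hf'
  have hderiv : ∀ p ∈ interlacingSet N a b,
      HasFDerivWithinAt (deform h t) (f' p) (interlacingSet N a b) p := by
    intro p hp
    obtain ⟨hp1, hp2⟩ := mem_cube.1 (interlacingSet_subset_cube hp)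
    refine HasFDerivAt.hasFDerivWithinAt ?_
    refine HasFDerivAt.prodMap (f := fun x : Fin N → ℝ => fun i => x i + t * h (x i))
      (f₂ := fun x : Fin (N - 1) → ℝ => fun i => x i + t * h (x i)) p ?_ ?_
    · exact hasFDerivAt_pi.2 fun i => HasFDerivAt.comp (g := fun x : ℝ => x + t * h x)
        (f := fun x : Fin N → ℝ => x i) p.1 (hsing _ (hp1 i))
        (ContinuousLinearMap.proj (R := ℝ) (φ := fun _ : Fin N => ℝ) i).hasFDerivAt
    · exact hasFDerivAt_pi.2 fun i => HasFDerivAt.comp (g := fun x : ℝ => x + t * h x)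
        (f := fun x : Fin (N - 1) → ℝ => x i) p.2 (hsing _ (hp2 i))
        (ContinuousLinearMap.proj (R := ℝ) (φ := fun _ : Fin (N - 1) => ℝ) i).hasFDerivAt
  -- Each coordinate is moved independently of the others, so the Jacobian matrix is diagonal.
  have hdet : ∀ p, (f' p).det
      = (∏ i, (1 + t * D (p.1 i) (p.1 i))) * ∏ i, (1 + t * D (p.2 i) (p.2 i)) := by
    intro p
    rw [hf', ContinuousLinearMap.det]
    simp only [ContinuousLinearMap.coe_prodMap]
    rw [LinearMap.det_prodMap]
    congr 1
    · refine (ContinuousLinearMap.det_pi _).trans ?_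
      simp only [ContinuousLinearMap.det_toSpanSingleton]
    · refine (ContinuousLinearMap.det_pi _).trans ?_
      simp only [ContinuousLinearMap.det_toSpanSingleton]
  have hhaar : (volume : Measure ((Fin N → ℝ) × (Fin (N - 1) → ℝ))).IsAddHaarMeasure := by
    exact Measure.prod.instIsAddHaarMeasure _ _
  have hcv := integral_image_eq_integral_abs_det_fderiv_smul volume
    isOpen_interlacingSet.measurableSet hderiv
    ((injOn_deform hF ht).mono interlacingSet_subset_cube)
    fun p => weight N θ Vt Vb p • F p
  rw [image_deform hab hF ht] at hcv
  rw [hcv]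
  refine setIntegral_congr_fun isOpen_interlacingSet.measurableSet fun p hp => ?_
  have hp' := interlacingSet_subset_cube hp
  obtain ⟨hp1, hp2⟩ := mem_cube.1 hp'
  have hpos : 0 < (∏ i, (1 + t * D (p.1 i) (p.1 i))) * ∏ i, (1 + t * D (p.2 i) (p.2 i)) :=
    mul_pos (Finset.prod_pos fun i _ => ht _ (hp1 i) _ (hp1 i))
      (Finset.prod_pos fun i _ => ht _ (hp2 i) _ (hp2 i))
  simp only [hdet]
  rw [abs_of_pos hpos, smul_smul, smul_smul, weight_deform hF ht hp']

/-- The Ward identity of a real vector field. -/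
theorem ward_real (hab : a < b) (hθ : 1 ≤ θ) (hVt : ∀ x ∈ Icc a b, AnalyticAt ℂ Vt (x : ℂ))
    (hVb : ∀ x ∈ Icc a b, AnalyticAt ℂ Vb (x : ℂ)) (hF : IsField a b h D)
    {F : (Fin N → ℝ) × (Fin (N - 1) → ℝ) → ℂ} (hFc : ∀ p ∈ cube N a b, ContDiffAt ℝ 1 F p) :
    IntegrableOn (fun p => weight N θ Vt Vb p • (deformLog N θ Vt Vb h D p • F p
        + fderiv ℝ F p (fun i => h (p.1 i), fun j => h (p.2 j)))) (interlacingSet N a b) ∧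
    ∫ p in interlacingSet N a b, weight N θ Vt Vb p •
      (deformLog N θ Vt Vb h D p • F p
        + fderiv ℝ F p (fun i => h (p.1 i), fun j => h (p.2 j))) = 0 := by
  set R : ℝ × ((Fin N → ℝ) × (Fin (N - 1) → ℝ)) → ℂ :=
    fun q => deformFactor N θ Vt Vb h D q.1 q.2 • F (deform h q.1 q.2) with hR
  have hdeform0 : ∀ p : (Fin N → ℝ) × (Fin (N - 1) → ℝ), deform h 0 p = p := fun p => by
    simp [deform]
  have hRc : ∀ p ∈ cube N a b, ContDiffAt ℝ 1 R (0, p) := by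
    intro p hp
    refine (contDiffAt_deformFactor hF hVt hVb hp).smul ?_
    exact ContDiffAt.comp (g := F) (0, p) (by simpa [hdeform0] using hFc p hp)
      (contDiffAt_deform hF.contDiffAt hp)
  -- Compactness of the cube gives one range of `t` in which the deformed integrand is `C^1` at all
  -- configurations and all the factors `1 + t D` are positive. The bound `C` on its `t`-derivative
  -- below comes from compactness too.
  have hRev : ∀ᶠ t in 𝓝 (0 : ℝ), ∀ p ∈ cube N a b, ContDiffAt ℝ 1 R (t, p) :=
    isCompact_cube.eventually_forall_of_forall_eventually fun p hp =>
      (hRc p hp).eventually (by simp)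
  have hpos : ∀ᶠ t in 𝓝 (0 : ℝ), ∀ x ∈ Icc a b, ∀ y ∈ Icc a b, 0 < 1 + t * D x y := by
    have : ∀ᶠ t in 𝓝 (0 : ℝ), ∀ q ∈ Icc a b ×ˢ Icc a b, 0 < 1 + t * D q.1 q.2 := by
      refine (isCompact_Icc.prod isCompact_Icc).eventually_forall_of_forall_eventually fun q hq => ?_
      have hc : ContinuousAt (fun z : ℝ × (ℝ × ℝ) => 1 + z.1 * D z.2.1 z.2.2) (0, q) := by
        have h1 : ContinuousAt (fun z : ℝ × (ℝ × ℝ) => D z.2.1 z.2.2) (0, q) :=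
          ContinuousAt.comp (g := fun q : ℝ × ℝ => D q.1 q.2) (f := Prod.snd)
            (hF.contDiffAt_div _ hq.1 _ hq.2).continuousAt continuousAt_snd
        exact continuousAt_const.add (continuousAt_fst.mul h1)
      exact hc.eventually (lt_mem_nhds (by simp))
    exact this.mono fun t ht x hx y hy => ht (x, y) ⟨hx, hy⟩
  obtain ⟨ε, hε, hball⟩ := Metric.nhds_basis_closedBall.mem_iff.1 (hRev.and hpos)
  have hfd : ContinuousOn (fun q => fderiv ℝ R q (1, 0)) (Metric.closedBall 0 ε ×ˢ cube N a b) :=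
    fun q hq => ((((hball hq.1).1 q.2 hq.2).continuousAt_fderiv one_ne_zero).clm_apply
      continuousAt_const).continuousWithinAt
  obtain ⟨C, hC⟩ := ((isCompact_closedBall (0 : ℝ) ε).prod isCompact_cube).exists_bound_of_continuousOn
    hfd
  have hw : ContinuousOn (weight N θ Vt Vb) (cube N a b) :=
    continuousOn_weight hθ (fun x hx => (hVt x hx).continuousAt) fun x hx => (hVb x hx).continuousAt
  have hmem := ae_restrict_mem (μ := volume) (isOpen_interlacingSet (N := N) (a := a)
    (b := b)).measurableSet
  have hint : ∀ t ∈ Metric.closedBall (0 : ℝ) ε,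
      IntegrableOn (fun p => weight N θ Vt Vb p • R (t, p)) (interlacingSet N a b) := by
    intro t ht
    refine integrableOn_of_continuousOn_cube (hw.smul fun p hp => ?_)
    exact (ContinuousAt.comp (f := fun p => (t, p)) ((hball ht).1 p hp).continuousAt
      (by fun_prop)).continuousWithinAt
  have hmain := hasDerivAt_integral_of_dominated_loc_of_deriv_le
    (μ := volume.restrict (interlacingSet N a b)) (s := Metric.closedBall (0 : ℝ) ε) (x₀ := 0)
    (F := fun t p => weight N θ Vt Vb p • R (t, p))
    (F' := fun t p => weight N θ Vt Vb p • fderiv ℝ R (t, p) (1, 0))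
    (bound := fun p => weight N θ Vt Vb p * C)
    (Metric.closedBall_mem_nhds _ hε) ?_ (hint 0 (Metric.mem_closedBall_self hε.le)) ?_ ?_
    ((integrableOn_of_continuousOn_cube hw).mul_const _) ?_
  -- By the change of variables the integral does not depend on `t`, so its derivative at `0`, taken
  -- under the integral sign, vanishes.
  · have hconst : ∀ᶠ t in 𝓝 (0 : ℝ), ∫ p in interlacingSet N a b, weight N θ Vt Vb p • R (t, p)
        = ∫ p in interlacingSet N a b, weight N θ Vt Vb p • F p :=
      hpos.mono fun t ht => (integral_deform hab hF ht F).symm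
    have hzero := hmain.2.unique ((hasDerivAt_const (0 : ℝ) _).congr_of_eventuallyEq hconst)
    suffices hcongr : EqOn (fun p => weight N θ Vt Vb p • fderiv ℝ R (0, p) (1, 0))
        (fun p => weight N θ Vt Vb p • (deformLog N θ Vt Vb h D p • F p
          + fderiv ℝ F p (fun i => h (p.1 i), fun j => h (p.2 j)))) (interlacingSet N a b) by
      exact ⟨IntegrableOn.congr_fun hmain.1 hcongr isOpen_interlacingSet.measurableSet,
        (setIntegral_congr_fun isOpen_interlacingSet.measurableSet hcongr).symm.trans hzero⟩
    intro p hp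
    have hp' := interlacingSet_subset_cube hp
    obtain ⟨hp1, hp2⟩ := mem_cube.1 hp'
    dsimp only
    congr 1
    have h1 : HasDerivAt (fun t => R (t, p)) (fderiv ℝ R (0, p) (1, 0)) 0 := by
      have := ((hRc p hp').differentiableAt one_ne_zero).hasFDerivAt
      exact this.comp_hasDerivAt (0 : ℝ) ((hasDerivAt_id (0 : ℝ)).prodMk (hasDerivAt_const 0 p))
    have h2 : HasDerivAt (fun t => deform h t p) (fun i => h (p.1 i), fun j => h (p.2 j)) 0 := by
      refine HasDerivAt.prodMk (hasDerivAt_pi.2 fun i => ?_) (hasDerivAt_pi.2 fun i => ?_)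
      · simpa using ((hasDerivAt_id (0 : ℝ)).mul_const (h (p.1 i))).const_add (p.1 i)
      · simpa using ((hasDerivAt_id (0 : ℝ)).mul_const (h (p.2 i))).const_add (p.2 i)
    have h3 : HasFDerivAt F (fderiv ℝ F p) (deform h 0 p) := by
      rw [hdeform0]
      exact ((hFc p hp').differentiableAt one_ne_zero).hasFDerivAt
    have h4 := (hasDerivAt_deformFactor (N := N) (θ := θ) (h := h) (D := D)
      (fun i => (hVt _ (hp1 i)).differentiableAt)
      fun i => (hVb _ (hp2 i)).differentiableAt).smul (h3.comp_hasDerivAt (0 : ℝ) h2)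
    rw [h1.unique h4]
    simp [hdeform0, deformFactor, add_comm]
  · filter_upwards [Metric.closedBall_mem_nhds (0 : ℝ) hε] with t ht using (hint t ht).1
  · refine (integrableOn_of_continuousOn_cube (hw.smul ?_)).1
    exact hfd.comp (f := fun p => ((0 : ℝ), p)) (by fun_prop)
      fun p hp => ⟨Metric.mem_closedBall_self hε.le, hp⟩
  · filter_upwards [hmem] with p hp t ht
    rw [norm_smul, Real.norm_of_nonneg (weight_pos hp).le]
    exact mul_le_mul_of_nonneg_left (hC (t, p) ⟨ht, interlacingSet_subset_cube hp⟩)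
      (weight_pos hp).le
  · filter_upwards [hmem] with p hp t ht
    have := (((hball ht).1 p (interlacingSet_subset_cube hp)).differentiableAt
      one_ne_zero).hasFDerivAt.comp_hasDerivAt t ((hasDerivAt_id t).prodMk (hasDerivAt_const t p))
    exact this.const_smul (weight N θ Vt Vb p)

end Ward

/-! ### Smooth observables and the complex vector field of the loop equations. -/

section Observables

open Set Filter Topology

variable {N : ℕ} {θ a b : ℝ} {Vt Vb : ℂ → ℂ}

/-! ### The algebra of smooth observables -/

/-- The functions of the configuration that are `C^1` near the cube. -/
def smoothFunctions (N : ℕ) (a b : ℝ) : Subalgebra ℂ ((Fin N → ℝ) × (Fin (N - 1) → ℝ) → ℂ) where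
  carrier := {F | ∀ p ∈ cube N a b, ContDiffAt ℝ 1 F p}
  mul_mem' hF hG p hp := (hF p hp).mul (hG p hp)
  add_mem' hF hG p hp := (hF p hp).add (hG p hp)
  algebraMap_mem' _ _ _ := contDiffAt_const

theorem contDiffAt_coe (F : smoothFunctions N a b)
    {p : (Fin N → ℝ) × (Fin (N - 1) → ℝ)} (hp : p ∈ cube N a b) :
    ContDiffAt ℝ 1 (F : (Fin N → ℝ) × (Fin (N - 1) → ℝ) → ℂ) p := F.2 p hp

theorem continuousOn_coe (F : smoothFunctions N a b) :
    ContinuousOn (F : (Fin N → ℝ) × (Fin (N - 1) → ℝ) → ℂ) (cube N a b) := fun _ hp =>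
  (contDiffAt_coe F hp).continuousAt.continuousWithinAt

/-- The assumptions on the parameters of the two-level log gas. -/
structure Admissible (θ a b : ℝ) (Vt Vb : ℂ → ℂ) : Prop where
  lt : a < b
  one_le : 1 ≤ θ
  top : ∀ x ∈ Icc a b, AnalyticAt ℂ Vt (x : ℂ)
  bot : ∀ x ∈ Icc a b, AnalyticAt ℂ Vb (x : ℂ)
  top_im : ∀ x ∈ Icc a b, (Vt (x : ℂ)).im = 0
  bot_im : ∀ x ∈ Icc a b, (Vb (x : ℂ)).im = 0

variable (H : Admissible θ a b Vt Vb)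

include H

theorem Admissible.integrable {E : Type*} [NormedAddCommGroup E]
    {F : (Fin N → ℝ) × (Fin (N - 1) → ℝ) → E} (hF : ContinuousOn F (cube N a b)) :
    Integrable F (law N θ a b Vt Vb) :=
  integrable_law H.lt H.one_le (fun x hx => (H.top x hx).continuousAt)
    (fun x hx => (H.bot x hx).continuousAt) hF

theorem Admissible.isProbabilityMeasure : IsProbabilityMeasure (law N θ a b Vt Vb) :=
  isProbabilityMeasure_law H.lt H.one_le (fun x hx => (H.top x hx).continuousAt)
    (fun x hx => (H.bot x hx).continuousAt)

/-- The expectation, as a linear form on the smooth observables. -/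
def expectation : smoothFunctions N a b →ₗ[ℂ] ℂ where
  toFun F := ∫ p, F.1 p ∂(law N θ a b Vt Vb)
  map_add' F G := integral_add (H.integrable (continuousOn_coe F)) (H.integrable (continuousOn_coe G))
  map_smul' c F := integral_const_mul c F.1

theorem expectation_apply (F : smoothFunctions N a b) :
    expectation H F = ∫ p, F.1 p ∂(law N θ a b Vt Vb) := rfl

theorem expectation_one : expectation H (1 : smoothFunctions N a b) = 1 := by
  have := H.isProbabilityMeasure (N := N)
  simp [expectation_apply]

theorem expectation_congr {F G : smoothFunctions N a b} (h : ∀ p ∈ cube N a b, F.1 p = G.1 p) :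
    expectation H F = expectation H G :=
  integral_congr_ae (ae_law_mem.mono fun p hp => h p (interlacingSet_subset_cube hp))

omit H in
/-- Evaluation at a configuration. -/
def evalAt (p : (Fin N → ℝ) × (Fin (N - 1) → ℝ)) : smoothFunctions N a b →ₐ[ℂ] ℂ :=
  (Pi.evalAlgHom ℂ (fun _ : (Fin N → ℝ) × (Fin (N - 1) → ℝ) => ℂ) p).comp
    (smoothFunctions N a b).val

omit H in
theorem evalAt_apply (p : (Fin N → ℝ) × (Fin (N - 1) → ℝ)) (F : smoothFunctions N a b) :
    evalAt p F = F.1 p := rfl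

omit H in
/-- The derivative at a configuration in the direction of a complex vector field. -/
def derivAt (h : ℝ → ℂ) {p : (Fin N → ℝ) × (Fin (N - 1) → ℝ)} (hp : p ∈ cube N a b) :
    smoothFunctions N a b →ₗ[ℂ] ℂ where
  toFun F := fderiv ℝ F.1 p (fun i => (h (p.1 i)).re, fun j => (h (p.2 j)).re)
    + Complex.I * fderiv ℝ F.1 p (fun i => (h (p.1 i)).im, fun j => (h (p.2 j)).im)
  map_add' F G := by
    have := fderiv_add ((contDiffAt_coe F hp).differentiableAt one_ne_zero)
      ((contDiffAt_coe G hp).differentiableAt one_ne_zero)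
    change fderiv ℝ (F.1 + G.1) p _ + Complex.I * fderiv ℝ (F.1 + G.1) p _ = _
    rw [this]
    simp only [add_apply]
    ring
  map_smul' c F := by
    have := fderiv_const_smul ((contDiffAt_coe F hp).differentiableAt one_ne_zero) c
    change fderiv ℝ (c • F.1) p _ + Complex.I * fderiv ℝ (c • F.1) p _ = _
    rw [this]
    simp only [smul_apply, smul_eq_mul, RingHom.id_apply]
    ring

omit H in
theorem derivAt_mul (h : ℝ → ℂ) {p : (Fin N → ℝ) × (Fin (N - 1) → ℝ)} (hp : p ∈ cube N a b)
    (F G : smoothFunctions N a b) :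
    derivAt h hp (F * G) = evalAt p F * derivAt h hp G + evalAt p G * derivAt h hp F := by
  have := fderiv_mul ((contDiffAt_coe F hp).differentiableAt one_ne_zero)
    ((contDiffAt_coe G hp).differentiableAt one_ne_zero)
  change fderiv ℝ (F.1 * G.1) p _ + Complex.I * fderiv ℝ (F.1 * G.1) p _
    = F.1 p * (fderiv ℝ G.1 p _ + Complex.I * fderiv ℝ G.1 p _)
      + G.1 p * (fderiv ℝ F.1 p _ + Complex.I * fderiv ℝ F.1 p _)
  rw [this]
  simp only [add_apply, smul_apply, smul_eq_mul]
  ring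

/-! ### Linear statistics of one level -/

omit H in
/-- `X` is one of the two levels of the configuration. -/
structure IsLevel (a b : ℝ) {k : ℕ}
    (X : (Fin N → ℝ) × (Fin (N - 1) → ℝ) →L[ℝ] (Fin k → ℝ)) : Prop where
  mem : ∀ p ∈ cube N a b, ∀ i, X p i ∈ Icc a b
  field : ∀ (h : ℝ → ℝ) p i, X (fun i => h (p.1 i), fun j => h (p.2 j)) i = h (X p i)

omit H in
theorem isLevel_fst : IsLevel a b (ContinuousLinearMap.fst ℝ (Fin N → ℝ) (Fin (N - 1) → ℝ)) :=
  ⟨fun _ hp => (mem_cube.1 hp).1, fun _ _ _ => rfl⟩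

omit H in
theorem isLevel_snd : IsLevel a b (ContinuousLinearMap.snd ℝ (Fin N → ℝ) (Fin (N - 1) → ℝ)) :=
  ⟨fun _ hp => (mem_cube.1 hp).2, fun _ _ _ => rfl⟩

variable {k : ℕ} {X : (Fin N → ℝ) × (Fin (N - 1) → ℝ) →L[ℝ] (Fin k → ℝ)} (hX : IsLevel a b X)

omit H in
theorem IsLevel.contDiffAt_comp (hX : IsLevel a b X) {f : ℝ → ℂ}
    (hf : ∀ x ∈ Icc a b, ContDiffAt ℝ 1 f x) (i : Fin k)
    {p : (Fin N → ℝ) × (Fin (N - 1) → ℝ)} (hp : p ∈ cube N a b) :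
    ContDiffAt ℝ 1 (fun p => f (X p i)) p :=
  ContDiffAt.comp (g := f) p (hf _ (hX.mem p hp i))
    ((contDiff_apply ℝ ℝ i).comp X.contDiff).contDiffAt

omit H in
/-- The linear statistic `∑ i, f (X i)`. -/
def linearStatistic (hX : IsLevel a b X) (f : ℝ → ℂ) (hf : ∀ x ∈ Icc a b, ContDiffAt ℝ 1 f x) :
    smoothFunctions N a b :=
  ⟨fun p => ∑ i, f (X p i), fun _ hp => ContDiffAt.sum fun i _ => hX.contDiffAt_comp hf i hp⟩

omit H in
theorem derivAt_linearStatistic (h : ℝ → ℂ) {f f' : ℝ → ℂ}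
    (hf : ∀ x ∈ Icc a b, ContDiffAt ℝ 1 f x) (hf' : ∀ x ∈ Icc a b, HasDerivAt f (f' x) x)
    {p : (Fin N → ℝ) × (Fin (N - 1) → ℝ)} (hp : p ∈ cube N a b) :
    derivAt h hp (linearStatistic hX f hf) = ∑ i, h (X p i) * f' (X p i) := by
  have hfd : HasFDerivAt (fun p => ∑ i, f (X p i))
      (∑ i, ((ContinuousLinearMap.toSpanSingleton ℝ (f' (X p i))).comp
        ((ContinuousLinearMap.proj i).comp X))) p := by
    refine HasFDerivAt.fun_sum fun i _ => ?_
    exact HasFDerivAt.comp (g := f) (f := fun p => X p i) p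
      (hf' _ (hX.mem p hp i)).hasFDerivAt ((ContinuousLinearMap.proj i).comp X).hasFDerivAt
  change fderiv ℝ (fun p => ∑ i, f (X p i)) p _
    + Complex.I * fderiv ℝ (fun p => ∑ i, f (X p i)) p _ = _
  rw [hfd.fderiv]
  simp only [sum_apply, ContinuousLinearMap.comp_apply,
    ContinuousLinearMap.proj_apply, ContinuousLinearMap.toSpanSingleton_apply]
  rw [Finset.mul_sum, ← Finset.sum_add_distrib]
  refine Finset.sum_congr rfl fun i _ => ?_
  rw [hX.field (fun x => (h x).re), hX.field (fun x => (h x).im)]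
  simp only [Complex.real_smul]
  conv_rhs => rw [← Complex.re_add_im (h (X p i))]
  ring

/-! ### The vector field of the loop equations -/

omit H in
/-- The complex vector field `(x - a)(x - b) / (v - x)`. -/
def loopField (a b : ℝ) (v : ℂ) (x : ℝ) : ℂ := (x - a) * (x - b) / (v - x)

omit H in
/-- The divided differences of `loopField`. -/
def loopDiv (a b : ℝ) (v : ℂ) (x y : ℝ) : ℂ := (v - a) * (v - b) / ((v - x) * (v - y)) - 1

omit H in
theorem sub_ne_zero_of_notMem_segment {v : ℂ} (hv : v ∉ segment a b) {x : ℝ} (hx : x ∈ Icc a b) :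
    v - x ≠ 0 := fun h => hv ⟨x, hx, (sub_eq_zero.1 h).symm⟩

omit H in
theorem contDiffAt_inv_sub {v : ℂ} {x : ℝ} (hx : v - x ≠ 0) :
    ContDiffAt ℝ 1 (fun x : ℝ => (v - x)⁻¹) x :=
  (contDiffAt_const.sub Complex.ofRealCLM.contDiff.contDiffAt).inv hx

omit H in
theorem contDiffAt_loopField {v : ℂ} {x : ℝ} (hx : v - x ≠ 0) :
    ContDiffAt ℝ 1 (loopField a b v) x := by
  have h1 : ContDiffAt ℝ 1 (fun x : ℝ => (x : ℂ)) x := Complex.ofRealCLM.contDiff.contDiffAt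
  exact ((h1.sub contDiffAt_const).mul (h1.sub contDiffAt_const)).mul (contDiffAt_inv_sub hx)

omit H in
theorem hasDerivAt_loopField {v : ℂ} {x : ℝ} (hx : v - x ≠ 0) :
    HasDerivAt (loopField a b v) (loopDiv a b v x x) x := by
  have h1 : HasDerivAt (fun z : ℂ => (z - a) * (z - b) / (v - z)) (loopDiv a b v x x) x := by
    have := (((hasDerivAt_id (x : ℂ)).sub_const (a : ℂ)).mul
      ((hasDerivAt_id (x : ℂ)).sub_const (b : ℂ))).div ((hasDerivAt_id (x : ℂ)).const_sub v) hx
    refine HasDerivAt.congr_deriv (f := fun z : ℂ => (z - a) * (z - b) / (v - z)) this ?_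
    simp only [id, Pi.mul_apply, loopDiv]
    field_simp
    ring
  exact h1.comp_ofReal

-- A general real-linear `l` covers the real and the imaginary part at once: vanishing at the end
-- points and the divided difference formula pass through any such `l`, and smoothness holds because
-- `v` is off the segment.
omit H in
theorem isField_loopField {v : ℂ} (hv : v ∉ segment a b) (l : ℂ →L[ℝ] ℝ) :
    IsField a b (fun x => l (loopField a b v x)) (fun x y => l (loopDiv a b v x y)) where
  left := by simp [loopField]
  right := by simp [loopField]
  sub_eq x hx y hy := by
    have h1 := sub_ne_zero_of_notMem_segment hv hx
    have h2 := sub_ne_zero_of_notMem_segment hv hy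
    have : loopField a b v x - loopField a b v y = (x - y : ℝ) • loopDiv a b v x y := by
      rw [Complex.real_smul, loopField, loopField, loopDiv]
      push_cast
      field_simp
      ring
    rw [← map_sub, this, map_smul, smul_eq_mul, mul_comm]
  contDiffAt_div x hx y hy := by
    refine l.contDiff.contDiffAt.comp (x, y) (ContDiffAt.sub ?_ contDiffAt_const)
    have h1 := ContDiffAt.comp (g := fun x : ℝ => (v - x)⁻¹) (f := Prod.fst) (x, y)
      (contDiffAt_inv_sub (sub_ne_zero_of_notMem_segment hv hx)) contDiffAt_fst
    have h2 := ContDiffAt.comp (g := fun x : ℝ => (v - x)⁻¹) (f := Prod.snd) (x, y)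
      (contDiffAt_inv_sub (sub_ne_zero_of_notMem_segment hv hy)) contDiffAt_snd
    refine ((contDiffAt_const (c := (v - a) * (v - b))).mul (h1.mul h2)).congr_of_eventuallyEq
      (Eventually.of_forall fun q => ?_)
    simp only [div_eq_mul_inv, mul_inv, Function.comp]
  hasDerivAt x hx :=
    l.hasFDerivAt.comp_hasDerivAt x (hasDerivAt_loopField (sub_ne_zero_of_notMem_segment hv hx))
  contDiffAt x hx :=
    l.contDiff.contDiffAt.comp x (contDiffAt_loopField (sub_ne_zero_of_notMem_segment hv hx))

-- The weight contains the real part of the potential, whereas the loop equations contain `V'`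
-- itself; they match because `V'` is real where the points lie. An interior point is required so
-- that the imaginary part vanishes on a two-sided neighbourhood.
omit H in
theorem deriv_im_eq_zero {V : ℂ → ℂ} {x : ℝ} (hx : x ∈ Ioo a b) (hV : DifferentiableAt ℂ V x)
    (him : ∀ x ∈ Icc a b, (V (x : ℂ)).im = 0) : (deriv V (x : ℂ)).im = 0 := by
  have h1 : HasDerivAt (fun x : ℝ => V x) (deriv V (x : ℂ)) x := hV.hasDerivAt.comp_ofReal
  have h2 : HasDerivAt (fun x : ℝ => (V x).im) (deriv V (x : ℂ)).im x :=
    Complex.imCLM.hasFDerivAt.comp_hasDerivAt x h1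
  have h3 : (fun x : ℝ => (V x).im) =ᶠ[𝓝 x] fun _ => 0 := by
    filter_upwards [Icc_mem_nhds hx.1 hx.2] with y hy using him y hy
  exact h2.unique ((hasDerivAt_const x (0 : ℝ)).congr_of_eventuallyEq h3)

omit H in
theorem sum_sum_Ioi_symm {n : ℕ} (f : Fin n → Fin n → ℂ) (hf : ∀ i j, f i j = f j i) :
    ∑ i, ∑ j ∈ Finset.Ioi i, f j i = (∑ i, ∑ j, f i j - ∑ i, f i i) / 2 := by
  have h1 : ∀ i : Fin n, ∑ j, f i j = ∑ j ∈ Finset.Ioi i, f i j + ∑ j ∈ Finset.Iio i, f i j + f i i := by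
    intro i
    have hu : (Finset.univ : Finset (Fin n)) = insert i (Finset.Ioi i ∪ Finset.Iio i) := by
      ext j
      have := lt_trichotomy i j
      simp only [Finset.mem_univ, Finset.mem_insert, Finset.mem_union, Finset.mem_Ioi,
        Finset.mem_Iio, true_iff]
      tauto
    have hd : Disjoint (Finset.Ioi i) (Finset.Iio i) := Finset.disjoint_left.2 fun j h1 h2 =>
      lt_asymm (Finset.mem_Ioi.1 h1) (Finset.mem_Iio.1 h2)
    rw [hu, Finset.sum_insert (by simp), Finset.sum_union hd, add_comm]
  have h2 : ∑ i, ∑ j ∈ Finset.Iio i, f i j = ∑ i, ∑ j ∈ Finset.Ioi i, f i j := by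
    rw [Finset.sum_comm' (s' := fun j => Finset.Ioi j) (t' := Finset.univ) (by simp)]
    exact Finset.sum_congr rfl fun i _ => Finset.sum_congr rfl fun j _ => hf j i
  simp only [h1, Finset.sum_add_distrib, h2]
  simp only [fun i j => hf j i]
  ring

omit H in
/-- The logarithmic derivative of the weight in the direction of `loopField`, in terms of Stieltjes
transforms. -/
def loopLog (N : ℕ) (θ a b : ℝ) (Vt Vb : ℂ → ℂ) (v : ℂ)
    (p : (Fin N → ℝ) × (Fin (N - 1) → ℝ)) : ℂ :=
  (v - a) * (v - b) * (((∑ i, (v - p.1 i)⁻¹) ^ 2 + ∑ i, ((v - p.1 i) ^ 2)⁻¹) / 2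
      + ((∑ i, (v - p.2 i)⁻¹) ^ 2 + ∑ i, ((v - p.2 i) ^ 2)⁻¹) / 2
      - (1 - θ) * ((∑ i, (v - p.1 i)⁻¹) * ∑ i, (v - p.2 i)⁻¹))
    - (N ^ 2 - (1 - θ) * N * (N - 1))
    - N * θ * (∑ i, loopField a b v (p.1 i) * deriv Vt (p.1 i)
      + ∑ i, loopField a b v (p.2 i) * deriv Vb (p.2 i))

-- The Vandermonde factor contributes each pair once and the Jacobian the whole diagonal. Together
-- they make half of the full double sum, a square of a Stieltjes transform, plus half of the
-- diagonal.
omit H in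
theorem sum_loopDiv_eq {n : ℕ} (v : ℂ) (x : Fin n → ℝ) :
    ∑ i, ∑ j ∈ Finset.Ioi i, loopDiv a b v (x j) (x i) + ∑ i, loopDiv a b v (x i) (x i)
      = (v - a) * (v - b) * (((∑ i, (v - x i)⁻¹) ^ 2 + ∑ i, ((v - x i) ^ 2)⁻¹) / 2)
        - ((n : ℂ) ^ 2 + n) / 2 := by
  have hdiv : ∀ x y : ℝ, loopDiv a b v x y = (v - a) * (v - b) * ((v - x)⁻¹ * (v - y)⁻¹) - 1 := by
    intro x y
    rw [loopDiv, div_eq_mul_inv, mul_inv]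
  rw [sum_sum_Ioi_symm (fun i j => loopDiv a b v (x i) (x j))
    fun i j => by rw [loopDiv, loopDiv, mul_comm (v - (x i : ℂ))]]
  simp only [hdiv, Finset.sum_sub_distrib, ← Finset.mul_sum, ← Finset.sum_mul]
  simp only [Finset.sum_const, Finset.card_univ, Fintype.card_fin, nsmul_eq_mul, pow_two, mul_inv]
  ring

theorem loopLog_eq (hN : 1 ≤ N) {p : (Fin N → ℝ) × (Fin (N - 1) → ℝ)}
    (hp : p ∈ interlacingSet N a b) (v : ℂ) :
    (deformLog N θ Vt Vb (fun x => Complex.reCLM (loopField a b v x))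
        (fun x y => Complex.reCLM (loopDiv a b v x y)) p : ℂ)
      + Complex.I * deformLog N θ Vt Vb (fun x => Complex.imCLM (loopField a b v x))
        (fun x y => Complex.imCLM (loopDiv a b v x y)) p
      = loopLog N θ a b Vt Vb v p := by
  obtain ⟨hp1, hp2⟩ := mem_Ioo_of_mem_interlacingSet hp
  have hre : ∀ {V : ℂ → ℂ} {x : ℝ}, x ∈ Ioo a b → (∀ x ∈ Icc a b, AnalyticAt ℂ V (x : ℂ)) →
      (∀ x ∈ Icc a b, (V (x : ℂ)).im = 0) → (((deriv V (x : ℂ)).re : ℝ) : ℂ) = deriv V (x : ℂ) := by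
    intro V x hx hV him
    have := deriv_im_eq_zero hx (hV x (Ioo_subset_Icc_self hx)).differentiableAt him
    conv_rhs => rw [← Complex.re_add_im (deriv V (x : ℂ)), this]
    simp
  have hcomb : ∀ z : ℂ, ((z.re : ℝ) : ℂ) + Complex.I * ((z.im : ℝ) : ℂ) = z := fun z => by
    rw [mul_comm]
    exact Complex.re_add_im z
  have hcross : ∑ i : Fin (N - 1), ∑ j : Fin N, loopDiv a b v (p.2 i) (p.1 j)
      = (v - a) * (v - b) * ((∑ i, (v - p.1 i)⁻¹) * ∑ i, (v - p.2 i)⁻¹) - N * (N - 1) := by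
    have hdiv : ∀ x y : ℝ, loopDiv a b v x y
        = (v - a) * (v - b) * ((v - x)⁻¹ * (v - y)⁻¹) - 1 := by
      intro x y
      rw [loopDiv, div_eq_mul_inv, mul_inv]
    simp only [hdiv, Finset.sum_sub_distrib, ← Finset.mul_sum, ← Finset.sum_mul]
    simp only [Finset.sum_const, Finset.card_univ, Fintype.card_fin, nsmul_eq_mul]
    push_cast [Nat.cast_sub hN]
    ring
  -- `deformLog` is linear in the field and its divided differences, and the derivatives of the
  -- potentials are real, so the real and imaginary contributions recombine into complex sums.
  have hsplit : (deformLog N θ Vt Vb (fun x => Complex.reCLM (loopField a b v x))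
        (fun x y => Complex.reCLM (loopDiv a b v x y)) p : ℂ)
      + Complex.I * deformLog N θ Vt Vb (fun x => Complex.imCLM (loopField a b v x))
        (fun x y => Complex.imCLM (loopDiv a b v x y)) p
      = (∑ i, ∑ j ∈ Finset.Ioi i, loopDiv a b v (p.1 j) (p.1 i)
          + ∑ i, loopDiv a b v (p.1 i) (p.1 i))
        + (∑ i, ∑ j ∈ Finset.Ioi i, loopDiv a b v (p.2 j) (p.2 i)
          + ∑ i, loopDiv a b v (p.2 i) (p.2 i))
        + (θ - 1) * ∑ i, ∑ j, loopDiv a b v (p.2 i) (p.1 j)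
        - N * θ * (∑ i, loopField a b v (p.1 i) * deriv Vt (p.1 i)
          + ∑ i, loopField a b v (p.2 i) * deriv Vb (p.2 i)) := by
    obtain ⟨dr, di, hdr, hdi, hd⟩ : ∃ dr di : ℝ → ℝ → ℝ, (∀ x y, (loopDiv a b v x y).re = dr x y) ∧
        (∀ x y, (loopDiv a b v x y).im = di x y) ∧
        ∀ x y, loopDiv a b v x y = dr x y + Complex.I * di x y :=
      ⟨_, _, fun _ _ => rfl, fun _ _ => rfl, fun _ _ => (hcomb _).symm⟩
    obtain ⟨fr, fi, hfr, hfi, hf⟩ : ∃ fr fi : ℝ → ℝ, (∀ x, (loopField a b v x).re = fr x) ∧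
        (∀ x, (loopField a b v x).im = fi x) ∧
        ∀ x, loopField a b v x = fr x + Complex.I * fi x :=
      ⟨_, _, fun _ => rfl, fun _ => rfl, fun _ => (hcomb _).symm⟩
    have hpot : ∀ (V : ℂ → ℂ) (x : ℝ), (((deriv V (x : ℂ)).re : ℝ) : ℂ) = deriv V (x : ℂ) →
        loopField a b v x * deriv V x = ((deriv V (x : ℂ)).re : ℂ) * fr x
          + Complex.I * (((deriv V (x : ℂ)).re : ℂ) * fi x) := by
      intro V x hx
      rw [hf, hx]
      ring
    simp only [deformLog, Complex.reCLM_apply, Complex.imCLM_apply, hdr, hdi, hfr, hfi]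
    simp only [fun i => hpot Vt (p.1 i) (hre (hp1 i) H.top H.top_im),
      fun i => hpot Vb (p.2 i) (hre (hp2 i) H.bot H.bot_im), hd]
    simp only [Finset.sum_add_distrib, Finset.sum_neg_distrib, ← Finset.mul_sum]
    push_cast
    ring
  rw [hsplit, sum_loopDiv_eq, sum_loopDiv_eq, hcross, loopLog]
  push_cast [Nat.cast_sub hN]
  ring

/-- The Ward identity for the complex vector field `loopField`. -/
theorem ward_loopField (hN : 1 ≤ N) {v : ℂ} (hv : v ∉ segment a b) (F : smoothFunctions N a b)
    {F' : smoothFunctions N a b}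
    (hF' : ∀ p (hp : p ∈ cube N a b), derivAt (loopField a b v) hp F = F'.1 p) :
    ∫ p, (loopLog N θ a b Vt Vb v p * F.1 p + F'.1 p) ∂(law N θ a b Vt Vb) = 0 := by
  obtain ⟨i1, e1⟩ := ward_real H.lt H.one_le H.top H.bot
    (isField_loopField hv Complex.reCLM) (F := F.1) fun p hp => contDiffAt_coe F hp
  obtain ⟨i2, e2⟩ := ward_real H.lt H.one_le H.top H.bot
    (isField_loopField hv Complex.imCLM) (F := F.1) fun p hp => contDiffAt_coe F hp
  -- The complex identity is the one for the real part of the field plus `I` times the one for the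
  -- imaginary part.
  have := integral_add i1 (i2.const_mul Complex.I)
  rw [e1, integral_const_mul, e2, mul_zero, add_zero] at this
  rw [integral_law H.lt H.one_le (fun x hx => (H.top x hx).continuousAt)
    fun x hx => (H.bot x hx).continuousAt, smul_eq_zero]
  right
  rw [← this]
  refine setIntegral_congr_fun isOpen_interlacingSet.measurableSet fun p hp => ?_
  rw [← hF' p (interlacingSet_subset_cube hp), ← loopLog_eq H hN hp v]
  simp only [derivAt, LinearMap.coe_mk, AddHom.coe_mk, Complex.real_smul, Complex.reCLM_apply,
    Complex.imCLM_apply]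
  ring

end Observables

/-! ### The loop equations for expectations. -/

section LoopEquation

open Set Filter Topology

variable {N : ℕ} {θ a b : ℝ} {Vt Vb : ℂ → ℂ} {k : ℕ}
  {X : (Fin N → ℝ) × (Fin (N - 1) → ℝ) →L[ℝ] (Fin k → ℝ)} (hX : IsLevel a b X)

/-! ### Stieltjes transforms as observables -/

/-- The Stieltjes transform of a level, as an observable. -/
def stieltjesStat (hX : IsLevel a b X) (z : ℂ) : smoothFunctions N a b :=
  open Classical in
  if hz : z ∉ segment a b then
    linearStatistic hX (fun x => (z - x)⁻¹) fun _ hx =>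
      contDiffAt_inv_sub (sub_ne_zero_of_notMem_segment hz hx)
  else 0

theorem stieltjesStat_eq {z : ℂ} (hz : z ∉ segment a b) :
    stieltjesStat hX z = linearStatistic hX (fun x => (z - x)⁻¹) fun _ hx =>
      contDiffAt_inv_sub (sub_ne_zero_of_notMem_segment hz hx) := dif_pos hz

theorem stieltjesStat_apply {z : ℂ} (hz : z ∉ segment a b)
    (p : (Fin N → ℝ) × (Fin (N - 1) → ℝ)) :
    (stieltjesStat hX z).1 p = ∑ i, (z - X p i)⁻¹ := by
  rw [stieltjesStat_eq hX hz]
  rfl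

/-- The linear statistic `∑ i, 1 / (z - X i)²`. -/
def stieltjesSqStat (hX : IsLevel a b X) {z : ℂ} (hz : z ∉ segment a b) : smoothFunctions N a b :=
  linearStatistic hX (fun x => ((z - x) ^ 2)⁻¹) fun x hx => by
    simpa only [inv_pow] using
      (contDiffAt_inv_sub (sub_ne_zero_of_notMem_segment hz hx)).pow 2

theorem isClosed_segment : IsClosed (segment a b) :=
  (isCompact_Icc.image Complex.continuous_ofReal).isClosed

theorem exists_ball_dist_segment {v : ℂ} (hv : v ∉ segment a b) :
    ∃ r > 0, ∀ w ∈ Metric.ball v r, w ∉ segment a b ∧ ∀ x ∈ Icc a b, r ≤ ‖w - (x : ℂ)‖ := by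
  obtain ⟨r, hr, hsub⟩ := Metric.isOpen_iff.1 isClosed_segment.isOpen_compl v hv
  refine ⟨r / 2, by positivity, fun w hw => ⟨fun h => ?_, fun x hx => ?_⟩⟩
  · exact hsub (Metric.ball_subset_ball (by linarith) hw) h
  · by_contra! h
    have hx' : (x : ℂ) ∈ segment a b := ⟨x, hx, rfl⟩
    refine hsub ?_ hx'
    rw [Metric.mem_ball] at hw ⊢
    rw [← dist_eq_norm] at h
    linarith [dist_triangle (x : ℂ) w v, dist_comm (x : ℂ) w]

variable (H : Admissible θ a b Vt Vb)

theorem hasDerivAt_expectation_stieltjesStat {v : ℂ} (hv : v ∉ segment a b)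
    (Q : smoothFunctions N a b) :
    HasDerivAt (fun z => expectation H (stieltjesStat hX z * Q))
      (-expectation H (stieltjesSqStat hX hv * Q)) v := by
  obtain ⟨r, hr, hball⟩ := exists_ball_dist_segment hv
  have hmem : ∀ᵐ p ∂(law N θ a b Vt Vb), p ∈ cube N a b :=
    ae_law_mem.mono fun p hp => interlacingSet_subset_cube hp
  have hne : ∀ w ∈ Metric.ball v r, ∀ p ∈ cube N a b, ∀ i, w - (X p i : ℂ) ≠ 0 :=
    fun w hw p hp i => sub_ne_zero_of_notMem_segment (hball w hw).1 (hX.mem p hp i)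
  have hd : ∀ w ∈ Metric.ball v r, ∀ p ∈ cube N a b,
      HasDerivAt (fun z => (∑ i, (z - (X p i : ℂ))⁻¹) * Q.1 p)
        (-(∑ i, ((w - (X p i : ℂ)) ^ 2)⁻¹) * Q.1 p) w := by
    intro w hw p hp
    refine HasDerivAt.mul_const ?_ _
    rw [← Finset.sum_neg_distrib]
    refine HasDerivAt.fun_sum fun i _ => ?_
    have : HasDerivAt (fun z : ℂ => (z - (X p i : ℂ))⁻¹) (-1 / (w - X p i) ^ 2) w :=
      ((hasDerivAt_id w).sub_const (X p i : ℂ)).inv (hne w hw p hp i)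
    simpa [neg_div] using this
  obtain ⟨C, hC⟩ := isCompact_cube.exists_bound_of_continuousOn (continuousOn_coe Q)
  have key := hasDerivAt_integral_of_holomorphic (μ := law N θ a b Vt Vb) (z₀ := v)
    (F := fun z p => (∑ i, (z - (X p i : ℂ))⁻¹) * Q.1 p) (B := fun _ => (∑ _i : Fin k, r⁻¹) * C)
    hr ?_ ?_ ?_ ?_
  · have hval : ∫ p, deriv (fun z => (∑ i, (z - (X p i : ℂ))⁻¹) * Q.1 p) v ∂(law N θ a b Vt Vb)
        = -expectation H (stieltjesSqStat hX hv * Q) := by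
      rw [expectation_apply, ← integral_neg]
      refine integral_congr_ae (hmem.mono fun p hp => ?_)
      dsimp only
      rw [(hd v (Metric.mem_ball_self hr) p hp).deriv, neg_mul]
      rfl
    rw [hval] at key
    refine key.congr_of_eventuallyEq ?_
    filter_upwards [Metric.ball_mem_nhds v hr] with w hw
    rw [stieltjesStat_eq hX (hball w hw).1]
    rfl
  · intro w hw
    have := (H.integrable (continuousOn_coe (stieltjesStat hX w * Q))).1
    rw [stieltjesStat_eq hX (hball w hw).1] at this
    exact this
  · filter_upwards [hmem] with p hp w hw
    exact (hd w hw p hp).differentiableAt.differentiableWithinAt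
  · filter_upwards [hmem] with p hp w hw
    rw [norm_mul]
    refine mul_le_mul ((norm_sum_le _ _).trans (Finset.sum_le_sum fun i _ => ?_)) (hC p hp)
      (norm_nonneg _) (Finset.sum_nonneg fun _ _ => by positivity)
    rw [norm_inv]
    exact inv_anti₀ hr ((hball w hw).2 _ (hX.mem p hp i))
  · have := H.isProbabilityMeasure (N := N)
    exact integrable_const _

/-! ### The contour integrals -/

theorem contourIntegral_finset_sum {γ : ℝ → ℂ} (hγ : IsPiecewiseC1 γ) {κ : Type*} (s : Finset κ)
    {f : κ → ℂ → ℂ} (hf : ∀ i ∈ s, ContinuousOn (f i) (trace γ)) :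
    contourIntegral γ (fun z => ∑ i ∈ s, f i z) = ∑ i ∈ s, contourIntegral γ (f i) := by
  simp only [contourIntegral, Finset.sum_mul]
  exact intervalIntegral.integral_finsetSum fun i hi => hγ.intervalIntegrable (hf i hi)

/-- Partial fractions split `1 / ((v - z)(z - x))` into `(v - x)⁻¹` times `1 / (z - x) - 1 / (z -
v)`. The curve winds once about `x` and not about `v`, so only the first pole contributes. -/
theorem contourIntegral_loop {γ : ℝ → ℂ} {M K S : Set ℂ} (hγ : IsContour γ M K S) (hM : IsOpen M)
    {g : ℂ → ℂ} (hg : DifferentiableOn ℂ g M) {v x : ℂ} (hv : v ∈ S) (hx : x ∈ K) (hvx : v - x ≠ 0) :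
    contourIntegral γ (fun z => g z * (v - z)⁻¹ * (z - x)⁻¹)
      = 2 * Real.pi * Complex.I * (g x * (v - x)⁻¹) := by
  have hγM : trace γ ⊆ M := by
    rintro _ ⟨s, hs, rfl⟩
    exact hγ.mem s hs
  have hvt : v ∉ trace γ := by
    rintro ⟨s, hs, rfl⟩
    exact hγ.notMem_excluded s hs hv
  have hxt : x ∉ trace γ := by
    rintro ⟨s, hs, rfl⟩
    exact hγ.notMem_enclosed s hs hx
  have hne : ∀ {w}, w ∉ trace γ → ∀ z ∈ trace γ, z - w ≠ 0 := fun hw z hz h =>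
    hw (sub_eq_zero.1 h ▸ hz)
  have hc : ∀ {w}, w ∉ trace γ → ContinuousOn (fun z => g z * (z - w)⁻¹) (trace γ) := fun hw =>
    (hg.continuousOn.mono hγM).mul
      ((continuousOn_id.sub continuousOn_const).inv₀ (hne hw))
  have h1 := contourIntegral_cauchy hγ.piecewiseC1 hγ.closed hM hγM hγ.interior_subset hg hxt
  have h2 := contourIntegral_cauchy hγ.piecewiseC1 hγ.closed hM hγM hγ.interior_subset hg hvt
  rw [hγ.encloses x hx] at h1
  rw [hγ.excludes v hv] at h2
  have h3 : contourIntegral γ (fun z => g z * (v - z)⁻¹ * (z - x)⁻¹)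
      = contourIntegral γ (fun z => (v - x)⁻¹ * (g z * (z - x)⁻¹ - g z * (z - v)⁻¹)) := by
    refine contourIntegral_congr fun z hz => ?_
    have e1 := hne hxt z hz
    have e2 := hne hvt z hz
    have e3 : v - z ≠ 0 := fun h => e2 (by rw [← neg_sub, h, neg_zero])
    have e4 : (z - v)⁻¹ = -(v - z)⁻¹ := by rw [← neg_sub v z, inv_neg]
    rw [e4]
    field_simp
    ring
  rw [h3, contourIntegral_const_mul, contourIntegral_sub hγ.piecewiseC1 (hc hxt) (hc hvt), h1, h2]
  ring

/-- By Fubini, the contour integral is evaluated for each configuration with `contourIntegral_loop`.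
Fubini applies because the integrand is a function continuous on the compact set `[0, 1] × cube`
times the integrable `deriv γ`. -/
theorem contourIntegral_expectation {γ : ℝ → ℂ} {M S : Set ℂ}
    (hγ : IsContour γ M (segment a b) S) (hM : IsOpen M)
    {g : ℂ → ℂ} (hg : DifferentiableOn ℂ g M) {v : ℂ} (hv : v ∈ S) (hvs : v ∉ segment a b)
    (Q : smoothFunctions N a b) (hf : ∀ x ∈ Icc a b, ContDiffAt ℝ 1 (fun x : ℝ => g x * (v - x)⁻¹) x) :
    contourIntegral γ (fun z => g z * (v - z)⁻¹ * expectation H (stieltjesStat hX z * Q))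
      = 2 * Real.pi * Complex.I *
        expectation H (linearStatistic hX (fun x => g x * (v - x)⁻¹) hf * Q) := by
  have hpc := hγ.piecewiseC1
  have hprob := H.isProbabilityMeasure (N := N)
  have hmem : ∀ᵐ p ∂(law N θ a b Vt Vb), p ∈ cube N a b :=
    ae_law_mem.mono fun p hp => interlacingSet_subset_cube hp
  have hγM : trace γ ⊆ M := by
    rintro _ ⟨s, hs, rfl⟩
    exact hγ.mem s hs
  have hseg : ∀ z ∈ trace γ, z ∉ segment a b := by
    rintro _ ⟨s, hs, rfl⟩
    exact hγ.notMem_enclosed s hs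
  have hvt : v ∉ trace γ := by
    rintro ⟨s, hs, rfl⟩
    exact hγ.notMem_excluded s hs hv
  have hgv : ContinuousOn (fun z => g z * (v - z)⁻¹) (trace γ) :=
    (hg.continuousOn.mono hγM).mul ((continuousOn_const.sub continuousOn_id).inv₀
      fun z hz h => hvt (by
        have h' : v = z := sub_eq_zero.1 h
        rwa [h']))
  have hsum : ∀ p ∈ cube N a b, ∀ i, ContinuousOn (fun z => (z - (X p i : ℂ))⁻¹) (trace γ) :=
    fun p hp i => (continuousOn_id.sub continuousOn_const).inv₀
      fun z hz => sub_ne_zero_of_notMem_segment (hseg z hz) (hX.mem p hp i)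
  set μ : Measure ℝ := volume.restrict (Ioc (0 : ℝ) 1) with hμ
  have hμmem : ∀ᵐ s ∂μ, s ∈ Icc (0 : ℝ) 1 :=
    (ae_restrict_mem measurableSet_Ioc).mono fun s hs => Ioc_subset_Icc_self hs
  set Φ : ℝ × ((Fin N → ℝ) × (Fin (N - 1) → ℝ)) → ℂ := fun q =>
    g (γ q.1) * (v - γ q.1)⁻¹ * ((∑ i, (γ q.1 - (X q.2 i : ℂ))⁻¹) * Q.1 q.2) with hΦ
  have hcompact : IsCompact (Icc (0 : ℝ) 1 ×ˢ cube N a b) := isCompact_Icc.prod isCompact_cube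
  have hγfst : ContinuousOn (fun q : ℝ × ((Fin N → ℝ) × (Fin (N - 1) → ℝ)) => γ q.1)
      (Icc (0 : ℝ) 1 ×ˢ cube N a b) :=
    hpc.continuousOn.comp continuousOn_fst fun q hq => hq.1
  have hΦc : ContinuousOn Φ (Icc (0 : ℝ) 1 ×ˢ cube N a b) := by
    refine ContinuousOn.mul (hgv.comp hγfst fun q hq => mem_image_of_mem γ hq.1) ?_
    refine ContinuousOn.mul (continuousOn_finsetSum _ fun i _ => ContinuousOn.inv₀ ?_ ?_)
      ((continuousOn_coe Q).comp continuousOn_snd fun q hq => hq.2)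
    · exact hγfst.sub (by fun_prop)
    · exact fun q hq => sub_ne_zero_of_notMem_segment (hseg _ (mem_image_of_mem γ hq.1))
        (hX.mem _ hq.2 i)
  have hae : ∀ᵐ q ∂(μ.prod (law N θ a b Vt Vb)), q ∈ Icc (0 : ℝ) 1 ×ˢ cube N a b := by
    filter_upwards [Measure.quasiMeasurePreserving_fst.ae hμmem,
      Measure.quasiMeasurePreserving_snd.ae hmem] with q h1 h2 using ⟨h1, h2⟩
  obtain ⟨C, hC⟩ := hcompact.exists_bound_of_continuousOn hΦc
  have hint : Integrable (fun q => Φ q * deriv γ q.1) (μ.prod (law N θ a b Vt Vb)) := by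
    have h1 : Integrable (fun q : ℝ × ((Fin N → ℝ) × (Fin (N - 1) → ℝ)) => deriv γ q.1)
        (μ.prod (law N θ a b Vt Vb)) :=
      ((intervalIntegrable_iff_integrableOn_Ioc_of_le zero_le_one).1
        hpc.intervalIntegrable_deriv).integrable.comp_fst _
    refine h1.bdd_mul ?_ (hae.mono fun q hq => hC q hq)
    rw [← Measure.restrict_eq_self_of_ae_mem hae]
    exact hΦc.aestronglyMeasurable hcompact.measurableSet
  have hswap := integral_integral_swap (f := fun s p => Φ (s, p) * deriv γ s) hint
  have hleft : contourIntegral γ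
      (fun z => g z * (v - z)⁻¹ * expectation H (stieltjesStat hX z * Q))
      = ∫ s, ∫ p, Φ (s, p) * deriv γ s ∂(law N θ a b Vt Vb) ∂μ := by
    rw [contourIntegral, intervalIntegral.integral_of_le zero_le_one]
    refine integral_congr_ae (hμmem.mono fun s hs => ?_)
    dsimp only
    rw [integral_mul_const, expectation_apply, ← integral_const_mul,
      stieltjesStat_eq hX (hseg _ (mem_image_of_mem γ hs))]
    rfl
  have hright : ∫ p, ∫ s, Φ (s, p) * deriv γ s ∂μ ∂(law N θ a b Vt Vb)
      = 2 * Real.pi * Complex.I *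
        expectation H (linearStatistic hX (fun x => g x * (v - x)⁻¹) hf * Q) := by
    rw [expectation_apply, ← integral_const_mul]
    refine integral_congr_ae (hmem.mono fun p hp => ?_)
    dsimp only
    have e1 : ∫ s, Φ (s, p) * deriv γ s ∂μ
        = contourIntegral γ fun z => Q.1 p *
          ∑ i, g z * (v - z)⁻¹ * (z - (X p i : ℂ))⁻¹ := by
      rw [contourIntegral, intervalIntegral.integral_of_le zero_le_one]
      refine integral_congr_ae (Eventually.of_forall fun s => ?_)
      simp only [hΦ, ← Finset.mul_sum]
      ring
    rw [e1, contourIntegral_const_mul, contourIntegral_finset_sum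
      (f := fun i z => g z * (v - z)⁻¹ * (z - (X p i : ℂ))⁻¹) hpc _
      fun i _ => hgv.mul (hsum p hp i)]
    have e2 : ∀ i, contourIntegral γ (fun z => g z * (v - z)⁻¹ * (z - (X p i : ℂ))⁻¹)
        = 2 * Real.pi * Complex.I * (g (X p i) * (v - X p i)⁻¹) := fun i =>
      contourIntegral_loop hγ hM hg hv ⟨_, hX.mem p hp i, rfl⟩
        (sub_ne_zero_of_notMem_segment hvs (hX.mem p hp i))
    simp only [e2, ← Finset.mul_sum]
    change _ = 2 * Real.pi * Complex.I * ((∑ i, g (X p i) * (v - X p i)⁻¹) * Q.1 p)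
    ring
  rw [hleft, hswap, hright]

/-! ### The loop equations for expectations -/

theorem contDiffAt_potential {V : ℂ → ℂ} (hV : ∀ x ∈ Icc a b, AnalyticAt ℂ V (x : ℂ)) {v : ℂ}
    (hv : v ∉ segment a b) :
    ∀ x ∈ Icc a b, ContDiffAt ℝ 1 (fun x : ℝ => (x - a) * (x - b) * deriv V x * (v - x)⁻¹) x := by
  intro x hx
  have h1 : ContDiffAt ℝ 1 (fun x : ℝ => (x : ℂ)) x := Complex.ofRealCLM.contDiff.contDiffAt
  have h2 : ContDiffAt ℝ 1 (fun x : ℝ => deriv V (x : ℂ)) x :=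
    ContDiffAt.comp (g := deriv V) x ((hV x hx).deriv.contDiffAt.restrict_scalars ℝ) h1
  exact (((h1.sub contDiffAt_const).mul (h1.sub contDiffAt_const)).mul h2).mul
    (contDiffAt_inv_sub (sub_ne_zero_of_notMem_segment hv hx))

/-- The linear statistic of the potential, weighted by `loopField`. -/
def potentialStat (hX : IsLevel a b X) {V : ℂ → ℂ} (hV : ∀ x ∈ Icc a b, AnalyticAt ℂ V (x : ℂ))
    {v : ℂ} (hv : v ∉ segment a b) : smoothFunctions N a b :=
  linearStatistic hX (fun x => (x - a) * (x - b) * deriv V x * (v - x)⁻¹)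
    (contDiffAt_potential hV hv)

/-- The linear statistic `∑ i, h(X i) / (w - X i)²`, where `h` is `loopField`. -/
def variationStat (hX : IsLevel a b X) {v : ℂ} (hv : v ∉ segment a b) {w : ℂ} (hw : w ∉ segment a b) :
    smoothFunctions N a b :=
  linearStatistic hX (fun x => loopField a b v x * ((w - x) ^ 2)⁻¹) fun x hx => by
    refine (contDiffAt_loopField (sub_ne_zero_of_notMem_segment hv hx)).mul ?_
    simpa only [inv_pow] using
      (contDiffAt_inv_sub (sub_ne_zero_of_notMem_segment hw hx)).pow 2

theorem derivAt_stieltjesStat {v : ℂ} (hv : v ∉ segment a b) {w : ℂ} (hw : w ∉ segment a b)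
    {p : (Fin N → ℝ) × (Fin (N - 1) → ℝ)} (hp : p ∈ cube N a b) :
    derivAt (loopField a b v) hp (stieltjesStat hX w) = (variationStat hX hv hw).1 p := by
  rw [stieltjesStat_eq hX hw]
  refine (derivAt_linearStatistic hX (loopField a b v) (f' := fun x : ℝ => ((w - x) ^ 2)⁻¹) _
    (fun x hx => ?_) hp).trans rfl
  have h1 : HasDerivAt (fun z : ℂ => (w - z)⁻¹) (((w - x) ^ 2)⁻¹) x := by
    have : HasDerivAt (fun z : ℂ => (w - z)⁻¹) (-(-1) / (w - x) ^ 2) (x : ℂ) :=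
      ((hasDerivAt_id (x : ℂ)).const_sub w).inv (sub_ne_zero_of_notMem_segment hw hx)
    simpa using this
  exact h1.comp_ofReal

/-- This is the Ward identity tested against the dual element `Q T`: the logarithmic derivative
multiplies `Q T`, and the variation of `Q T` is distributed over its variables by
`derivation_cumulantDual`. -/
theorem loop_equation_expectation (hN : 1 ≤ N) {v : ℂ} (hv : v ∉ segment a b) {ι : Type*}
    [DecidableEq ι] (ξ ξ' : ι → smoothFunctions N a b)
    (hξ : ∀ i p (hp : p ∈ cube N a b), derivAt (loopField a b v) hp (ξ i) = (ξ' i).1 p)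
    (T : Finset ι) :
    let Q := cumulantDual (expectation H) ξ
    let Gt := stieltjesStat (N := N) (isLevel_fst (a := a) (b := b)) v
    let Gb := stieltjesStat (N := N) (isLevel_snd (a := a) (b := b)) v
    (v - a) * (v - b) *
        ((expectation H (Gt * Gt * Q T) + expectation H (stieltjesSqStat isLevel_fst hv * Q T)) / 2
        + (expectation H (Gb * Gb * Q T) + expectation H (stieltjesSqStat isLevel_snd hv * Q T)) / 2
        - (1 - θ) * expectation H (Gt * Gb * Q T))
      - (N ^ 2 - (1 - θ) * N * (N - 1)) * expectation H (Q T)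
      - N * θ * (expectation H (potentialStat isLevel_fst H.top hv * Q T)
        + expectation H (potentialStat isLevel_snd H.bot hv * Q T))
      + ∑ i ∈ T, expectation H (ξ' i * Q (T.erase i)) = 0 := by
  intro Q Gt Gb
  set L : smoothFunctions N a b :=
    ((v - a) * (v - b)) • ((1 / 2 : ℂ) • (Gt * Gt + stieltjesSqStat isLevel_fst hv)
      + (1 / 2 : ℂ) • (Gb * Gb + stieltjesSqStat isLevel_snd hv) - (1 - θ : ℂ) • (Gt * Gb))
    - ((N : ℂ) ^ 2 - (1 - θ) * N * (N - 1)) • (1 : smoothFunctions N a b)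
    - ((N : ℂ) * θ) • (potentialStat isLevel_fst H.top hv + potentialStat isLevel_snd H.bot hv)
    with hL
  have hward := ward_loopField H hN hv (Q T) (F' := ∑ i ∈ T, ξ' i * Q (T.erase i)) ?_
  · have hzero : expectation H (L * Q T + ∑ i ∈ T, ξ' i * Q (T.erase i)) = 0 := by
      rw [expectation_apply, ← hward]
      refine integral_congr_ae (Eventually.of_forall fun p => ?_)
      have hGt : Gt.1 p = ∑ i, (v - p.1 i)⁻¹ := stieltjesStat_apply isLevel_fst hv p
      have hGb : Gb.1 p = ∑ i, (v - p.2 i)⁻¹ := stieltjesStat_apply isLevel_snd hv p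
      have hpot : ∀ {n : ℕ} (V : ℂ → ℂ) (x : Fin n → ℝ),
          ∑ i, ((x i : ℂ) - a) * (x i - b) * deriv V (x i) * (v - x i)⁻¹
            = ∑ i, loopField a b v (x i) * deriv V (x i) := fun V x =>
        Finset.sum_congr rfl fun i _ => by
          rw [loopField]
          ring
      have hLp : L.1 p = loopLog N θ a b Vt Vb v p := by
        change (v - a) * (v - b) * (1 / 2 * (Gt.1 p * Gt.1 p + ∑ i, ((v - p.1 i) ^ 2)⁻¹)
          + 1 / 2 * (Gb.1 p * Gb.1 p + ∑ i, ((v - p.2 i) ^ 2)⁻¹) - (1 - θ) * (Gt.1 p * Gb.1 p))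
          - ((N : ℂ) ^ 2 - (1 - θ) * N * (N - 1)) * 1
          - N * θ * (∑ i, ((p.1 i : ℂ) - a) * (p.1 i - b) * deriv Vt (p.1 i) * (v - p.1 i)⁻¹
            + ∑ i, ((p.2 i : ℂ) - a) * (p.2 i - b) * deriv Vb (p.2 i) * (v - p.2 i)⁻¹) = _
        rw [hpot, hpot, hGt, hGb, loopLog]
        ring
      change L.1 p * (Q T).1 p + (∑ i ∈ T, ξ' i * Q (T.erase i)).1 p = _
      rw [hLp]
    rw [map_add, map_sum] at hzero
    rw [← hzero, hL]
    simp only [sub_mul, add_mul, smul_mul_assoc, map_add, map_sub, map_smul, smul_eq_mul, one_mul]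
    ring
  · intro p hp
    rw [derivation_cumulantDual ξ (evalAt p) (derivAt (loopField a b v) hp)
      (derivAt_mul (loopField a b v) hp) T]
    rw [← evalAt_apply, map_sum]
    refine Finset.sum_congr rfl fun i _ => ?_
    rw [hξ i p hp, map_mul, evalAt_apply, evalAt_apply]

end LoopEquation

/-! ### Cumulants as expectations against dual elements. -/

section Kappa

open Set Filter Topology

variable {Ω : Type*} [MeasurableSpace Ω] {P : Measure Ω} {N : ℕ} {θ a b : ℝ} {Vt Vb : ℂ → ℂ}
  {X : Ω → Fin N → ℝ} {Y : Ω → Fin (N - 1) → ℝ}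

/-! ### The cumulants as expectations -/

/-- The Stieltjes transform of the upper level. -/
abbrev topStat (N : ℕ) (a b : ℝ) (z : ℂ) : smoothFunctions N a b := stieltjesStat isLevel_fst z

/-- The Stieltjes transform of the lower level. -/
abbrev botStat (N : ℕ) (a b : ℝ) (z : ℂ) : smoothFunctions N a b := stieltjesStat isLevel_snd z

/-- The Stieltjes transforms at the points `u` and `w`. -/
def statFamily (N : ℕ) (a b : ℝ) {ι ι' : Type*} (u : ι → ℂ) (w : ι' → ℂ) :
    ι ⊕ ι' → smoothFunctions N a b :=
  Sum.elim (fun i => topStat N a b (u i)) fun j => botStat N a b (w j)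

variable (H : Admissible θ a b Vt Vb)
  (hlaw : HasLaw (fun ω => (X ω, Y ω)) (law N θ a b Vt Vb) P)

section Reindex

variable {ι ι' κ κ' κ₁ κ₂ : Type} [Fintype κ₁] [DecidableEq κ₁] [Fintype κ₂] [DecidableEq κ₂]
  {v₁ : ι → ℂ} {v₂ : ι' → ℂ} {u : κ₁ → ℂ} {w : κ₂ → ℂ}

include hlaw in
theorem kappa_eq_setCumulant (hu : ∀ i, u i ∉ segment a b) (hw : ∀ j, w j ∉ segment a b) :
    kappa P X Y u w
      = setCumulant (moment (expectation H) (statFamily N a b u w)) Finset.univ := by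
  unfold kappa jointCumulant setCumulant
  refine Finset.sum_congr rfl fun π _ => ?_
  congr 1
  refine Finset.prod_congr rfl fun B _ => ?_
  rw [moment, expectation_apply, ← hlaw.integral_comp (H.integrable (continuousOn_coe _)).1]
  refine integral_congr_ae (Eventually.of_forall fun ω => ?_)
  simp only [Function.comp_apply]
  rw [← evalAt_apply, map_prod]
  refine Finset.prod_congr rfl fun i _ => ?_
  rw [evalAt_apply]
  rcases i with i | j
  · refine Eq.trans ?_ (stieltjesStat_apply isLevel_fst (hu i) _).symm
    simp [stieltjes]
  · refine Eq.trans ?_ (stieltjesStat_apply isLevel_snd (hw j) _).symm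
    simp [stieltjes]

/-- Splitting off the distinguished index of the left summand. -/
def optionSumLeft (κ κ' : Type*) : Option (κ ⊕ κ') ≃ Option κ ⊕ κ' where
  toFun := fun o => o.elim (Sum.inl none) (Sum.map some id)
  invFun := Sum.elim (fun o => o.map Sum.inl) fun k => some (Sum.inr k)
  left_inv := by rintro (_ | _ | _) <;> rfl
  right_inv := by rintro ((_ | _) | _) <;> rfl

/-- Splitting off the distinguished index of the right summand. -/
def optionSumRight (κ κ' : Type*) : Option (κ ⊕ κ') ≃ κ ⊕ Option κ' where
  toFun := fun o => o.elim (Sum.inr none) (Sum.map id some)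
  invFun := Sum.elim (fun k => some (Sum.inl k)) fun o => o.map Sum.inr
  left_inv := by rintro (_ | _ | _) <;> rfl
  right_inv := by rintro (_ | (_ | _)) <;> rfl

variable [Fintype κ] [DecidableEq κ] [Fintype κ'] [DecidableEq κ'] [DecidableEq ι]
  [DecidableEq ι']

-- The cumulants in the equations are indexed by different types (adjoined points, subfamilies,
-- updated families). Here `e` singles out one point and `f`, `f'` embed the others into a fixed
-- family, so that all of them are written with the dual elements of that single family.
include hlaw in
theorem kappa_eq_top (hu : ∀ i, u i ∉ segment a b) (hw : ∀ j, w j ∉ segment a b)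
    (e : Option κ ≃ κ₁) (e' : κ' ≃ κ₂) (f : κ ↪ ι) (f' : κ' ↪ ι')
    (h : ∀ i, u (e (some i)) = v₁ (f i)) (h' : ∀ j, w (e' j) = v₂ (f' j)) :
    kappa P X Y u w = expectation H (topStat N a b (u (e none)) *
      cumulantDual (expectation H) (statFamily N a b v₁ v₂) (Finset.univ.map (f.sumMap f'))) := by
  rw [kappa_eq_setCumulant H hlaw hu hw, setCumulant_univ_eq (statFamily N a b v₁ v₂)
    (expectation_one H) _ ((optionSumLeft κ κ').trans (e.sumCongr e')) (f.sumMap f')]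
  · rfl
  · rintro (i | j)
    · exact congrArg (topStat N a b) (h i)
    · exact congrArg (botStat N a b) (h' j)

include hlaw in
theorem kappa_eq_bot (hu : ∀ i, u i ∉ segment a b) (hw : ∀ j, w j ∉ segment a b)
    (e : κ ≃ κ₁) (e' : Option κ' ≃ κ₂) (f : κ ↪ ι) (f' : κ' ↪ ι')
    (h : ∀ i, u (e i) = v₁ (f i)) (h' : ∀ j, w (e' (some j)) = v₂ (f' j)) :
    kappa P X Y u w = expectation H (botStat N a b (w (e' none)) *
      cumulantDual (expectation H) (statFamily N a b v₁ v₂) (Finset.univ.map (f.sumMap f'))) := by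
  rw [kappa_eq_setCumulant H hlaw hu hw, setCumulant_univ_eq (statFamily N a b v₁ v₂)
    (expectation_one H) _ ((optionSumRight κ κ').trans (e.sumCongr e')) (f.sumMap f')]
  · rfl
  · rintro (i | j)
    · exact congrArg (topStat N a b) (h i)
    · exact congrArg (botStat N a b) (h' j)

end Reindex

section SecondOrder

variable {ι ι' κ₁ κ₂ : Type} [Fintype κ₁] [DecidableEq κ₁] [Fintype κ₂] [DecidableEq κ₂]
  [Fintype ι] [DecidableEq ι] [Fintype ι'] [DecidableEq ι']
  {v₁ : ι → ℂ} {v₂ : ι' → ℂ} {u : κ₁ → ℂ} {w : κ₂ → ℂ}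

omit [DecidableEq ι] [DecidableEq ι'] in
theorem sum_finset_sum_type {A : Type*} [AddCommMonoid A] (F : Finset (ι ⊕ ι') → A) :
    ∑ U, F U = ∑ S : Finset ι, ∑ S' : Finset ι', F (S.disjSum S') := by
  rw [← Fintype.sum_prod_type']
  exact Fintype.sum_equiv Finset.sumEquiv.toEquiv _ _ fun U => by
    conv_lhs => rw [← Finset.sumEquiv.symm_apply_apply U]
    rfl

theorem compl_disjSum (S : Finset ι) (S' : Finset ι') :
    (S.disjSum S')ᶜ = Sᶜ.disjSum S'ᶜ := by
  ext (i | j) <;> simp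

-- The splittings of a sum type are pairs of splittings of its summands, which yields the double sum
-- of the loop equation. Here both of the extra points belong to the upper level.
include hlaw in
theorem expectation_top_top (hu : ∀ i, u i ∉ segment a b) (hw : ∀ j, w j ∉ segment a b)
    (e : Option (Option ι) ≃ κ₁) (e' : ι' ≃ κ₂) (h : ∀ i, u (e (some (some i))) = v₁ i)
    (h' : ∀ j, w (e' j) = v₂ j) :
    let Q := cumulantDual (expectation H) (statFamily N a b v₁ v₂)
    expectation H (topStat N a b (u (e none)) * topStat N a b (u (e (some none))) * Q Finset.univ)
      = kappa P X Y u w + ∑ S : Finset ι, ∑ S' : Finset ι',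
        expectation H (topStat N a b (u (e none)) * Q (S.disjSum S'))
          * expectation H (topStat N a b (u (e (some none))) * Q (Sᶜ.disjSum S'ᶜ)) := by
  intro Q
  have := map_mul_mul_cumulantDual_univ (statFamily N a b v₁ v₂) (expectation_one H)
    (statFamily N a b u w) (((optionSumLeft ι ι').optionCongr.trans
      (optionSumLeft (Option ι) ι')).trans (e.sumCongr e')) ?_
  · rw [kappa_eq_setCumulant H hlaw hu hw]
    simp only [← compl_disjSum]
    rw [← sum_finset_sum_type fun U => expectation H (topStat N a b (u (e none)) * Q U)
      * expectation H (topStat N a b (u (e (some none))) * Q Uᶜ)]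
    exact this
  · rintro (i | j)
    · exact congrArg (topStat N a b) (h i)
    · exact congrArg (botStat N a b) (h' j)

include hlaw in
theorem expectation_bot_bot (hu : ∀ i, u i ∉ segment a b) (hw : ∀ j, w j ∉ segment a b)
    (e : ι ≃ κ₁) (e' : Option (Option ι') ≃ κ₂) (h : ∀ i, u (e i) = v₁ i)
    (h' : ∀ j, w (e' (some (some j))) = v₂ j) :
    let Q := cumulantDual (expectation H) (statFamily N a b v₁ v₂)
    expectation H (botStat N a b (w (e' none)) * botStat N a b (w (e' (some none))) * Q Finset.univ)
      = kappa P X Y u w + ∑ S : Finset ι, ∑ S' : Finset ι',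
        expectation H (botStat N a b (w (e' none)) * Q (S.disjSum S'))
          * expectation H (botStat N a b (w (e' (some none))) * Q (Sᶜ.disjSum S'ᶜ)) := by
  intro Q
  have := map_mul_mul_cumulantDual_univ (statFamily N a b v₁ v₂) (expectation_one H)
    (statFamily N a b u w) (((optionSumRight ι ι').optionCongr.trans
      (optionSumRight ι (Option ι'))).trans (e.sumCongr e')) ?_
  · rw [kappa_eq_setCumulant H hlaw hu hw]
    simp only [← compl_disjSum]
    rw [← sum_finset_sum_type fun U => expectation H (botStat N a b (w (e' none)) * Q U)
      * expectation H (botStat N a b (w (e' (some none))) * Q Uᶜ)]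
    exact this
  · rintro (i | j)
    · exact congrArg (topStat N a b) (h i)
    · exact congrArg (botStat N a b) (h' j)

include hlaw in
theorem expectation_top_bot (hu : ∀ i, u i ∉ segment a b) (hw : ∀ j, w j ∉ segment a b)
    (e : Option ι ≃ κ₁) (e' : Option ι' ≃ κ₂) (h : ∀ i, u (e (some i)) = v₁ i)
    (h' : ∀ j, w (e' (some j)) = v₂ j) :
    let Q := cumulantDual (expectation H) (statFamily N a b v₁ v₂)
    expectation H (topStat N a b (u (e none)) * botStat N a b (w (e' none)) * Q Finset.univ)
      = kappa P X Y u w + ∑ S : Finset ι, ∑ S' : Finset ι',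
        expectation H (topStat N a b (u (e none)) * Q (S.disjSum S'))
          * expectation H (botStat N a b (w (e' none)) * Q (Sᶜ.disjSum S'ᶜ)) := by
  intro Q
  have := map_mul_mul_cumulantDual_univ (statFamily N a b v₁ v₂) (expectation_one H)
    (statFamily N a b u w) (((optionSumRight ι ι').optionCongr.trans
      (optionSumLeft ι (Option ι'))).trans (e.sumCongr e')) ?_
  · rw [kappa_eq_setCumulant H hlaw hu hw]
    simp only [← compl_disjSum]
    rw [← sum_finset_sum_type fun U => expectation H (topStat N a b (u (e none)) * Q U)
      * expectation H (botStat N a b (w (e' none)) * Q Uᶜ)]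
    exact this
  · rintro (i | j)
    · exact congrArg (topStat N a b) (h i)
    · exact congrArg (botStat N a b) (h' j)

end SecondOrder

/-! ### The analytic terms of the loop equations -/

theorem eventually_notMem_segment {v : ℂ} (hv : v ∉ segment a b) :
    ∀ᶠ z in 𝓝 v, z ∉ segment a b :=
  isClosed_segment.isOpen_compl.mem_nhds hv

theorem contourIntegral_add {γ : ℝ → ℂ} (hγ : IsPiecewiseC1 γ) {f g : ℂ → ℂ}
    (hf : ContinuousOn f (trace γ)) (hg : ContinuousOn g (trace γ)) :
    contourIntegral γ (fun z => f z + g z) = contourIntegral γ f + contourIntegral γ g := by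
  simp only [contourIntegral, add_mul]
  exact intervalIntegral.integral_add (hγ.intervalIntegrable hf) (hγ.intervalIntegrable hg)

section Variation

variable {k : ℕ} {L : (Fin N → ℝ) × (Fin (N - 1) → ℝ) →L[ℝ] (Fin k → ℝ)} (hL : IsLevel a b L)

theorem sub_mul_sub_ne_zero (hab : a ≤ b) {v : ℂ} (hv : v ∉ segment a b) :
    (v - a) * (v - b) ≠ 0 :=
  mul_ne_zero (sub_ne_zero_of_notMem_segment hv (left_mem_Icc.2 hab))
    (sub_ne_zero_of_notMem_segment hv (right_mem_Icc.2 hab))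

/-- As a function of `x`, `h(x) / (w - x)²` has a simple pole at `v`, a double pole at `w` and
vanishes at infinity. It is thus a combination of `1/(v - x)`, `1/(w - x)` and `1/(w - x)²`, whose
coefficients are those produced by differentiating the bracket at `w`; the condition `w ≠ v` keeps
the poles apart. -/
theorem deriv_variation {v : ℂ} (hv : v ∉ segment a b) {w : ℂ} (hw : w ∉ segment a b)
    (hwv : w ≠ v) (Q : smoothFunctions N a b) :
    deriv (fun z => expectation H (stieltjesStat hL v * Q) / (v - z)
        - (z - a) * (z - b) * expectation H (stieltjesStat hL z * Q) /
          ((v - z) * (v - a) * (v - b))) w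
      = expectation H (variationStat hL hv hw * Q) / ((v - a) * (v - b)) := by
  have hD := sub_mul_sub_ne_zero H.lt.le hv
  have hva := left_ne_zero_of_mul hD
  have hvb := right_ne_zero_of_mul hD
  have hvw : v - w ≠ 0 := sub_ne_zero.2 hwv.symm
  have h1 := hasDerivAt_expectation_stieltjesStat hL H hw Q
  have hid := hasDerivAt_id w
  have h2 : HasDerivAt (fun z : ℂ => v - z) (-1) w := hid.const_sub v
  have h3 := ((hasDerivAt_const w (expectation H (stieltjesStat hL v * Q))).div h2 hvw).sub
    ((((hid.sub_const (a : ℂ)).mul (hid.sub_const (b : ℂ))).mul h1).div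
      ((h2.mul_const (v - a : ℂ)).mul_const (v - b : ℂ)) (mul_ne_zero (mul_ne_zero hvw hva) hvb))
  refine (HasDerivAt.deriv (f := fun z => expectation H (stieltjesStat hL v * Q) / (v - z)
        - (z - a) * (z - b) * expectation H (stieltjesStat hL z * Q) /
          ((v - z) * (v - a) * (v - b))) h3).trans ?_
  have key : expectation H (variationStat hL hv hw * Q)
      = expectation H (((v - a) * (v - b) / (v - w) ^ 2) • (stieltjesStat hL v * Q)
        - ((2 * w - a - b) / (v - w) + (w - a) * (w - b) / (v - w) ^ 2) • (stieltjesStat hL w * Q)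
        + ((w - a) * (w - b) / (v - w)) • (stieltjesSqStat hL hw * Q)) := by
    refine expectation_congr H fun p hp => ?_
    change (∑ i, loopField a b v (L p i) * ((w - L p i) ^ 2)⁻¹) * Q.1 p
      = (v - a) * (v - b) / (v - w) ^ 2 * ((stieltjesStat hL v).1 p * Q.1 p)
        - ((2 * w - a - b) / (v - w) + (w - a) * (w - b) / (v - w) ^ 2) *
          ((stieltjesStat hL w).1 p * Q.1 p)
        + (w - a) * (w - b) / (v - w) * ((∑ i, ((w - L p i) ^ 2)⁻¹) * Q.1 p)
    rw [stieltjesStat_apply hL hv, stieltjesStat_apply hL hw]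
    simp only [← mul_assoc, ← sub_mul, ← add_mul]
    congr 1
    simp only [Finset.mul_sum]
    rw [← Finset.sum_sub_distrib, ← Finset.sum_add_distrib]
    refine Finset.sum_congr rfl fun i _ => ?_
    have e1 := sub_ne_zero_of_notMem_segment hv (hL.mem p hp i)
    have e2 := sub_ne_zero_of_notMem_segment hw (hL.mem p hp i)
    rw [loopField]
    field_simp
    ring
  rw [key, map_add, map_sub, map_smul, map_smul, map_smul]
  simp only [smul_eq_mul, id, Pi.mul_apply]
  field_simp
  ring

end Variation

/-- `contourIntegral_expectation` is applied on each level to `g(z) = (z - a)(z - b) V'(z)`, which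
is holomorphic on `M`. -/
theorem contourIntegral_potential {γ : ℝ → ℂ} {M S : Set ℂ}
    (hγ : IsContour γ M (segment a b) S) (hM : IsOpen M) (hVt : AnalyticOnNhd ℂ Vt M)
    (hVb : AnalyticOnNhd ℂ Vb M) {v : ℂ} (hvS : v ∈ S) (hv : v ∉ segment a b)
    (Q : smoothFunctions N a b) :
    contourIntegral γ (fun z => (z - a) * (z - b) *
        (deriv Vt z * expectation H (topStat N a b z * Q)
          + deriv Vb z * expectation H (botStat N a b z * Q)) / ((v - z) * (v - a) * (v - b)))
      = 2 * Real.pi * Complex.I * (expectation H (potentialStat isLevel_fst H.top hv * Q)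
        + expectation H (potentialStat isLevel_snd H.bot hv * Q)) / ((v - a) * (v - b)) := by
  have hγM : trace γ ⊆ M := by
    rintro _ ⟨s, hs, rfl⟩
    exact hγ.mem s hs
  have hseg : ∀ z ∈ trace γ, z ∉ segment a b := by
    rintro _ ⟨s, hs, rfl⟩
    exact hγ.notMem_enclosed s hs
  have hne : ∀ z ∈ trace γ, v - z ≠ 0 := by
    rintro _ ⟨s, hs, rfl⟩ h
    exact hγ.notMem_excluded s hs (by rwa [← sub_eq_zero.1 h])
  have hg : ∀ {V : ℂ → ℂ}, AnalyticOnNhd ℂ V M →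
      DifferentiableOn ℂ (fun z => (z - a) * (z - b) * deriv V z) M := fun hV =>
    ((differentiableOn_id.sub_const _).mul (differentiableOn_id.sub_const _)).mul
      hV.deriv.differentiableOn
  have hc : ∀ {V : ℂ → ℂ}, AnalyticOnNhd ℂ V M → ∀ {k : ℕ}
      {L : (Fin N → ℝ) × (Fin (N - 1) → ℝ) →L[ℝ] (Fin k → ℝ)} (hL : IsLevel a b L),
      ContinuousOn (fun z => (z - a) * (z - b) * deriv V z * (v - z)⁻¹ *
        expectation H (stieltjesStat hL z * Q)) (trace γ) := fun hV k L hL =>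
    (((hg hV).continuousOn.mono hγM).mul
      ((continuousOn_const.sub continuousOn_id).inv₀ hne)).mul fun z hz =>
        (hasDerivAt_expectation_stieltjesStat hL H
          (hseg z hz) Q).continuousAt.continuousWithinAt
  have e1 := contourIntegral_expectation isLevel_fst H hγ hM (hg hVt) hvS hv Q
    (contDiffAt_potential H.top hv)
  have e2 := contourIntegral_expectation isLevel_snd H hγ hM (hg hVb) hvS hv Q
    (contDiffAt_potential H.bot hv)
  have e3 := contourIntegral_add hγ.piecewiseC1 (hc hVt isLevel_fst) (hc hVb isLevel_snd)
  rw [e1, e2] at e3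
  have e4 := contourIntegral_const_mul (γ := γ) ((v - a) * (v - b))⁻¹ fun z =>
    (z - a) * (z - b) * deriv Vt z * (v - z)⁻¹ * expectation H (topStat N a b z * Q)
      + (z - a) * (z - b) * deriv Vb z * (v - z)⁻¹ * expectation H (botStat N a b z * Q)
  rw [e3] at e4
  refine (contourIntegral_congr fun z _ => ?_).trans (e4.trans ?_)
  · rw [div_eq_mul_inv, mul_assoc (v - z), mul_inv]
    ring
  · rw [potentialStat, potentialStat]
    ring

/-- The loop equations, for expectations against the dual elements. -/
theorem loop_equation_dual (hN : 1 ≤ N) {γ : ℝ → ℂ} {M S : Set ℂ}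
    (hγ : IsContour γ M (segment a b) S) (hM : IsOpen M) (hVt : AnalyticOnNhd ℂ Vt M)
    (hVb : AnalyticOnNhd ℂ Vb M) {v : ℂ} (hvS : v ∈ S) (hv : v ∉ segment a b)
    {ι ι' : Type*} [Fintype ι] [DecidableEq ι] [Fintype ι'] [DecidableEq ι']
    {v₁ : ι → ℂ} {v₂ : ι' → ℂ} (h₁ : ∀ i, v₁ i ∉ segment a b) (h₂ : ∀ j, v₂ j ∉ segment a b)
    (h₁v : ∀ i, v₁ i ≠ v) (h₂v : ∀ j, v₂ j ≠ v) :
    let Q := cumulantDual (expectation H) (statFamily N a b v₁ v₂)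
    0 = - (N * θ / (2 * Real.pi * Complex.I) * contourIntegral γ fun z => (z - a) * (z - b) *
        (deriv Vt z * expectation H (topStat N a b z * Q Finset.univ)
          + deriv Vb z * expectation H (botStat N a b z * Q Finset.univ)) /
            ((v - z) * (v - a) * (v - b)))
      - ((N : ℂ) ^ 2 - (1 - θ) * N * (N - 1)) / ((v - a) * (v - b)) * expectation H (Q Finset.univ)
      - (deriv (fun z => expectation H (topStat N a b z * Q Finset.univ)) v
        + deriv (fun z => expectation H (botStat N a b z * Q Finset.univ)) v) / 2
      + (expectation H (topStat N a b v * topStat N a b v * Q Finset.univ)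
        + expectation H (botStat N a b v * botStat N a b v * Q Finset.univ)) / 2
      - (1 - θ) * expectation H (topStat N a b v * botStat N a b v * Q Finset.univ)
      + ∑ i, deriv (fun w =>
        expectation H (topStat N a b v * Q (Finset.univ.erase (Sum.inl i))) / (v - w)
          - (w - a) * (w - b) *
            expectation H (topStat N a b w * Q (Finset.univ.erase (Sum.inl i))) /
              ((v - w) * (v - a) * (v - b))) (v₁ i)
      + ∑ j, deriv (fun w =>
        expectation H (botStat N a b v * Q (Finset.univ.erase (Sum.inr j))) / (v - w)
          - (w - a) * (w - b) *
            expectation H (botStat N a b w * Q (Finset.univ.erase (Sum.inr j))) /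
              ((v - w) * (v - a) * (v - b))) (v₂ j) := by
  intro Q
  have hD := sub_mul_sub_ne_zero H.lt.le hv
  have key := loop_equation_expectation H hN hv (statFamily N a b v₁ v₂)
    (Sum.elim (fun i => variationStat isLevel_fst hv (h₁ i))
      fun j => variationStat isLevel_snd hv (h₂ j)) ?_ Finset.univ
  · rw [contourIntegral_potential H hγ hM hVt hVb hvS hv,
      (hasDerivAt_expectation_stieltjesStat isLevel_fst H hv _).deriv,
      (hasDerivAt_expectation_stieltjesStat isLevel_snd H hv _).deriv]
    rw [Finset.sum_congr rfl fun i _ => deriv_variation H isLevel_fst hv (h₁ i) (h₁v i)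
        (Q (Finset.univ.erase (Sum.inl i))),
      Finset.sum_congr rfl fun j _ => deriv_variation H isLevel_snd hv (h₂ j) (h₂v j)
        (Q (Finset.univ.erase (Sum.inr j))), ← Finset.sum_div, ← Finset.sum_div]
    extract_lets Gt Gb at key
    rw [Fintype.sum_sum_type] at key
    have hpi : (Real.pi : ℂ) ≠ 0 := by simp [Real.pi_ne_zero]
    simp only [Gt, Gb, Sum.elim_inl, Sum.elim_inr] at key
    simp only [topStat, botStat] at key ⊢
    -- After division by `p(v)` only its being nonzero matters, so it is treated as an unknown.
    generalize (v - a) * (v - b) = D at hD key ⊢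
    field_simp
    linear_combination (-2) * key
  · rintro (i | j) p hp
    · exact derivAt_stieltjesStat isLevel_fst hv (h₁ i) hp
    · exact derivAt_stieltjesStat isLevel_snd hv (h₂ j) hp

end Kappa

/-! ### The loop equations in terms of cumulants. -/

section Main

open Set Filter Topology

variable {Ω : Type*} [MeasurableSpace Ω] {P : Measure Ω} {N : ℕ} {θ a b : ℝ} {Vt Vb : ℂ → ℂ}
  {X : Ω → Fin N → ℝ} {Y : Ω → Fin (N - 1) → ℝ} (H : Admissible θ a b Vt Vb)
  (hlaw : HasLaw (fun ω => (X ω, Y ω)) (law N θ a b Vt Vb) P)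
  {ι ι' : Type} [Fintype ι] [DecidableEq ι] [Fintype ι'] [DecidableEq ι']
  {v₁ : ι → ℂ} {v₂ : ι' → ℂ} (h₁ : ∀ i, v₁ i ∉ segment a b) (h₂ : ∀ j, v₂ j ∉ segment a b)

/-! ### The cumulants in the loop equations -/

theorem adjoin_notMem {κ : Type} {z : ℂ} {u : κ → ℂ} {K : Set ℂ} (hz : z ∉ K) (hu : ∀ i, u i ∉ K) :
    ∀ i, adjoin z u i ∉ K
  | none => hz
  | some i => hu i

omit [Fintype ι] in
theorem update_notMem {z : ℂ} {u : ι → ℂ} {K : Set ℂ} (hz : z ∉ K) (hu : ∀ i, u i ∉ K) (i : ι) :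
    ∀ k, Function.update u i z k ∉ K := fun k => by
  by_cases h : k = i
  · subst h
    rwa [Function.update_self]
  · rw [Function.update_of_ne h]
    exact hu k

include H hlaw h₁ h₂

theorem kappa_adjoin_left {z : ℂ} (hz : z ∉ segment a b) :
    kappa P X Y (adjoin z v₁) v₂ = expectation H (topStat N a b z *
      cumulantDual (expectation H) (statFamily N a b v₁ v₂) Finset.univ) := by
  rw [kappa_eq_top H hlaw (v₁ := v₁) (v₂ := v₂) (adjoin_notMem hz h₁) h₂ (Equiv.refl _)
    (Equiv.refl _) (Function.Embedding.refl _) (Function.Embedding.refl _) (fun _ => rfl)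
    fun _ => rfl]
  congr 3
  ext (i | j) <;> simp

theorem kappa_adjoin_right {z : ℂ} (hz : z ∉ segment a b) :
    kappa P X Y v₁ (adjoin z v₂) = expectation H (botStat N a b z *
      cumulantDual (expectation H) (statFamily N a b v₁ v₂) Finset.univ) := by
  rw [kappa_eq_bot H hlaw (v₁ := v₁) (v₂ := v₂) h₁ (adjoin_notMem hz h₂) (Equiv.refl _)
    (Equiv.refl _) (Function.Embedding.refl _) (Function.Embedding.refl _) (fun _ => rfl)
    fun _ => rfl]
  congr 3
  ext (i | j) <;> simp

omit [Fintype ι] [Fintype ι'] in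
theorem kappa_adjoin_sub_left {z : ℂ} (hz : z ∉ segment a b) (S : Finset ι) (S' : Finset ι') :
    kappa P X Y (adjoin z (sub v₁ S)) (sub v₂ S') = expectation H (topStat N a b z *
      cumulantDual (expectation H) (statFamily N a b v₁ v₂) (S.disjSum S')) := by
  rw [kappa_eq_top H hlaw (v₁ := v₁) (v₂ := v₂) (u := adjoin z (sub v₁ S)) (w := sub v₂ S')
    (adjoin_notMem hz fun i => h₁ i)
    (fun j => h₂ j) (Equiv.refl _) (Equiv.refl _) (Function.Embedding.subtype _)
    (Function.Embedding.subtype _) (fun _ => rfl) fun _ => rfl]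
  congr 3
  ext (i | j) <;> simp

omit [Fintype ι] [Fintype ι'] in
theorem kappa_adjoin_sub_right {z : ℂ} (hz : z ∉ segment a b) (S : Finset ι) (S' : Finset ι') :
    kappa P X Y (sub v₁ S) (adjoin z (sub v₂ S')) = expectation H (botStat N a b z *
      cumulantDual (expectation H) (statFamily N a b v₁ v₂) (S.disjSum S')) := by
  rw [kappa_eq_bot H hlaw (v₁ := v₁) (v₂ := v₂) (u := sub v₁ S) (w := adjoin z (sub v₂ S'))
    (fun i => h₁ i)
    (adjoin_notMem hz fun j => h₂ j) (Equiv.refl _) (Equiv.refl _)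
    (Function.Embedding.subtype _) (Function.Embedding.subtype _) (fun _ => rfl) fun _ => rfl]
  congr 3
  ext (i | j) <;> simp

theorem kappa_adjoin_sub_compl_left {z : ℂ} (hz : z ∉ segment a b) (i : ι) :
    kappa P X Y (adjoin z (sub v₁ {i}ᶜ)) v₂ = expectation H (topStat N a b z *
      cumulantDual (expectation H) (statFamily N a b v₁ v₂) (Finset.univ.erase (Sum.inl i))) := by
  rw [kappa_eq_top H hlaw (v₁ := v₁) (v₂ := v₂) (u := adjoin z (sub v₁ {i}ᶜ)) (w := v₂)
    (adjoin_notMem hz fun i => h₁ i) h₂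
    (Equiv.refl _) (Equiv.refl _) (Function.Embedding.subtype _) (Function.Embedding.refl _)
    (fun _ => rfl) fun _ => rfl]
  congr 3
  ext (i | j) <;> simp

theorem kappa_adjoin_sub_compl_right {z : ℂ} (hz : z ∉ segment a b) (j : ι') :
    kappa P X Y v₁ (adjoin z (sub v₂ {j}ᶜ)) = expectation H (botStat N a b z *
      cumulantDual (expectation H) (statFamily N a b v₁ v₂) (Finset.univ.erase (Sum.inr j))) := by
  rw [kappa_eq_bot H hlaw (v₁ := v₁) (v₂ := v₂) (u := v₁) (w := adjoin z (sub v₂ {j}ᶜ))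
    h₁ (adjoin_notMem hz fun j => h₂ j)
    (Equiv.refl _) (Equiv.refl _) (Function.Embedding.refl _) (Function.Embedding.subtype _)
    (fun _ => rfl) fun _ => rfl]
  congr 3
  ext (i | j) <;> simp

theorem kappa_update_left {z : ℂ} (hz : z ∉ segment a b) (i : ι) :
    kappa P X Y (Function.update v₁ i z) v₂ = expectation H (topStat N a b z *
      cumulantDual (expectation H) (statFamily N a b v₁ v₂) (Finset.univ.erase (Sum.inl i))) := by
  rw [kappa_eq_top H hlaw (v₁ := v₁) (v₂ := v₂) (update_notMem hz h₁ i) h₂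
    (Equiv.optionSubtypeNe i) (Equiv.refl _) (Function.Embedding.subtype _)
    (Function.Embedding.refl _) (fun k => by simp [Function.update_of_ne k.2]) fun _ => rfl]
  simp only [Equiv.optionSubtypeNe_none, Function.update_self]
  congr 3
  ext (i | j) <;> simp

theorem kappa_update_right {z : ℂ} (hz : z ∉ segment a b) (j : ι') :
    kappa P X Y v₁ (Function.update v₂ j z) = expectation H (botStat N a b z *
      cumulantDual (expectation H) (statFamily N a b v₁ v₂) (Finset.univ.erase (Sum.inr j))) := by
  rw [kappa_eq_bot H hlaw (v₁ := v₁) (v₂ := v₂) h₁ (update_notMem hz h₂ j)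
    (Equiv.refl _) (Equiv.optionSubtypeNe j) (Function.Embedding.refl _)
    (Function.Embedding.subtype _) (fun _ => rfl) fun k => by simp [Function.update_of_ne k.2]]
  simp only [Equiv.optionSubtypeNe_none, Function.update_self]
  congr 3
  ext (i | j) <;> simp

/-- With the other points fixed, the cumulant is the expectation of `G(z)` against an observable
that does not depend on `z`. -/
theorem differentiableAt_kappa_update_left (i : ι) :
    DifferentiableAt ℂ (fun z => kappa P X Y (Function.update v₁ i z) v₂) (v₁ i) := by
  have h := (eventually_notMem_segment (h₁ i)).mono fun z hz =>
    kappa_update_left H hlaw h₁ h₂ hz i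
  exact (hasDerivAt_expectation_stieltjesStat isLevel_fst H (h₁ i)
    _).differentiableAt.congr_of_eventuallyEq h

theorem differentiableAt_kappa_update_right (j : ι') :
    DifferentiableAt ℂ (fun z => kappa P X Y v₁ (Function.update v₂ j z)) (v₂ j) := by
  have h := (eventually_notMem_segment (h₂ j)).mono fun z hz =>
    kappa_update_right H hlaw h₁ h₂ hz j
  exact (hasDerivAt_expectation_stieltjesStat isLevel_snd H (h₂ j)
    _).differentiableAt.congr_of_eventuallyEq h

omit h₁ h₂ [Fintype ι] [DecidableEq ι] [Fintype ι'] [DecidableEq ι'] in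
theorem rankExpr_eq_zero (hN : 1 ≤ N) {γ : ℝ → ℂ} {M S : Set ℂ}
    (hγ : IsContour γ M (segment a b) S) (hM : IsOpen M) (hVt : AnalyticOnNhd ℂ Vt M)
    (hVb : AnalyticOnNhd ℂ Vb M) {v : ℂ} (hvS : v ∈ S) (hv : v ∉ segment a b)
    {m n : ℕ} (hmn : 1 ≤ m + n) {v₁ : Fin m → ℂ} {v₂ : Fin n → ℂ}
    (h₁ : ∀ i, v₁ i ∉ segment a b) (h₂ : ∀ j, v₂ j ∉ segment a b)
    (h₁v : ∀ i, v₁ i ≠ v) (h₂v : ∀ j, v₂ j ≠ v) :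
    rankExpr P X Y θ a b Vt Vb γ v v₁ v₂ = 0 := by
  have key := loop_equation_dual H hN hγ hM hVt hVb hvS hv h₁ h₂ h₁v h₂v
  extract_lets Q at key
  have hseg : ∀ z ∈ trace γ, z ∉ segment a b := by
    rintro _ ⟨s, hs, rfl⟩
    exact hγ.notMem_enclosed s hs
  -- Since at least one point is present, the constant term of the Ward identity drops out; it
  -- survives in rank `(0, 0)` only.
  have hQ : expectation H (Q Finset.univ) = 0 := by
    refine (map_cumulantDual _ (expectation_one H) _).trans (if_neg fun h => ?_)
    have : Fintype.card (Fin m ⊕ Fin n) = 0 := by rw [← Finset.card_univ, h, Finset.card_empty]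
    simp only [Fintype.card_sum, Fintype.card_fin] at this
    omega
  -- The formulas for the cumulants hold off the segment, an open set. They can be used on the
  -- contour and, for the derivatives, in a neighbourhood of each point.
  rw [rankExpr, contourIntegral_congr fun z hz => by
      rw [kappa_adjoin_left H hlaw h₁ h₂ (hseg z hz), kappa_adjoin_right H hlaw h₁ h₂ (hseg z hz)],
    Filter.EventuallyEq.deriv_eq (f₁ := fun z => kappa P X Y (adjoin z v₁) v₂)
      ((eventually_notMem_segment hv).mono fun z hz => kappa_adjoin_left H hlaw h₁ h₂ hz),
    Filter.EventuallyEq.deriv_eq (f₁ := fun z => kappa P X Y v₁ (adjoin z v₂))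
      ((eventually_notMem_segment hv).mono fun z hz => kappa_adjoin_right H hlaw h₁ h₂ hz),
    Finset.sum_congr rfl fun i _ => Filter.EventuallyEq.deriv_eq
      ((eventually_notMem_segment (h₁ i)).mono fun w hw => by
        rw [kappa_update_left H hlaw h₁ h₂ hw i, kappa_adjoin_sub_compl_left H hlaw h₁ h₂ hv i]),
    Finset.sum_congr (s₁ := (Finset.univ : Finset (Fin n))) rfl fun j _ =>
      Filter.EventuallyEq.deriv_eq ((eventually_notMem_segment (h₂ j)).mono fun w hw => by
        rw [kappa_update_right H hlaw h₁ h₂ hw j,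
          kappa_adjoin_sub_compl_right H hlaw h₁ h₂ hv j])]
  simp only [kappa_adjoin_sub_left H hlaw h₁ h₂ hv, kappa_adjoin_sub_right H hlaw h₁ h₂ hv,
    Finset.sum_add_distrib, Finset.sum_sub_distrib, ← Finset.mul_sum]
  have ett : expectation H (topStat N a b v * topStat N a b v * Q Finset.univ)
      = kappa P X Y (adjoin v (adjoin v v₁)) v₂
        + ∑ S : Finset (Fin m), ∑ S' : Finset (Fin n),
          expectation H (topStat N a b v * Q (S.disjSum S')) *
            expectation H (topStat N a b v * Q (Sᶜ.disjSum S'ᶜ)) :=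
    expectation_top_top H hlaw (adjoin_notMem hv (adjoin_notMem hv h₁)) h₂ (Equiv.refl _)
      (Equiv.refl _) (fun _ => rfl) fun _ => rfl
  have ebb : expectation H (botStat N a b v * botStat N a b v * Q Finset.univ)
      = kappa P X Y v₁ (adjoin v (adjoin v v₂))
        + ∑ S : Finset (Fin m), ∑ S' : Finset (Fin n),
          expectation H (botStat N a b v * Q (S.disjSum S')) *
            expectation H (botStat N a b v * Q (Sᶜ.disjSum S'ᶜ)) :=
    expectation_bot_bot H hlaw h₁ (adjoin_notMem hv (adjoin_notMem hv h₂)) (Equiv.refl _)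
      (Equiv.refl _) (fun _ => rfl) fun _ => rfl
  have etb : expectation H (topStat N a b v * botStat N a b v * Q Finset.univ)
      = kappa P X Y (adjoin v v₁) (adjoin v v₂)
        + ∑ S : Finset (Fin m), ∑ S' : Finset (Fin n),
          expectation H (topStat N a b v * Q (S.disjSum S')) *
            expectation H (botStat N a b v * Q (Sᶜ.disjSum S'ᶜ)) :=
    expectation_top_bot H hlaw (adjoin_notMem hv h₁) (adjoin_notMem hv h₂) (Equiv.refl _)
      (Equiv.refl _) (fun _ => rfl) fun _ => rfl
  rw [hQ, ett, ebb, etb] at key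
  linear_combination -key

omit h₁ h₂ [Fintype ι] [DecidableEq ι] [Fintype ι'] [DecidableEq ι'] in
theorem rankZeroExpr_eq_zero (hN : 1 ≤ N) {γ : ℝ → ℂ} {M S : Set ℂ}
    (hγ : IsContour γ M (segment a b) S) (hM : IsOpen M) (hVt : AnalyticOnNhd ℂ Vt M)
    (hVb : AnalyticOnNhd ℂ Vb M) {v : ℂ} (hvS : v ∈ S) (hv : v ∉ segment a b) :
    rankZeroExpr P X Y θ a b Vt Vb γ v = 0 := by
  have h0 : ∀ i, (![] : Fin 0 → ℂ) i ∉ segment a b := fun i => i.elim0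
  have h1 : ∀ {z}, z ∉ segment a b → ∀ i, (![z] : Fin 1 → ℂ) i ∉ segment a b := fun hz i => by
    simpa using hz
  have h2 : ∀ i, (![v, v] : Fin 2 → ℂ) i ∉ segment a b := fun i => by
    fin_cases i <;> simpa using hv
  have key := loop_equation_dual H hN hγ hM hVt hVb hvS hv h0 h0 (fun i => i.elim0)
    fun i => i.elim0
  extract_lets Q at key
  have hseg : ∀ z ∈ trace γ, z ∉ segment a b := by
    rintro _ ⟨s, hs, rfl⟩
    exact hγ.notMem_enclosed s hs
  -- There are no further points, so the test function is `1` and every second-order expansion has a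
  -- single splitting.
  have hQ1 : ∀ T, Q T = 1 := fun T => by
    rw [Finset.eq_empty_of_isEmpty T]
    exact cumulantDual_empty _
  have kt : ∀ z, z ∉ segment a b →
      kappa P X Y ![z] ![] = expectation H (topStat N a b z * 1) := fun z hz => by
    rw [kappa_eq_top H hlaw (h1 hz) h0 (finSuccEquiv 0).symm (Equiv.refl _)
      (Function.Embedding.refl _) (Function.Embedding.refl _) (v₁ := ![]) (v₂ := ![])
      (fun i => i.elim0) fun i => i.elim0]
    exact congrArg (fun q => expectation H (topStat N a b z * q)) (hQ1 _)
  have kb : ∀ z, z ∉ segment a b →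
      kappa P X Y ![] ![z] = expectation H (botStat N a b z * 1) := fun z hz => by
    rw [kappa_eq_bot H hlaw h0 (h1 hz) (Equiv.refl _) (finSuccEquiv 0).symm
      (Function.Embedding.refl _) (Function.Embedding.refl _) (v₁ := ![]) (v₂ := ![])
      (fun i => i.elim0) fun i => i.elim0]
    exact congrArg (fun q => expectation H (botStat N a b z * q)) (hQ1 _)
  -- Any bijection serves, because both points of `![v, v]` are equal to `v`.
  have e2 : Option (Option (Fin 0)) ≃ Fin 2 :=
    (finSuccEquiv 0).symm.optionCongr.trans (finSuccEquiv 1).symm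
  have hv2 : ∀ i, (![v, v] : Fin 2 → ℂ) i = v := fun i => by fin_cases i <;> rfl
  have hv1 : ∀ i, (![v] : Fin 1 → ℂ) i = v := fun i => by simp
  have ett := expectation_top_top H hlaw (v₁ := ![]) (v₂ := ![]) h2 h0 e2 (Equiv.refl _)
    (fun i => i.elim0) fun i => i.elim0
  have ebb := expectation_bot_bot H hlaw (v₁ := ![]) (v₂ := ![]) h0 h2 (Equiv.refl _) e2
    (fun i => i.elim0) fun i => i.elim0
  have etb := expectation_top_bot H hlaw (v₁ := ![]) (v₂ := ![]) (h1 hv) (h1 hv)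
    (finSuccEquiv 0).symm (finSuccEquiv 0).symm (fun i => i.elim0) fun i => i.elim0
  extract_lets at ett ebb etb
  simp only [hv2, hv1] at ett ebb etb
  change _ = _ + ∑ S : Finset (Fin 0), ∑ S' : Finset (Fin 0),
    expectation H (_ * Q _) * expectation H (_ * Q _) at ett ebb etb
  simp only [hQ1, Finset.univ_unique, Finset.sum_singleton] at ett ebb etb
  rw [rankZeroExpr, contourIntegral_congr (g := fun z => (z - a) * (z - b) *
        (deriv Vt z * expectation H (topStat N a b z * 1)
          + deriv Vb z * expectation H (botStat N a b z * 1)) /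
            ((v - z) * (v - a) * (v - b))) fun z hz => by
      rw [kt z (hseg z hz), kb z (hseg z hz)]
      ring,
    Filter.EventuallyEq.deriv_eq (f₁ := fun z => kappa P X Y ![z] ![])
      ((eventually_notMem_segment hv).mono kt),
    Filter.EventuallyEq.deriv_eq (f₁ := fun z => kappa P X Y ![] ![z])
      ((eventually_notMem_segment hv).mono kb), kt v hv, kb v hv]
  simp only [hQ1, expectation_one, Finset.univ_eq_empty, Finset.sum_empty] at key
  linear_combination -key - ett / 2 - ebb / 2 + (1 - θ) * etb

end Main

end TwoLevel

end


theorem mainTheorem5 {Ω : Type*} [MeasurableSpace Ω] (P : MeasureTheory.Measure Ω)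
    [MeasureTheory.IsProbabilityMeasure P]
    (N : ℕ) (hN : 2 ≤ N) (θ : ℝ) (hθ : 1 ≤ θ) (a b : ℝ) (hab : a < b)
    (M : Set ℂ) (hM : IsOpen M) (habM : TwoLevel.segment a b ⊆ M)
    (Vt Vb : ℂ → ℂ) (hVt : AnalyticOnNhd ℂ Vt M) (hVb : AnalyticOnNhd ℂ Vb M)
    (hVt_real : ∀ x : ℝ, x ∈ Set.Icc a b → (Vt x).im = 0)
    (hVb_real : ∀ x : ℝ, x ∈ Set.Icc a b → (Vb x).im = 0)
    (X : Ω → Fin N → ℝ) (Y : Ω → Fin (N - 1) → ℝ) :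
    MeasureTheory.IsProbabilityMeasure (TwoLevel.law N θ a b Vt Vb) ∧
    (ProbabilityTheory.HasLaw (fun ω => (X ω, Y ω)) (TwoLevel.law N θ a b Vt Vb) P →
      -- the cumulants are holomorphic in each of their points
      (∀ (ι ι' : Type) [Fintype ι] [DecidableEq ι] [Fintype ι'] [DecidableEq ι']
        (u : ι → ℂ) (w : ι' → ℂ), (∀ i, u i ∉ TwoLevel.segment a b) →
        (∀ j, w j ∉ TwoLevel.segment a b) →
        (∀ i, DifferentiableAt ℂ
          (fun z => TwoLevel.kappa P X Y (Function.update u i z) w) (u i)) ∧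
        (∀ j, DifferentiableAt ℂ
          (fun z => TwoLevel.kappa P X Y u (Function.update w j z)) (w j))) ∧
      -- the loop equation of rank `(0, 0)`
      (∀ v : ℂ, v ∉ TwoLevel.segment a b →
        ∀ γ : ℝ → ℂ, TwoLevel.IsContour γ M (TwoLevel.segment a b) {v} →
        0 = TwoLevel.rankZeroExpr P X Y θ a b Vt Vb γ v) ∧
      -- the loop equation of rank `(m, n)`
      (∀ m n : ℕ, 1 ≤ m + n → ∀ (v : ℂ) (v₁ : Fin m → ℂ) (v₂ : Fin n → ℂ),
        v ∉ TwoLevel.segment a b →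
        (∀ i, v₁ i ∉ TwoLevel.segment a b) → (∀ j, v₂ j ∉ TwoLevel.segment a b) →
        (∀ i, v₁ i ≠ v) → (∀ j, v₂ j ≠ v) →
        ∀ γ : ℝ → ℂ, TwoLevel.IsContour γ M (TwoLevel.segment a b)
          ({v} ∪ Set.range v₁ ∪ Set.range v₂) →
        0 = TwoLevel.rankExpr P X Y θ a b Vt Vb γ v v₁ v₂)) := by
  have hmem : ∀ x ∈ Set.Icc a b, (x : ℂ) ∈ M := fun x hx => habM ⟨x, hx, rfl⟩
  have H : TwoLevel.Admissible θ a b Vt Vb :=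
    ⟨hab, hθ, fun x hx => hVt _ (hmem x hx), fun x hx => hVb _ (hmem x hx), hVt_real, hVb_real⟩
  have hN' : 1 ≤ N := one_le_two.trans hN
  refine ⟨H.isProbabilityMeasure, fun hlaw => ⟨fun ι ι' _ _ _ _ u w hu hw =>
    ⟨TwoLevel.differentiableAt_kappa_update_left H hlaw hu hw,
      TwoLevel.differentiableAt_kappa_update_right H hlaw hu hw⟩,
    fun v hv γ hγ =>
      (TwoLevel.rankZeroExpr_eq_zero H hlaw hN' hγ hM hVt hVb rfl hv).symm,
    fun m n hmn v v₁ v₂ hv h₁ h₂ h₁v h₂v γ hγ =>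
      (TwoLevel.rankExpr_eq_zero H hlaw hN' hγ hM hVt hVb (by simp) hv hmn h₁ h₂ h₁v h₂v).symm⟩⟩
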